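/- **Theorem 1.** Let $X$ be the plane $\mathbb{R}^2$ or a flat torus $\mathbb{R}^2/\Lambda$, where $\Lambda\subset\mathbb{R}^2$ is a lattice of rank two, and consider the billiard whose table $D\subset X$ is the complement of a union of finitely many open unit disks (the scatterers) with disjoint closures (in the torus, the closed unit disks around all the lifts of the centres to $\mathbb{R}^2$ are pairwise disjoint). Orbits move along straight segments in $D$ and are reflected elastically at the boundary. A collision is grazing if its angle of incidence, i.e. the signed angle in $[-\frac{\pi}{2},\frac{\pi}{2}]$ between the trajectory and the normal of the scatterer, is $\pm\frac{\pi}{2}$, that is, if the trajectory is tangent to the scatterer there; an orbit is singular if it has a grazing collision. For every $\varepsilon>0$ and every $\alpha_0$ with $|\alpha_0|<\frac{\pi}{6}$ there is a $\delta>0$, depending only on $\varepsilon$, $\alpha_0$, $X$ and the positions of the scatterers, such that the following holds. Take any scatterer, called scatterer $0$, and any periodic orbit such that * there is exactly one collision with scatterer $0$ per period, and its angle of incidence is $\alpha_0$; * some segment of the trajectory passes within a distance $R<\delta$ of the boundary of scatterer $0$ without colliding with it there (after lifting to $\mathbb{R}^2$: some segment between two consecutive collision points passes within distance $R<\delta$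 of the boundary of a lift of scatterer $0$ that carries neither endpoint of the segment). Then there are $T\ge 0$, a continuous motion $C:[0,T]\to\mathbb{R}^2$ of the centre of scatterer $0$, starting at its given position and staying within distance $\varepsilon$ of it, all other scatterers being fixed, and a family of periodic orbits, indexed by $\gamma\in[0,T]$, such that for every $\gamma$ the closed disks remain disjoint and the orbit with index $\gamma$ is a periodic orbit of the billiard with scatterer $0$ centred at $C(\gamma)$; the orbit with index $0$ is the given one; the collision points depend continuously on $\gamma$, and their number per period and the scatterers on which they lie do not change (the contact points of tangencies that occur at $\gamma=T$ in the interior of a segment are not counted here); for $\gamma<T$ the orbit is not singular, and for $\gamma=T$ it is singular. -/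

import Mathlib

/-- The Euclidean plane. A billiard in a flat torus `ℝ² / Λ` is described by its lift to the plane,
where every scatterer is repeated along `Λ`; a billiard in the plane is the case `Λ = ⊥`. -/
abbrev Plane : Type := EuclideanSpace ℝ (Fin 2)

/-- The open unit disks with centres `c i` in `ℝ² / Λ` have disjoint closures: in the plane, the
closed unit disks around any two distinct lifts of centres are disjoint. -/
def IsBilliard {ι : Type*} (Λ : Submodule ℤ Plane) (c : ι → Plane) : Prop :=
  ∀ i j : ι, ∀ a ∈ Λ, (i ≠ j ∨ a ≠ 0) →
    Disjoint (Metric.closedBall (c i) 1) (Metric.closedBall (c j + a) 1)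

/-- The (lifted) billiard table: the complement of all the open unit disks. -/
def billiardTable {ι : Type*} (Λ : Submodule ℤ Plane) (c : ι → Plane) : Set Plane :=
  {x | ∀ i : ι, ∀ a ∈ Λ, x ∉ Metric.ball (c i + a) 1}

/-- The unit direction in which the particle travels from the collision point `Q k` to `Q (k + 1)`,
where `Q` is the sequence of collision points. -/
noncomputable def direction (Q : ℤ → Plane) (k : ℤ) : Plane :=
  ‖Q (k + 1) - Q k‖⁻¹ • (Q (k + 1) - Q k)

/-- `Q : ℤ → Plane` is the bi-infinite sequence of collision points of (the lift of) a billiard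
orbit that is periodic in `ℝ² / Λ`, with `N` collisions per period. The `k`-th collision is with
the lift centred at `c (σ k) + g k` of the scatterer `σ k`, and the lifted orbit is translated by
the vector `w ∈ Λ` after one period. -/
structure IsPeriodicOrbit {ι : Type*} (Λ : Submodule ℤ Plane) (c : ι → Plane)
    (N : ℕ) (σ : ℤ → ι) (g : ℤ → Plane) (w : Plane) (Q : ℤ → Plane) : Prop where
  period_pos : 0 < N
  g_mem : ∀ k, g k ∈ Λ
  w_mem : w ∈ Λ
  σ_periodic : ∀ k, σ (k + N) = σ k
  g_periodic : ∀ k, g (k + N) = g k + w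
  Q_periodic : ∀ k, Q (k + N) = Q k + w
  /-- each collision point lies on the boundary of its scatterer -/
  mem_boundary : ∀ k, Q k ∈ Metric.sphere (c (σ k) + g k) 1
  ne_next : ∀ k, Q k ≠ Q (k + 1)
  /-- the particle stays in the table between two collisions -/
  segment_subset : ∀ k, segment ℝ (Q k) (Q (k + 1)) ⊆ billiardTable Λ c
  /-- elastic reflection at `Q k`, where the unit normal is `Q k - (c (σ k) + g k)` -/
  reflection : ∀ k, direction Q k = direction Q (k - 1) -
    (2 * inner ℝ (direction Q (k - 1)) (Q k - (c (σ k) + g k))) • (Q k - (c (σ k) + g k))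

/-- The orbit is singular: somewhere its trajectory touches the boundary of a scatterer in a
direction tangent to it (a grazing collision, with angle of incidence `± π / 2`). The point of
tangency may be one of the `Q k` or an inner point of a segment. -/
def IsSingularOrbit {ι : Type*} (Λ : Submodule ℤ Plane) (c : ι → Plane) (Q : ℤ → Plane) : Prop :=
  ∃ k : ℤ, ∃ i : ι, ∃ a ∈ Λ, ∃ x ∈ segment ℝ (Q k) (Q (k + 1)),
    x ∈ Metric.sphere (c i + a) 1 ∧ inner ℝ (x - (c i + a)) (Q (k + 1) - Q k) = 0

/-- The absolute value of the angle of incidence (equal to the angle of reflection) at `Q k`: the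
angle between the outer normal of the scatterer at `Q k` and the outgoing segment. -/
noncomputable def incidenceAngle {ι : Type*} (c : ι → Plane) (σ : ℤ → ι) (g : ℤ → Plane)
    (Q : ℤ → Plane) (k : ℤ) : ℝ :=
  InnerProductGeometry.angle (Q k - (c (σ k) + g k)) (Q (k + 1) - Q k)

/-- Some segment of the trajectory passes at distance less than `δ` from the boundary of a lift of
the scatterer `i₀` other than the lifts (if any) with which it collides at its two ends. -/
def PassesWithin {ι : Type*} (Λ : Submodule ℤ Plane) (c : ι → Plane) (σ : ℤ → ι) (g : ℤ → Plane)
    (Q : ℤ → Plane) (i₀ : ι) (δ : ℝ) : Prop :=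
  ∃ k : ℤ, ∃ a ∈ Λ, ¬ (σ k = i₀ ∧ g k = a) ∧ ¬ (σ (k + 1) = i₀ ∧ g (k + 1) = a) ∧
    ∃ x ∈ segment ℝ (Q k) (Q (k + 1)), ∃ y ∈ Metric.sphere (c i₀ + a) 1, dist x y < δ

/-- The determinant of two vectors of the plane. -/
def planeCross (a b : Plane) : ℝ := a 0 * b 1 - a 1 * b 0

/-- Rotation of the plane by a right angle. -/
noncomputable def planeRot (a : Plane) : Plane := !₂[-a 1, a 0]

theorem plane_inner_eq (a b : Plane) : inner ℝ a b = a 0 * b 0 + a 1 * b 1 := by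
  simp [PiLp.inner_apply, Fin.sum_univ_two, mul_comm]

theorem plane_norm_sq (a : Plane) : ‖a‖ ^ 2 = a 0 ^ 2 + a 1 ^ 2 := by
  rw [EuclideanSpace.norm_sq_eq, Fin.sum_univ_two]; simp

theorem plane_unit {a : Plane} (h : ‖a‖ = 1) : a 0 ^ 2 + a 1 ^ 2 = 1 := by
  rw [← plane_norm_sq, h]; norm_num

theorem plane_ext {a b : Plane} (h₀ : a 0 = b 0) (h₁ : a 1 = b 1) : a = b := by
  ext i; fin_cases i <;> assumption

theorem planeRot_zero (a : Plane) : planeRot a 0 = -a 1 := rfl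

theorem planeRot_one (a : Plane) : planeRot a 1 = a 0 := rfl

theorem norm_planeRot (a : Plane) : ‖planeRot a‖ = ‖a‖ := by
  have : ‖planeRot a‖ ^ 2 = ‖a‖ ^ 2 := by
    rw [plane_norm_sq, plane_norm_sq, planeRot_zero, planeRot_one]; ring
  exact (sq_eq_sq₀ (norm_nonneg _) (norm_nonneg _)).1 this

theorem planeCross_sq_add_inner_sq (a b : Plane) :
    planeCross a b ^ 2 + inner ℝ a b ^ 2 = ‖a‖ ^ 2 * ‖b‖ ^ 2 := by
  rw [plane_norm_sq, plane_norm_sq, plane_inner_eq, planeCross]; ring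

theorem abs_planeCross_le (a b : Plane) : |planeCross a b| ≤ ‖a‖ * ‖b‖ := by
  apply abs_le_of_sq_le_sq _ (by positivity)
  have := planeCross_sq_add_inner_sq a b
  nlinarith [sq_nonneg (inner ℝ a b : ℝ)]

theorem planeCross_sub_right (a b c : Plane) :
    planeCross a (b - c) = planeCross a b - planeCross a c := by
  simp only [planeCross, PiLp.sub_apply]; ring

theorem planeCross_smul_left (t : ℝ) (a b : Plane) :
    planeCross (t • a) b = t * planeCross a b := by
  simp only [planeCross, PiLp.smul_apply, smul_eq_mul]; ring

theorem planeCross_smul_right (t : ℝ) (a b : Plane) :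
    planeCross a (t • b) = t * planeCross a b := by
  simp only [planeCross, PiLp.smul_apply, smul_eq_mul]; ring

/-- Normalisation is Lipschitz away from the origin. -/
theorem norm_normalize_sub_le {E : Type*} [NormedAddCommGroup E] [NormedSpace ℝ E]
    (a b : E) (ha : a ≠ 0) (hb : b ≠ 0) :
    ‖‖a‖⁻¹ • a - ‖b‖⁻¹ • b‖ ≤ 2 * ‖a - b‖ / ‖b‖ := by
  have hb' : 0 < ‖b‖ := norm_pos_iff.2 hb
  have ha' : 0 < ‖a‖ := norm_pos_iff.2 ha
  have h : ‖a‖⁻¹ • a - ‖b‖⁻¹ • b = ‖b‖⁻¹ • (a - b) + ((‖b‖ - ‖a‖) * ‖b‖⁻¹) • (‖a‖⁻¹ • a) := by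
    rw [smul_smul, smul_sub]
    have : (‖b‖ - ‖a‖) * ‖b‖⁻¹ * ‖a‖⁻¹ = ‖a‖⁻¹ - ‖b‖⁻¹ := by field_simp
    rw [this, sub_smul]; abel
  rw [h]
  refine (norm_add_le _ _).trans ?_
  rw [norm_smul, norm_smul, norm_smul, norm_inv, norm_inv, norm_norm, norm_norm,
    inv_mul_cancel₀ ha'.ne', mul_one, norm_mul, norm_inv, norm_norm]
  have h1 : ‖‖b‖ - ‖a‖‖ ≤ ‖a - b‖ := by
    rw [norm_sub_rev a b]; exact abs_norm_sub_norm_le b a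
  rw [div_eq_mul_inv]
  have h2 : 0 ≤ ‖b‖⁻¹ := by positivity
  nlinarith [mul_le_mul_of_nonneg_right h1 h2]

/-- For unit directions `u`, `u'`, the component of a displacement `x` transverse to the mean
direction of `u` and `u'`. -/
noncomputable def midOffset (u u' x : Plane) : ℝ := planeCross x (u + u') / ‖u + u'‖

/-- The sine of half the angle from `u'` to `u`, for unit directions `u`, `u'`. -/
noncomputable def midSlope (u u' : Plane) : ℝ := -(planeCross u u' / ‖u + u'‖)

section Mid

variable {u u' : Plane}

theorem norm_sq_add_of_unit (hu : ‖u‖ = 1) (hu' : ‖u'‖ = 1) :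
    ‖u + u'‖ ^ 2 = 2 + 2 * inner ℝ u u' := by
  rw [norm_add_sq_real, hu, hu']; ring

theorem inner_sub_eq_midSlope_mul (hu : ‖u‖ = 1) (hu' : ‖u'‖ = 1) (hw : u + u' ≠ 0) (x : Plane) :
    inner ℝ (u' - u) x = 2 * midSlope u u' * midOffset u u' x := by
  have hw' : ‖u + u'‖ ≠ 0 := norm_ne_zero_iff.2 hw
  have h2 := norm_sq_add_of_unit hu hu'
  rw [midSlope, midOffset]
  field_simp
  rw [h2, plane_inner_eq, plane_inner_eq]
  simp only [planeCross, PiLp.add_apply, PiLp.sub_apply]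
  have e := plane_unit hu
  have e' := plane_unit hu'
  linear_combination
    (2 * x 0 * u 0 + 2 * x 1 * u 1) * e' - (2 * x 0 * u' 0 + 2 * x 1 * u' 1) * e

theorem norm_sub_eq_midSlope (hu : ‖u‖ = 1) (hu' : ‖u'‖ = 1) (hw : u + u' ≠ 0) :
    ‖u' - u‖ = 2 * |midSlope u u'| := by
  have hw' : ‖u + u'‖ ≠ 0 := norm_ne_zero_iff.2 hw
  have h2 := norm_sq_add_of_unit hu hu'
  have h : ‖u' - u‖ ^ 2 = (2 * |midSlope u u'|) ^ 2 := by
    rw [mul_pow, sq_abs, midSlope, neg_sq, div_pow, norm_sub_sq_real, hu, hu']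
    have h3 := planeCross_sq_add_inner_sq u u'
    rw [hu, hu'] at h3
    field_simp
    rw [h2, real_inner_comm u u']
    linear_combination (-4) * h3
  exact (sq_eq_sq₀ (norm_nonneg _) (by positivity)).1 h

theorem midOffset_add_step (hw : u + u' ≠ 0) (x : Plane) (l l' : ℝ) :
    midOffset u u' (x + (l' • u' - l • u)) = midOffset u u' x + (l + l') * midSlope u u' := by
  have hw' : ‖u + u'‖ ≠ 0 := norm_ne_zero_iff.2 hw
  rw [midOffset, midOffset, midSlope]
  field_simp
  simp only [planeCross, PiLp.add_apply, PiLp.sub_apply, PiLp.smul_apply, smul_eq_mul]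
  ring

theorem abs_midOffset_le (x : Plane) : |midOffset u u' x| ≤ ‖x‖ := by
  rw [midOffset, abs_div, abs_norm]
  apply div_le_of_le_mul₀ (norm_nonneg _) (norm_nonneg _)
  exact abs_planeCross_le _ _

/-- The transverse component with respect to the mean direction is close to the transverse
component with respect to `u`. -/
theorem abs_midOffset_sub_planeCross_le (hu : ‖u‖ = 1) (hw : u + u' ≠ 0) (x : Plane) :
    |midOffset u u' x - planeCross x u| ≤ ‖x‖ * ‖u' - u‖ := by
  have e1 : midOffset u u' x = planeCross x (‖u + u'‖⁻¹ • (u + u')) := by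
    rw [planeCross_smul_right, midOffset, div_eq_inv_mul]
  rw [e1, ← planeCross_sub_right]
  refine (abs_planeCross_le _ _).trans (mul_le_mul_of_nonneg_left ?_ (norm_nonneg _))
  have h20 : (2 : ℝ) • u ≠ 0 := by
    rw [Ne, smul_eq_zero, ← norm_eq_zero (a := u), hu]; norm_num
  have h := norm_normalize_sub_le (u + u') ((2 : ℝ) • u) hw h20
  rw [norm_smul, hu, smul_smul] at h
  have e2 : u + u' - (2 : ℝ) • u = u' - u := by rw [two_smul]; abel
  rw [e2] at h
  rw [Real.norm_ofNat, mul_one, inv_mul_cancel₀ two_ne_zero, one_smul,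
    mul_div_cancel_left₀ _ two_ne_zero] at h
  exact h

end Mid

section Collision

variable {n n' v v' u u' : Plane}

theorem norm_reflect (hn : ‖n‖ = 1) (hu : u = v - (2 * inner ℝ v n) • n) : ‖u‖ = ‖v‖ := by
  have : ‖u‖ ^ 2 = ‖v‖ ^ 2 := by
    rw [hu, plane_norm_sq, plane_norm_sq, plane_inner_eq]
    simp only [PiLp.sub_apply, PiLp.smul_apply, smul_eq_mul]
    linear_combination 4 * (v 0 * n 0 + v 1 * n 1) ^ 2 * plane_unit hn
  exact (sq_eq_sq₀ (norm_nonneg _) (norm_nonneg _)).1 this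

theorem inner_reflect (hn : ‖n‖ = 1) (hu : u = v - (2 * inner ℝ v n) • n) :
    inner ℝ u n = -inner ℝ v n := by
  rw [hu, inner_sub_left, inner_smul_left, real_inner_self_eq_norm_sq, hn]
  simp; ring

theorem reflection_angle_identity {a b a' b' C S : ℝ} (h : a ^ 2 + b ^ 2 = 1)
    (h' : a' ^ 2 + b' ^ 2 = 1) (hCS : C ^ 2 + S ^ 2 = 1) :
    (-(a + a') * S + (b - b') * (C - 1)) ^ 2
        * (1 + ((a * a' + b * b') * C - (b * a' - a * b') * S))
      = ((a + a') * S + (b - b') * (C - 1)) ^ 2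
        * (1 + ((a * a' + b * b') * C + (b * a' - a * b') * S)) := by
  have h1 : (b * a' - a * b') * (1 + (a * a' - b * b')) = (a + a') * (b - b') := by
    linear_combination (-(a' * b')) * h + a * b * h'
  have h2 : (b * a' - a * b') * ((a + a') ^ 2 - (b - b') ^ 2)
      = 2 * (a * a' + b * b') * (a + a') * (b - b') := by
    linear_combination (-b'*a - a' * b) * h + (a * b'+ a' * b) * h'
  have h3 : (a + a') ^ 2 + (b - b') ^ 2 = 2 * (1 + (a * a' - b * b')) := by
    linear_combination h + h'
  have hS : S ^ 2 = (1 - C) * (1 + C) := by linear_combination hCS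
  have key : (b * a' - a * b') * S * (((a + a') * S) ^ 2 + ((b - b') * (C - 1)) ^ 2)
      + 2 * ((a + a') * S) * ((b - b') * (C - 1)) * (1 + (a * a' + b * b') * C) = 0 := by
    have : (b * a' - a * b') * ((a + a') ^ 2 * (1 + C) + (b - b') ^ 2 * (1 - C))
        - 2 * (a + a') * (b - b') * (1 + (a * a' + b * b') * C) = 0 := by
      linear_combination (b * a' - a * b') * h3 + 2 * h1 + C * h2
    linear_combination S * (1 - C) * this + (b * a' - a * b') * S * (a + a') ^ 2 * hS
  linear_combination (-2) * key

theorem midOffset_sq_reflect (hn : ‖n‖ = 1) (hn' : ‖n'‖ = 1) (hv : ‖v‖ = 1) (hv' : ‖v'‖ = 1)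
    (hu : u = v - (2 * inner ℝ v n) • n) (hu' : u' = v' - (2 * inner ℝ v' n') • n')
    (hw : u + u' ≠ 0) (hz : v + v' ≠ 0) :
    midOffset u u' (n' - n) ^ 2 = midOffset v v' (n' - n) ^ 2 := by
  have hw' : ‖u + u'‖ ≠ 0 := norm_ne_zero_iff.2 hw
  have hz' : ‖v + v'‖ ≠ 0 := norm_ne_zero_iff.2 hz
  have hu1 : ‖u‖ = 1 := (norm_reflect hn hu).trans hv
  have hu1' : ‖u'‖ = 1 := (norm_reflect hn' hu').trans hv'
  have en := plane_unit hn
  have en' := plane_unit hn'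
  have hab : (inner ℝ v n : ℝ) ^ 2 + planeCross n v ^ 2 = 1 := by
    have := planeCross_sq_add_inner_sq n v
    rw [hn, hv, real_inner_comm] at this; linear_combination this
  have hab' : (inner ℝ v' n' : ℝ) ^ 2 + planeCross n' v' ^ 2 = 1 := by
    have := planeCross_sq_add_inner_sq n' v'
    rw [hn', hv', real_inner_comm] at this; linear_combination this
  have hCS : (inner ℝ n n' : ℝ) ^ 2 + planeCross n n' ^ 2 = 1 := by
    have := planeCross_sq_add_inner_sq n n'
    rw [hn, hn'] at this; linear_combination this
  have key := reflection_angle_identity hab hab' hCS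
  have c1 : planeCross n' v = -inner ℝ v n * planeCross n n' + planeCross n v * inner ℝ n n' := by
    simp only [planeCross, plane_inner_eq]
    linear_combination (-(n' 0 * v 1 - n' 1 * v 0)) * en
  have c2 : planeCross n v'
      = inner ℝ v' n' * planeCross n n' + planeCross n' v' * inner ℝ n n' := by
    simp only [planeCross, plane_inner_eq]
    linear_combination (-(n 0 * v' 1 - n 1 * v' 0)) * en'
  have c3 : (inner ℝ v v' : ℝ) = (inner ℝ v n * inner ℝ v' n' + planeCross n v * planeCross n' v')
      * inner ℝ n n' + (planeCross n v * inner ℝ v' n' - inner ℝ v n * planeCross n' v')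
      * planeCross n n' := by
    simp only [planeCross, plane_inner_eq]
    linear_combination (-(v 0 * v' 0 + v 1 * v' 1)) * en
      - (v 0 * v' 0 + v 1 * v' 1) * (n 0 ^ 2 + n 1 ^ 2) * en'
  have d0 : planeCross (n' - n) (v + v')
      = planeCross n' v + planeCross n' v' - planeCross n v - planeCross n v' := by
    simp only [planeCross, PiLp.add_apply, PiLp.sub_apply]; ring
  have d1 : planeCross (n' - n) (v + v') = -(inner ℝ v n + inner ℝ v' n') * planeCross n n'
      + (planeCross n v - planeCross n' v') * (inner ℝ n n' - 1) := by
    rw [d0, c1, c2]; ring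
  have d2 : planeCross (n' - n) (u + u') = (inner ℝ v n + inner ℝ v' n') * planeCross n n'
      + (planeCross n v - planeCross n' v') * (inner ℝ n n' - 1) := by
    have : planeCross (n' - n) (u + u') = planeCross (n' - n) (v + v')
        + 2 * (inner ℝ v n + inner ℝ v' n') * planeCross n n' := by
      rw [hu, hu']
      simp only [planeCross, PiLp.add_apply, PiLp.sub_apply, PiLp.smul_apply, smul_eq_mul]
      ring
    rw [this, d1]; ring
  have d3 : (inner ℝ u u' : ℝ) = (inner ℝ v n * inner ℝ v' n' + planeCross n v * planeCross n' v')
      * inner ℝ n n' - (planeCross n v * inner ℝ v' n' - inner ℝ v n * planeCross n' v')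
      * planeCross n n' := by
    have : (inner ℝ u u' : ℝ) = inner ℝ v v'
      - 2 * (planeCross n v * inner ℝ v' n' - inner ℝ v n * planeCross n' v')
      * planeCross n n' := by
      rw [hu, hu']
      simp only [planeCross, plane_inner_eq, PiLp.sub_apply, PiLp.smul_apply, smul_eq_mul]
      linear_combination (2 * (v 0 * n' 0 + v 1 * n' 1) * (v' 0 * n' 0 + v' 1 * n' 1)) * en
        + (2 * (v 0 * n 0 + v 1 * n 1) * (v' 0 * n 0 + v' 1 * n 1)) * en'
    rw [this, c3]; ring
  rw [midOffset, midOffset, div_pow, div_pow,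
    div_eq_div_iff (pow_ne_zero 2 hw') (pow_ne_zero 2 hz'),
    norm_sq_add_of_unit hu1 hu1', norm_sq_add_of_unit hv hv', d1, d2, c3, d3]
  linear_combination (-2) * key

theorem inner_reflect_sub (hn : ‖n‖ = 1) (hn' : ‖n'‖ = 1)
    (hu : u = v - (2 * inner ℝ v n) • n) (hu' : u' = v' - (2 * inner ℝ v' n') • n') :
    inner ℝ (u' - u) (n' - n) - inner ℝ (v' - v) (n' - n)
      = -(inner ℝ v n + inner ℝ v' n') * ‖n' - n‖ ^ 2 := by
  have en := plane_unit hn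
  have en' := plane_unit hn'
  rw [hu, hu', plane_norm_sq]
  simp only [plane_inner_eq, PiLp.sub_apply, PiLp.smul_apply, smul_eq_mul]
  linear_combination ((v 0 * n 0 + v 1 * n 1) - (v' 0 * n' 0 + v' 1 * n' 1)) * (en' - en)

theorem inner_sub_le_reflect (hn : ‖n‖ = 1) (hn' : ‖n'‖ = 1)
    (hu : u = v - (2 * inner ℝ v n) • n) (hu' : u' = v' - (2 * inner ℝ v' n') • n')
    (hs : inner ℝ v n ≤ 0) (hs' : inner ℝ v' n' ≤ 0) :
    inner ℝ (v' - v) (n' - n) ≤ inner ℝ (u' - u) (n' - n) := by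
  have := inner_reflect_sub hn hn' hu hu'
  nlinarith [sq_nonneg ‖n' - n‖]

end Collision

section Collision

variable {n n' v v' u u' : Plane}

theorem two_mul_abs_planeCross_le_of_reflect (hn : ‖n‖ = 1) (hn' : ‖n'‖ = 1) (hv : ‖v‖ = 1)
    (hu : u = v - (2 * inner ℝ v n) • n) (hu' : u' = v' - (2 * inner ℝ v' n') • n') :
    2 * |planeCross n n'| ≤ ‖u' - u‖ + ‖v' - v‖ := by
  set y : Plane := (v' - v) - (2 * inner ℝ (v' - v) n') • n' with hy
  have hy1 : ‖y‖ = ‖v' - v‖ := norm_reflect hn' hy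
  set x : Plane := (2 * inner ℝ v n) • n - (2 * inner ℝ v n') • n' with hx
  have e : x = (u' - u) - y := by
    rw [hx, hy, hu, hu', inner_sub_left, mul_sub, sub_smul]; abel
  have hx1 : ‖x‖ = 2 * |planeCross n n'| := by
    have : ‖x‖ ^ 2 = (2 * |planeCross n n'|) ^ 2 := by
      rw [mul_pow, sq_abs, plane_norm_sq, hx]
      have en := plane_unit hn
      have en' := plane_unit hn'
      have ev := plane_unit hv
      simp only [planeCross, plane_inner_eq, PiLp.sub_apply, PiLp.smul_apply, smul_eq_mul]
      linear_combination (4 * (v 0 * n 0 + v 1 * n 1) ^ 2) * en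
        + 4 * (v 0 * n' 0 + v 1 * n' 1) ^ 2 * en'
        + 4 * (n 0 * n' 1 - n 1 * n' 0) ^ 2 * ev
        - 4 * (v 0 * n' 0 + v 1 * n' 1) ^ 2 * en - 4 * (v 0 * n 0 + v 1 * n 1) ^ 2 * en'
    exact (sq_eq_sq₀ (norm_nonneg _) (by positivity)).1 this
  rw [← hx1, ← hy1, e]
  exact norm_sub_le _ _

theorem norm_sub_mul_norm_add_of_unit (hn : ‖n‖ = 1) (hn' : ‖n'‖ = 1) :
    ‖n' - n‖ * ‖n + n'‖ = 2 * |planeCross n n'| := by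
  have : (‖n' - n‖ * ‖n + n'‖) ^ 2 = (2 * |planeCross n n'|) ^ 2 := by
    rw [mul_pow, mul_pow, sq_abs, plane_norm_sq, plane_norm_sq]
    have en := plane_unit hn
    have en' := plane_unit hn'
    simp only [planeCross, PiLp.sub_apply, PiLp.add_apply]
    linear_combination (n 0 ^ 2 + n 1 ^ 2 - (n' 0 ^ 2 + n' 1 ^ 2)) * (en - en')
  exact (sq_eq_sq₀ (by positivity) (by positivity)).1 this

theorem norm_add_ge_of_unit (hu : ‖u‖ = 1) : 2 - ‖u' - u‖ ≤ ‖u + u'‖ := by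
  have h : (2 : ℝ) • u = (u + u') - (u' - u) := by rw [two_smul]; abel
  have h2 : ‖(2 : ℝ) • u‖ = 2 := by rw [norm_smul, hu]; norm_num
  have := norm_sub_le (u + u') (u' - u)
  rw [← h, h2] at this
  linarith

/-- If two reflections off the same disk have close incoming and close outgoing directions, and
the transverse offset is not large, then the collision points are close. -/
theorem norm_normal_sub_le {r : ℝ} (hr : r ≤ 1 / 10) (hn : ‖n‖ = 1) (hn' : ‖n'‖ = 1)
    (hv : ‖v‖ = 1)
    (hu : u = v - (2 * inner ℝ v n) • n) (hu' : u' = v' - (2 * inner ℝ v' n') • n')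
    (hs : inner ℝ v n ≤ 0) (hs' : inner ℝ v' n' ≤ 0)
    (hur : ‖u' - u‖ ≤ r) (hvr : ‖v' - v‖ ≤ r) (hD : |midOffset u u' (n' - n)| ≤ 1) :
    ‖n' - n‖ ≤ 2 * r := by
  have h1 : ‖n' - n‖ * ‖n + n'‖ ≤ 2 * r := by
    rw [norm_sub_mul_norm_add_of_unit hn hn']
    linarith [two_mul_abs_planeCross_le_of_reflect hn hn' hv hu hu']
  have hr0 : 0 ≤ r := (norm_nonneg _).trans hur
  by_cases hge : 1 ≤ ‖n + n'‖
  · nlinarith only [norm_nonneg (n' - n), h1, hge]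
  exfalso
  push Not at hge
  have hpar := parallelogram_law_with_norm ℝ n' n
  rw [hn, hn', add_comm n' n] at hpar
  set c := ‖n' - n‖ with hc
  have hc0 : 0 ≤ c := norm_nonneg _
  have hc3 : 3 ≤ c ^ 2 := by nlinarith only [norm_nonneg (n + n'), hpar, hge]
  have hc1 : 1.7 ≤ c := by nlinarith only [hc3, hc0]
  have hu1 : ‖u‖ = 1 := (norm_reflect hn hu).trans hv
  have hun := inner_reflect hn hu
  have hun' := inner_reflect hn' hu'
  have hkick := inner_reflect_sub hn hn' hu hu'
  have hE1 : inner ℝ (u' - u) (n' - n) ≤ r * c :=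
    (real_inner_le_norm _ _).trans (mul_le_mul_of_nonneg_right hur hc0)
  have hE2 : -inner ℝ (v' - v) (n' - n) ≤ r * c := by
    refine (neg_le_abs _).trans ((abs_real_inner_le_norm _ _).trans ?_)
    exact mul_le_mul_of_nonneg_right hvr hc0
  have hL : inner ℝ u n + inner ℝ u' n' ≤ 2 * r := by
    rw [hun, hun']
    have h3 : (-inner ℝ v n + -inner ℝ v' n') * c * c ≤ 2 * r * c := by
      linarith only [hkick, hE1, hE2, show (-inner ℝ v n + -inner ℝ v' n') * c * c
        = -(inner ℝ v n + inner ℝ v' n') * c ^ 2 by ring]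
    have h4 := le_of_mul_le_mul_right h3 (by linarith : 0 < c)
    have h5 := mul_le_mul_of_nonneg_left hc1 (by linarith : 0 ≤ -inner ℝ v n + -inner ℝ v' n')
    linarith only [h4, h5, hs, hs']
  have hA : |inner ℝ n' (u' - u)| ≤ r := by
    refine (abs_real_inner_le_norm _ _).trans ?_
    rw [hn', one_mul]; exact hur
  have hB : |inner ℝ n (u' - u)| ≤ r := by
    refine (abs_real_inner_le_norm _ _).trans ?_
    rw [hn, one_mul]; exact hur
  have hdot : (inner ℝ (n' - n) (u + u') : ℝ)
      = 2 * inner ℝ u' n' - 2 * inner ℝ u n - inner ℝ n' (u' - u) - inner ℝ n (u' - u) := by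
    simp only [plane_inner_eq, PiLp.sub_apply, PiLp.add_apply]; ring
  have hdot' : |(inner ℝ (n' - n) (u + u') : ℝ)| ≤ 6 * r := by
    rw [abs_le] at hA hB ⊢
    rw [hdot]
    constructor <;> linarith [hA.1, hA.2, hB.1, hB.2]
  have hw : 1.9 ≤ ‖u + u'‖ := by linarith [norm_add_ge_of_unit (u' := u') hu1]
  have hcr : |planeCross (n' - n) (u + u')| ≤ ‖u + u'‖ := by
    rw [midOffset, abs_div, abs_norm, div_le_one (by linarith)] at hD
    exact hD
  have hsum := planeCross_sq_add_inner_sq (n' - n) (u + u')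
  have e1 : planeCross (n' - n) (u + u') ^ 2 ≤ ‖u + u'‖ ^ 2 := by
    rw [← sq_abs]; gcongr
  have e2 : (inner ℝ (n' - n) (u + u') : ℝ) ^ 2 ≤ (6 * r) ^ 2 := by
    rw [← sq_abs]; gcongr
  rw [← hc] at hsum
  have e3 : (6 * r) ^ 2 ≤ 0.36 := by nlinarith only [hr, hr0]
  have e4 : 3.61 ≤ ‖u + u'‖ ^ 2 := by nlinarith only [hw]
  linarith only [mul_le_mul_of_nonneg_right hc3 (sq_nonneg ‖u + u'‖), e1, e2, e3, e4, hsum]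

/-- The defocusing effect of a reflection, for close collisions with the same disk. -/
theorem midOffset_sq_le_reflect {r : ℝ} (hr : r ≤ 1 / 10) (hn : ‖n‖ = 1) (hn' : ‖n'‖ = 1)
    (hv : ‖v‖ = 1)
    (hu : u = v - (2 * inner ℝ v n) • n) (hu' : u' = v' - (2 * inner ℝ v' n') • n')
    (hs : inner ℝ v n ≤ 0) (hs' : inner ℝ v' n' ≤ 0)
    (hur : ‖u' - u‖ ≤ r) (hc : ‖n' - n‖ ≤ 2 * r) :
    midOffset u u' (n' - n) ^ 2
      ≤ 2 * (inner ℝ (u' - u) (n' - n) - inner ℝ (v' - v) (n' - n)) + 8 * r ^ 4 := by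
  rw [inner_reflect_sub hn hn' hu hu']
  have hr0 : 0 ≤ r := (norm_nonneg _).trans hur
  have hu1 : ‖u‖ = 1 := (norm_reflect hn hu).trans hv
  have hun := inner_reflect hn hu
  have hun' := inner_reflect hn' hu'
  have hw : 1 ≤ ‖u + u'‖ := by linarith [norm_add_ge_of_unit (u' := u') hu1]
  have hz : 1 ≤ ‖n + n'‖ := by linarith [norm_add_ge_of_unit (u' := n') hn]
  set c := ‖n' - n‖ with hcdef
  have hc0 : 0 ≤ c := norm_nonneg _
  set D := midOffset u u' (n' - n) with hD
  have hDc : |D| ≤ c := abs_midOffset_le _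
  have hcross : |planeCross (n' - n) (u + u')| = |D| * ‖u + u'‖ := by
    rw [hD, midOffset, abs_div, abs_norm, div_mul_cancel₀]; linarith
  have hid : |planeCross (n' - n) (u + u')| * ‖n + n'‖ = c * |inner ℝ (n + n') (u + u')| := by
    have : (|planeCross (n' - n) (u + u')| * ‖n + n'‖) ^ 2
        = (c * |inner ℝ (n + n') (u + u')|) ^ 2 := by
      rw [mul_pow, mul_pow, sq_abs, sq_abs, hcdef, plane_norm_sq, plane_norm_sq]
      have en := plane_unit hn
      have en' := plane_unit hn'
      have h0 : (n' 0 - n 0) * (n 0 + n' 0) = -((n' 1 - n 1) * (n 1 + n' 1)) := by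
        linear_combination en' - en
      simp only [planeCross, plane_inner_eq, PiLp.sub_apply, PiLp.add_apply]
      linear_combination
        ((u 1 + u' 1) ^ 2 - (u 0 + u' 0) ^ 2) * ((n' 0 - n 0) * (n 0 + n' 0)
            - (n' 1 - n 1) * (n 1 + n' 1)) * h0
          - 2 * (u 0 + u' 0) * (u 1 + u' 1) * ((n' 0 - n 0) * (n 1 + n' 1)
            + (n' 1 - n 1) * (n 0 + n' 0)) * h0
    exact (sq_eq_sq₀ (by positivity) (by positivity)).1 this
  have hdot : (inner ℝ (n + n') (u + u') : ℝ)
      = 2 * (-inner ℝ v n + -inner ℝ v' n') - inner ℝ (u' - u) (n' - n) := by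
    rw [← hun, ← hun']
    simp only [plane_inner_eq, PiLp.sub_apply, PiLp.add_apply]; ring
  have hE : |inner ℝ (u' - u) (n' - n)| ≤ r * c :=
    (abs_real_inner_le_norm _ _).trans (mul_le_mul_of_nonneg_right hur hc0)
  have hb : |(inner ℝ (n + n') (u + u') : ℝ)| ≤ 2 * (-inner ℝ v n + -inner ℝ v' n') + r * c := by
    rw [hdot]
    refine (abs_sub _ _).trans ?_
    rw [abs_of_nonneg (by linarith)]
    linarith
  have h1 : |D| ≤ c * (2 * (-inner ℝ v n + -inner ℝ v' n') + r * c) := by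
    calc |D| ≤ |D| * ‖u + u'‖ * ‖n + n'‖ := by
          have := mul_le_mul hw hz zero_le_one (norm_nonneg _)
          nlinarith [abs_nonneg D]
      _ = c * |inner ℝ (n + n') (u + u')| := by rw [← hcross, hid]
      _ ≤ _ := mul_le_mul_of_nonneg_left hb hc0
  have h2 : D ^ 2 ≤ c * (c * (2 * (-inner ℝ v n + -inner ℝ v' n') + r * c)) := by
    rw [← sq_abs, sq]; exact mul_le_mul hDc h1 (abs_nonneg _) hc0
  have h3 : r * c ^ 3 ≤ r * (2 * r) ^ 3 := by gcongr
  linarith [h2, h3, show c * (c * (2 * (-inner ℝ v n + -inner ℝ v' n') + r * c))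
    = 2 * (-(inner ℝ v n + inner ℝ v' n') * c ^ 2) + r * c ^ 3 by ring,
    show r * (2 * r) ^ 3 = 8 * r ^ 4 by ring]

end Collision

/-- The real data of the comparison of two trajectories that hit the same disks: `a k` and `b k`
are the transverse offsets at the beginning and at the end of the `k`-th segment, and `m k` is the
rate at which the offset grows along it. -/
structure OffsetData (N : ℕ) (a b m L : ℕ → ℝ) : Prop where
  pos : ∀ k < N, 0 < L k
  step : ∀ k < N, b k = a k + L k * m k
  sq_eq : ∀ k, k + 1 < N → a (k + 1) ^ 2 = b k ^ 2
  mono : ∀ k, k + 1 < N → b k * m k ≤ a (k + 1) * m (k + 1)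

namespace OffsetData

variable {N : ℕ} {a b m L : ℕ → ℝ}

theorem abs_eq (h : OffsetData N a b m L) {k : ℕ} (hk : k + 1 < N) : |a (k + 1)| = |b k| :=
  (sq_eq_sq_iff_abs_eq_abs _ _).1 (h.sq_eq k hk)

theorem mul_le (h : OffsetData N a b m L) {k : ℕ} (hk : k < N) :
    a k * m k + L k * m k ^ 2 = b k * m k := by
  rw [h.step k hk]; ring

theorem mul_le' (h : OffsetData N a b m L) {k : ℕ} (hk : k < N) : a k * m k ≤ b k * m k := by
  nlinarith [h.mul_le hk, h.pos k hk, sq_nonneg (m k)]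

theorem abs_le_of_nonneg (h : OffsetData N a b m L) {k : ℕ} (hk : k < N) (h0 : 0 ≤ a k * m k) :
    |a k| ≤ |b k| := by
  rw [h.step k hk]
  apply sq_le_sq.1
  nlinarith [h.pos k hk, sq_nonneg (L k * m k), mul_nonneg (h.pos k hk).le h0]

theorem abs_le_of_nonpos (h : OffsetData N a b m L) {k : ℕ} (hk : k < N) (h0 : b k * m k ≤ 0) :
    |b k| ≤ |a k| := by
  have e : a k = b k - L k * m k := by rw [h.step k hk]; ring
  rw [e]
  apply sq_le_sq.1
  nlinarith [h.pos k hk, sq_nonneg (L k * m k),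
    mul_nonneg (h.pos k hk).le (by linarith : 0 ≤ -(b k * m k))]

theorem forward (h : OffsetData N a b m L) {k : ℕ} (h0 : 0 ≤ b k * m k) (j : ℕ)
    (hj : k + j < N) : 0 ≤ b (k + j) * m (k + j) ∧ |b k| ≤ |b (k + j)| := by
  induction j with
  | zero => exact ⟨h0, le_rfl⟩
  | succ j ih =>
    obtain ⟨h1, h2⟩ := ih (by omega)
    have h3 := h.mono (k + j) hj
    have h4 : 0 ≤ a (k + j + 1) * m (k + j + 1) := h1.trans h3
    refine ⟨h4.trans (h.mul_le' hj), h2.trans ?_⟩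
    rw [← h.abs_eq (k := k + j) hj]
    exact h.abs_le_of_nonneg hj h4

theorem backward (h : OffsetData N a b m L) (k : ℕ) (hk : k < N) (h0 : a k * m k ≤ 0) :
    |a k| ≤ |a 0| := by
  induction k with
  | zero => exact le_rfl
  | succ k ih =>
    have h1 : b k * m k ≤ 0 := (h.mono k hk).trans h0
    rw [h.abs_eq hk]
    exact (h.abs_le_of_nonpos (by omega) h1).trans
      (ih (by omega) ((h.mul_le' (by omega)).trans h1))

/-- The maximum principle for transverse offsets. -/
theorem abs_le_max (h : OffsetData N a b m L) {k : ℕ} (hk : k < N) {d : ℝ}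
    (h0 : |a 0| ≤ d) (hN : |b (N - 1)| ≤ d) : |a k| ≤ d ∧ |b k| ≤ d := by
  have hb : 0 ≤ b k * m k → |b k| ≤ d := fun h1 => by
    have h2 := (h.forward h1 (N - 1 - k) (by omega)).2
    rw [show k + (N - 1 - k) = N - 1 by omega] at h2
    exact h2.trans hN
  rcases le_total 0 (a k * m k) with h1 | h1
  · have h2 := hb (h1.trans (h.mul_le' hk))
    exact ⟨(h.abs_le_of_nonneg hk h1).trans h2, h2⟩
  · have h2 := (h.backward k hk h1).trans h0
    rcases le_total 0 (b k * m k) with h3 | h3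
    · exact ⟨h2, hb h3⟩
    · exact ⟨h2, (h.abs_le_of_nonpos hk h3).trans h2⟩

theorem abs_slope_mul_le (h : OffsetData N a b m L) {k : ℕ} (hk : k < N) {d : ℝ}
    (h0 : |a 0| ≤ d) (hN : |b (N - 1)| ≤ d) : L k * |m k| ≤ 2 * d := by
  obtain ⟨h1, h2⟩ := h.abs_le_max hk h0 hN
  rw [← abs_of_pos (h.pos k hk), ← abs_mul, show L k * m k = b k - a k by rw [h.step k hk]; ring]
  exact (abs_sub _ _).trans (by linarith)

theorem mul_mono (h : OffsetData N a b m L) {k : ℕ} (j : ℕ) (hj : k + j < N) :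
    b k * m k ≤ b (k + j) * m (k + j) := by
  induction j with
  | zero => exact le_rfl
  | succ j ih =>
    exact (ih (by omega)).trans ((h.mono (k + j) hj).trans (h.mul_le' hj))

theorem energy (h : OffsetData N a b m L) (hN : 2 ≤ N) :
    L 0 * m 0 ^ 2 + (a 1 * m 1 - b 0 * m 0) ≤ b (N - 1) * m (N - 1) - a 0 * m 0 := by
  have h1 := h.mul_mono (k := 1) (N - 2) (by omega)
  rw [show 1 + (N - 2) = N - 1 by omega] at h1
  have h2 := h.mul_le (k := 0) (by omega)
  have h3 := h.mul_le' (k := 1) (by omega)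
  linarith

/-- If the offset vanishes at the beginning, the directions turn more at the end than at the
beginning. -/
theorem slope_le_of_start (h : OffsetData N a b m L) (hN : 0 < N) (h0 : a 0 = 0) :
    |m 0| ≤ |m (N - 1)| ∧ 0 ≤ b (N - 1) * m (N - 1) := by
  have hb0 : 0 ≤ b 0 * m 0 := by simpa [h0] using h.mul_le' hN
  have hlast := h.forward hb0 (N - 1) (by omega)
  rw [zero_add] at hlast
  refine ⟨?_, hlast.1⟩
  by_cases hm : m 0 = 0
  · simp [hm]
  have hbpos : 0 < |b 0| := by
    rw [h.step 0 hN, h0, zero_add]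
    exact abs_pos.2 (mul_ne_zero (h.pos 0 hN).ne' hm)
  have key : ∀ j, j < N → |m 0| ≤ |m j| := by
    intro j
    induction j with
    | zero => intro _; exact le_rfl
    | succ j ih =>
      intro hj
      refine (ih (by omega)).trans ?_
      have h1 := h.forward hb0 j (by omega)
      rw [zero_add] at h1
      have h2 := h.mono j hj
      have h3 : |b j * m j| ≤ |a (j + 1) * m (j + 1)| := abs_le_abs_of_nonneg h1.1 h2
      rw [abs_mul, abs_mul, h.abs_eq hj] at h3
      exact le_of_mul_le_mul_left h3 (hbpos.trans_le h1.2)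
  exact key (N - 1) (by omega)

theorem reverse (h : OffsetData N a b m L) :
    OffsetData N (fun k => b (N - 1 - k)) (fun k => a (N - 1 - k)) (fun k => -m (N - 1 - k))
      (fun k => L (N - 1 - k)) where
  pos k hk := h.pos _ (by omega)
  step k hk := by rw [h.step (N - 1 - k) (by omega)]; ring
  sq_eq k hk := by
    have := h.sq_eq (N - 1 - (k + 1)) (by omega)
    rw [show N - 1 - (k + 1) + 1 = N - 1 - k by omega] at this
    exact this.symm
  mono k hk := by
    have := h.mono (N - 1 - (k + 1)) (by omega)
    rw [show N - 1 - (k + 1) + 1 = N - 1 - k by omega] at this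
    linarith

theorem slope_le_of_end (h : OffsetData N a b m L) (hN : 0 < N) (h0 : b (N - 1) = 0) :
    |m (N - 1)| ≤ |m 0| ∧ a 0 * m 0 ≤ 0 := by
  have := h.reverse.slope_le_of_start hN (by simpa using h0)
  simp only [tsub_zero, abs_neg, tsub_self] at this
  exact ⟨this.1, by linarith [this.2]⟩

end OffsetData

/-- Two finite chains of segments with directions `u k`, `u' k` and lengths `l k`, `l' k`, which are
reflected at the same disks, at the points with normals `n k` and `n' k`; `x k` is the displacement
between the initial points of the `k`-th segments. -/
structure ReflectingPair (N : ℕ) (u u' n n' x : ℕ → Plane) (l l' : ℕ → ℝ) : Prop where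
  unit : ∀ k < N, ‖u k‖ = 1
  unit' : ∀ k < N, ‖u' k‖ = 1
  add_ne_zero : ∀ k < N, u k + u' k ≠ 0
  pos : ∀ k < N, 0 < l k
  pos' : ∀ k < N, 0 < l' k
  step : ∀ k < N, x (k + 1) = x k + (l' k • u' k - l k • u k)
  normal_unit : ∀ k, k + 1 < N → ‖n (k + 1)‖ = 1
  normal_unit' : ∀ k, k + 1 < N → ‖n' (k + 1)‖ = 1
  displacement : ∀ k, k + 1 < N → x (k + 1) = n' (k + 1) - n (k + 1)
  reflect : ∀ k, k + 1 < N → u (k + 1) = u k - (2 * inner ℝ (u k) (n (k + 1))) • n (k + 1)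
  reflect' : ∀ k, k + 1 < N → u' (k + 1) = u' k - (2 * inner ℝ (u' k) (n' (k + 1))) • n' (k + 1)
  incoming : ∀ k, k + 1 < N → inner ℝ (u k) (n (k + 1)) ≤ 0
  incoming' : ∀ k, k + 1 < N → inner ℝ (u' k) (n' (k + 1)) ≤ 0

theorem planeCross_eq_inner_mul {u e : Plane} (hu : ‖u‖ = 1) (he : ‖e‖ = 1)
    (hue : inner ℝ e u = 0) (x : Plane) : planeCross x u = inner ℝ e x * planeCross e u := by
  have eu := plane_unit hu
  have ee := plane_unit he
  rw [plane_inner_eq] at hue ⊢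
  simp only [planeCross]
  linear_combination (-(x 0 * u 1 - x 1 * u 0)) * ee + (x 0 * e 1 - x 1 * e 0) * hue

theorem abs_inner_eq_abs_planeCross {u e : Plane} (hu : ‖u‖ = 1) (he : ‖e‖ = 1)
    (hue : inner ℝ e u = 0) (x : Plane) : |inner ℝ e x| = |planeCross x u| := by
  have h := planeCross_sq_add_inner_sq e u
  rw [hue, hu, he] at h
  have h1 : |planeCross e u| = 1 := by
    rw [← abs_one]; exact (sq_eq_sq_iff_abs_eq_abs _ _).1 (by linarith)
  rw [planeCross_eq_inner_mul hu he hue, abs_mul, h1, mul_one]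

namespace ReflectingPair

variable {N : ℕ} {u u' n n' x : ℕ → Plane} {l l' : ℕ → ℝ}

theorem offsetData (h : ReflectingPair N u u' n n' x l l') :
    OffsetData N (fun k => midOffset (u k) (u' k) (x k))
      (fun k => midOffset (u k) (u' k) (x (k + 1))) (fun k => midSlope (u k) (u' k))
      (fun k => l k + l' k) where
  pos k hk := add_pos (h.pos k hk) (h.pos' k hk)
  step k hk := by
    rw [h.step k hk, midOffset_add_step (h.add_ne_zero k hk)]
  sq_eq k hk := by
    rw [h.displacement k hk]
    exact midOffset_sq_reflect (h.normal_unit k hk) (h.normal_unit' k hk) (h.unit k (by omega))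
      (h.unit' k (by omega)) (h.reflect k hk) (h.reflect' k hk) (h.add_ne_zero _ hk)
      (h.add_ne_zero k (by omega))
  mono k hk := by
    have h1 := inner_sub_le_reflect (h.normal_unit k hk) (h.normal_unit' k hk) (h.reflect k hk)
      (h.reflect' k hk) (h.incoming k hk) (h.incoming' k hk)
    rw [← h.displacement k hk, inner_sub_eq_midSlope_mul (h.unit k (by omega))
      (h.unit' k (by omega)) (h.add_ne_zero k (by omega)), inner_sub_eq_midSlope_mul (h.unit _ hk)
      (h.unit' _ hk) (h.add_ne_zero _ hk)] at h1
    linarith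

theorem norm_direction_sub_le (h : ReflectingPair N u u' n n' x l l') {g d : ℝ} (hg : 0 < g)
    (hl : ∀ k < N, 2 * g ≤ l k + l' k) (h0 : |midOffset (u 0) (u' 0) (x 0)| ≤ d)
    (hN : |midOffset (u (N - 1)) (u' (N - 1)) (x (N - 1 + 1))| ≤ d) {k : ℕ} (hk : k < N) :
    ‖u' k - u k‖ ≤ 2 * d / g := by
  rw [norm_sub_eq_midSlope (h.unit k hk) (h.unit' k hk) (h.add_ne_zero k hk)]
  have h1 := h.offsetData.abs_slope_mul_le hk h0 hN
  rw [le_div_iff₀ hg]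
  nlinarith [abs_nonneg (midSlope (u k) (u' k)), hl k hk]

theorem norm_displacement_le (h : ReflectingPair N u u' n n' x l l') {g d : ℝ} (hg : 0 < g)
    (hl : ∀ k < N, 2 * g ≤ l k + l' k) (h0 : |midOffset (u 0) (u' 0) (x 0)| ≤ d)
    (hN : |midOffset (u (N - 1)) (u' (N - 1)) (x (N - 1 + 1))| ≤ d) (hd : d ≤ 1)
    (hdg : 2 * d / g ≤ 1 / 10) {k : ℕ} (hk : k + 1 < N) :
    ‖x (k + 1)‖ ≤ 2 * (2 * d / g) := by
  have h1 := (h.offsetData.abs_le_max hk h0 hN).1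
  rw [h.displacement k hk] at h1 ⊢
  exact norm_normal_sub_le hdg (h.normal_unit k hk) (h.normal_unit' k hk) (h.unit k (by omega))
    (h.reflect k hk) (h.reflect' k hk) (h.incoming k hk) (h.incoming' k hk)
    (h.norm_direction_sub_le hg hl h0 hN hk)
    (h.norm_direction_sub_le hg hl h0 hN (by omega)) (h1.trans hd)

/-- The displacement of the initial point of a segment in the direction of its normal. -/
theorem abs_inner_start_le (h : ReflectingPair N u u' n n' x l l') {d : ℝ}
    (h0 : |midOffset (u 0) (u' 0) (x 0)| ≤ d)
    (hN : |midOffset (u (N - 1)) (u' (N - 1)) (x (N - 1 + 1))| ≤ d)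
    {k : ℕ} (hk : k < N) {e : Plane} (he : ‖e‖ = 1) (heu : inner ℝ e (u k) = 0) :
    |inner ℝ e (x k)| ≤ d + ‖x k‖ * ‖u' k - u k‖ := by
  rw [abs_inner_eq_abs_planeCross (h.unit k hk) he heu]
  have h1 := (h.offsetData.abs_le_max hk h0 hN).1
  have h2 := abs_midOffset_sub_planeCross_le (h.unit k hk) (h.add_ne_zero k hk) (x k)
  have h3 := abs_sub_abs_le_abs_sub (planeCross (x k) (u k)) (midOffset (u k) (u' k) (x k))
  rw [abs_sub_comm] at h3
  linarith

theorem abs_inner_end_le (h : ReflectingPair N u u' n n' x l l') {d : ℝ}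
    (h0 : |midOffset (u 0) (u' 0) (x 0)| ≤ d)
    (hN : |midOffset (u (N - 1)) (u' (N - 1)) (x (N - 1 + 1))| ≤ d)
    {k : ℕ} (hk : k < N) {e : Plane} (he : ‖e‖ = 1) (heu : inner ℝ e (u k) = 0) :
    |inner ℝ e (x (k + 1))| ≤ d + ‖x (k + 1)‖ * ‖u' k - u k‖ := by
  rw [abs_inner_eq_abs_planeCross (h.unit k hk) he heu]
  have h1 := (h.offsetData.abs_le_max hk h0 hN).2
  have h2 := abs_midOffset_sub_planeCross_le (h.unit k hk) (h.add_ne_zero k hk) (x (k + 1))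
  have h3 := abs_sub_abs_le_abs_sub (planeCross (x (k + 1)) (u k))
    (midOffset (u k) (u' k) (x (k + 1)))
  rw [abs_sub_comm] at h3
  linarith

/-- Moving the initial point of the first chain along its first segment. -/
theorem shiftStart (h : ReflectingPair N u u' n n' x l l') {t : ℝ} (ht : t < l 0)
    (hx : x 0 = t • u 0) :
    ReflectingPair N u u' n n' (Function.update x 0 0) (Function.update l 0 (l 0 - t)) l' where
  unit := h.unit
  unit' := h.unit'
  add_ne_zero := h.add_ne_zero
  pos k hk := by
    rcases k with _ | k
    · simpa using ht
    · simpa using h.pos _ hk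
  pos' := h.pos'
  step k hk := by
    rcases k with _ | k
    · have := h.step 0 hk
      simp only [Function.update_self, ne_eq, Nat.add_eq_zero_iff, one_ne_zero, and_false,
        not_false_eq_true, Function.update_of_ne]
      rw [this, hx, sub_smul]; abel
    · simpa using h.step _ hk
  normal_unit := h.normal_unit
  normal_unit' := h.normal_unit'
  displacement k hk := by simpa using h.displacement k hk
  reflect := h.reflect
  reflect' := h.reflect'
  incoming := h.incoming
  incoming' := h.incoming'

/-- Moving the end point of the first chain along its last segment. -/
theorem shiftEnd (h : ReflectingPair N u u' n n' x l l') (hN : 0 < N) {t : ℝ}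
    (ht : 0 < l (N - 1) + t) (hx : x N = t • u (N - 1)) :
    ReflectingPair N u u' n n' (Function.update x N 0)
      (Function.update l (N - 1) (l (N - 1) + t)) l' where
  unit := h.unit
  unit' := h.unit'
  add_ne_zero := h.add_ne_zero
  pos k hk := by
    by_cases hkN : k = N - 1
    · subst hkN; simpa using ht
    · rw [Function.update_of_ne hkN]; exact h.pos _ hk
  pos' := h.pos'
  step k hk := by
    rw [Function.update_of_ne (by omega : k ≠ N)]
    by_cases hkN : k = N - 1
    · subst hkN
      have := h.step (N - 1) hk
      rw [Nat.sub_add_cancel hN] at this ⊢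
      rw [Function.update_self, Function.update_self, add_smul, ← hx, this]; abel
    · rw [Function.update_of_ne hkN, Function.update_of_ne (by omega : k + 1 ≠ N)]
      exact h.step k hk
  normal_unit := h.normal_unit
  normal_unit' := h.normal_unit'
  displacement k hk := by
    rw [Function.update_of_ne (by omega : k + 1 ≠ N)]; exact h.displacement k hk
  reflect := h.reflect
  reflect' := h.reflect'
  incoming := h.incoming
  incoming' := h.incoming'

/-- A lower bound for the second variation of the length. -/
theorem offset_sq_le_energy (h : ReflectingPair N u u' n n' x l l') (hN2 : 2 ≤ N) {g d M : ℝ}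
    (hg : 0 < g) (hl : ∀ k < N, 2 * g ≤ l k + l' k) (h0 : |midOffset (u 0) (u' 0) (x 0)| ≤ d)
    (hN : |midOffset (u (N - 1)) (u' (N - 1)) (x (N - 1 + 1))| ≤ d) (hd : d ≤ 1)
    (hdg : 2 * d / g ≤ 1 / 10) (hM : l 0 + l' 0 ≤ M) :
    midOffset (u 0) (u' 0) (x 0) ^ 2 ≤ (M + 4) *
      (inner ℝ (u' (N - 1) - u (N - 1)) (x (N - 1 + 1)) - inner ℝ (u' 0 - u 0) (x 0)
        + 4 * (2 * d / g) ^ 4) := by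
  have hO := h.offsetData
  have hen := hO.energy hN2
  have hsq := hO.sq_eq 0 (by omega)
  have hst := hO.step 0 (by omega)
  simp only [zero_add] at hen hsq hst
  have h1 : 0 + 1 < N := by omega
  have hk := midOffset_sq_le_reflect hdg (h.normal_unit 0 h1) (h.normal_unit' 0 h1)
    (h.unit 0 (by omega)) (h.reflect 0 h1) (h.reflect' 0 h1) (h.incoming 0 h1) (h.incoming' 0 h1)
    (h.norm_direction_sub_le hg hl h0 hN (k := 1) (by omega))
    (by rw [← h.displacement 0 h1]; exact h.norm_displacement_le hg hl h0 hN hd hdg h1)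
  rw [← h.displacement 0 h1] at hk
  simp only [zero_add] at hk
  rw [inner_sub_eq_midSlope_mul (h.unit 1 (by omega)) (h.unit' 1 (by omega))
    (h.add_ne_zero 1 (by omega)), inner_sub_eq_midSlope_mul (h.unit 0 (by omega))
    (h.unit' 0 (by omega)) (h.add_ne_zero 0 (by omega))] at hk
  rw [inner_sub_eq_midSlope_mul (h.unit (N - 1) (by omega)) (h.unit' (N - 1) (by omega))
    (h.add_ne_zero (N - 1) (by omega)), inner_sub_eq_midSlope_mul (h.unit 0 (by omega))
    (h.unit' 0 (by omega)) (h.add_ne_zero 0 (by omega))]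
  have hL : 0 < l 0 + l' 0 := add_pos (h.pos 0 (by omega)) (h.pos' 0 (by omega))
  set a0 := midOffset (u 0) (u' 0) (x 0)
  set b0 := midOffset (u 0) (u' 0) (x 1)
  set a1 := midOffset (u 1) (u' 1) (x 1)
  set m0 := midSlope (u 0) (u' 0)
  set m1 := midSlope (u 1) (u' 1)
  set L := l 0 + l' 0
  set bN := midOffset (u (N - 1)) (u' (N - 1)) (x (N - 1 + 1))
  set mN := midSlope (u (N - 1)) (u' (N - 1))
  set r := 2 * d / g
  have hW : 2 * L * m0 ^ 2 + b0 ^ 2 / 2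
      ≤ 2 * mN * bN - 2 * m0 * a0 + 4 * r ^ 4 := by
    linarith only [hen, hk, hsq]
  have ha : a0 = b0 - L * m0 := by linarith
  have hcs : a0 ^ 2 ≤ (L / 2 + 2) * (2 * L * m0 ^ 2 + b0 ^ 2 / 2) := by
    have e : (L / 2 + 2) * (2 * L * m0 ^ 2 + b0 ^ 2 / 2) - (b0 - L * m0) ^ 2
        = L * (2 * m0 + b0 / 2) ^ 2 := by ring
    rw [ha]
    nlinarith only [e, mul_nonneg hL.le (sq_nonneg (2 * m0 + b0 / 2))]
  have hnn : 0 ≤ 2 * L * m0 ^ 2 + b0 ^ 2 / 2 := by positivity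
  calc a0 ^ 2 ≤ (L / 2 + 2) * (2 * L * m0 ^ 2 + b0 ^ 2 / 2) := hcs
    _ ≤ (M + 4) * (2 * L * m0 ^ 2 + b0 ^ 2 / 2) :=
        mul_le_mul_of_nonneg_right (by linarith only [hM, hL]) hnn
    _ ≤ _ := mul_le_mul_of_nonneg_left hW (by linarith only [hM, hL])

end ReflectingPair

theorem norm_inv_norm_smul {E : Type*} [NormedAddCommGroup E] [NormedSpace ℝ E] {x : E}
    (hx : x ≠ 0) : ‖‖x‖⁻¹ • x‖ = 1 := by
  rw [norm_smul, norm_inv, norm_norm, inv_mul_cancel₀ (norm_ne_zero_iff.2 hx)]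

/-- A reflection with unit normal `n`, incoming direction `v` and outgoing direction `u`, in the
frame `n`, `planeRot n`. -/
structure ReflectionFrame (n u v : Plane) (c σ : ℝ) : Prop where
  unit : ‖n‖ = 1
  sq_add_sq : c ^ 2 + σ ^ 2 = 1
  half_lt : 3 / 4 < c ^ 2
  c_pos : 0 < c
  outgoing_eq : u = c • n + σ • planeRot n
  incoming_eq : v = -c • n + σ • planeRot n

theorem inner_planeRot_self (n : Plane) : inner ℝ n (planeRot n) = 0 := by
  rw [plane_inner_eq, planeRot_zero, planeRot_one]; ring

theorem inner_eq_frame {n : Plane} (hn : ‖n‖ = 1) (x y : Plane) :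
    inner ℝ x y = inner ℝ y n * inner ℝ x n
      + inner ℝ y (planeRot n) * inner ℝ x (planeRot n) := by
  simp only [plane_inner_eq, planeRot_zero, planeRot_one]
  linear_combination (-(x 0 * y 0 + x 1 * y 1)) * plane_unit hn

theorem inner_sq_add_inner_sq_frame {n : Plane} (hn : ‖n‖ = 1) {e : Plane} (he : ‖e‖ = 1) :
    inner ℝ e n ^ 2 + inner ℝ e (planeRot n) ^ 2 = 1 := by
  have h := inner_eq_frame hn e e
  rw [real_inner_self_eq_norm_sq, he] at h
  linarith

namespace ReflectionFrame

variable {n u v u' v' : Plane} {c σ r : ℝ}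

theorem c_gt (h : ReflectionFrame n u v c σ) : 0.86 < c := by
  nlinarith [h.half_lt, h.c_pos]

theorem c_le_one (h : ReflectionFrame n u v c σ) : c ≤ 1 := by
  nlinarith [h.sq_add_sq, sq_nonneg σ, h.c_pos]

theorem reverse (h : ReflectionFrame n u v c σ) : ReflectionFrame n (-v) (-u) c (-σ) where
  unit := h.unit
  sq_add_sq := by rw [neg_sq]; exact h.sq_add_sq
  half_lt := h.half_lt
  c_pos := h.c_pos
  outgoing_eq := by rw [h.incoming_eq, neg_smul, neg_smul]; abel
  incoming_eq := by rw [h.outgoing_eq, neg_smul, neg_smul]; abel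

theorem unit_outgoing (h : ReflectionFrame n u v c σ) : ‖u‖ = 1 := by
  have : ‖u‖ ^ 2 = 1 ^ 2 := by
    rw [h.outgoing_eq, plane_norm_sq]
    simp only [PiLp.add_apply, PiLp.smul_apply, smul_eq_mul, planeRot_zero, planeRot_one]
    linear_combination (c ^ 2 + σ ^ 2) * plane_unit h.unit + h.sq_add_sq
  exact (sq_eq_sq₀ (norm_nonneg _) zero_le_one).1 this

theorem unit_incoming (h : ReflectionFrame n u v c σ) : ‖v‖ = 1 := by
  rw [← norm_neg]; exact h.reverse.unit_outgoing

theorem outgoing_sub_incoming (h : ReflectionFrame n u v c σ) : u - v = (2 * c) • n := by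
  rw [h.outgoing_eq, h.incoming_eq, neg_smul, two_mul, add_smul]; abel

theorem planeCross_rot_outgoing (h : ReflectionFrame n u v c σ) :
    planeCross (planeRot n) u = -c := by
  rw [h.outgoing_eq]
  simp only [planeCross, PiLp.add_apply, PiLp.smul_apply, smul_eq_mul, planeRot_zero, planeRot_one]
  linear_combination (-c) * plane_unit h.unit

theorem planeCross_rot_incoming (h : ReflectionFrame n u v c σ) :
    planeCross (planeRot n) v = c := by
  rw [h.incoming_eq]
  simp only [planeCross, PiLp.add_apply, PiLp.smul_apply, smul_eq_mul, planeRot_zero, planeRot_one]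
  linear_combination c * plane_unit h.unit

theorem planeCross_outgoing_incoming (h : ReflectionFrame n u v c σ) :
    planeCross u v = 2 * c * σ := by
  rw [h.outgoing_eq, h.incoming_eq]
  simp only [planeCross, PiLp.add_apply, PiLp.smul_apply, smul_eq_mul, planeRot_zero, planeRot_one]
  linear_combination 2 * c * σ * plane_unit h.unit

theorem norm_sub_ge (h : ReflectionFrame n u v c σ) (hr : r ≤ 1 / 10) (hu : ‖u' - u‖ ≤ r)
    (hv : ‖v' - v‖ ≤ r) : 1 ≤ ‖u' - v'‖ := by
  have e : (2 * c) • n = (u' - v') - ((u' - u) - (v' - v)) := by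
    rw [← h.outgoing_sub_incoming]; abel
  have h1 : ‖(2 * c) • n‖ = 2 * c := by
    rw [norm_smul, h.unit, mul_one, Real.norm_of_nonneg (by linarith [h.c_pos])]
  have h2 := norm_sub_le (u' - v') ((u' - u) - (v' - v))
  have h3 := norm_sub_le (u' - u) (v' - v)
  rw [← e, h1] at h2
  linarith [h.c_gt]

theorem norm_normal_sub_le (h : ReflectionFrame n u v c σ) (hr : r ≤ 1 / 10) (hu : ‖u' - u‖ ≤ r)
    (hv : ‖v' - v‖ ≤ r) : ‖‖u' - v'‖⁻¹ • (u' - v') - n‖ ≤ 4 * r := by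
  have hge := h.norm_sub_ge hr hu hv
  have h0 : u' - v' ≠ 0 := norm_pos_iff.1 (by linarith)
  have hc2 : ‖u - v‖ = 2 * c := by
    rw [h.outgoing_sub_incoming, norm_smul, h.unit, mul_one,
      Real.norm_of_nonneg (by linarith [h.c_pos])]
  have h0' : u - v ≠ 0 := norm_pos_iff.1 (by rw [hc2]; linarith [h.c_pos])
  have h1 := norm_normalize_sub_le (u' - v') (u - v) h0 h0'
  rw [hc2, h.outgoing_sub_incoming, smul_smul, inv_mul_cancel₀ (by linarith [h.c_pos]),
    one_smul] at h1
  refine h1.trans ?_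
  rw [div_le_iff₀ (by linarith [h.c_pos])]
  have e : u' - v' - (2 * c) • n = (u' - u) - (v' - v) := by
    rw [← h.outgoing_sub_incoming]; abel
  rw [e]
  have h3 := norm_sub_le (u' - u) (v' - v)
  have hr0 : 0 ≤ r := (norm_nonneg _).trans hu
  nlinarith [h.c_gt]

theorem inner_normal_sub (h : ReflectionFrame n u v c σ) {n' : Plane} (hn' : ‖n'‖ = 1) :
    inner ℝ (n' - n) n = -(‖n' - n‖ ^ 2 / 2) := by
  have := plane_unit h.unit
  have := plane_unit hn'
  rw [plane_norm_sq, plane_inner_eq]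
  simp only [PiLp.sub_apply]
  linarith

theorem inner_normal_sub_mul_le (h : ReflectionFrame n u v c σ) (hr : r ≤ 1 / 10)
    (hu : ‖u' - u‖ ≤ r) (hv : ‖v' - v‖ ≤ r) {y : ℝ} (hy : |y| ≤ 1) :
    y * inner ℝ (‖u' - v'‖⁻¹ • (u' - v') - n) n ≤ 8 * r ^ 2 := by
  have hge := h.norm_sub_ge hr hu hv
  have h0 : u' - v' ≠ 0 := norm_pos_iff.1 (by linarith)
  rw [h.inner_normal_sub (norm_inv_norm_smul h0)]
  have h1 := h.norm_normal_sub_le hr hu hv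
  set w := ‖‖u' - v'‖⁻¹ • (u' - v') - n‖
  have hw : 0 ≤ w := norm_nonneg _
  have h2 : w ^ 2 ≤ (4 * r) ^ 2 := by gcongr
  have h3 := (abs_le.1 hy).1
  nlinarith [sq_nonneg w]

/-- The displacement of the disk when the collision point moves tangentially. -/
theorem le_inner_of_tangential (h : ReflectionFrame n u v c σ) (hr : r ≤ 1 / 10)
    (hu : ‖u' - u‖ ≤ r) (hv : ‖v' - v‖ ≤ r) (hu'1 : ‖u'‖ = 1) (hv'1 : ‖v'‖ = 1)
    {e : Plane} (he : ‖e‖ = 1) {ε s κ : ℝ} (hε : |ε| = 1)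
    (hεe : ε * inner ℝ e (planeRot n) = |inner ℝ e (planeRot n)|) (hs : 0 ≤ s) (hκ : 0 ≤ κ)
    (hE : κ * s ≤ inner ℝ ((v' - v) - (u' - u)) (ε • planeRot n)) :
    |inner ℝ e (planeRot n)| * (s * (1 + κ / 2)) - 8 * r ^ 2
      ≤ inner ℝ (s • (ε • planeRot n) - (‖u' - v'‖⁻¹ • (u' - v') - n)) e := by
  have hge := h.norm_sub_ge hr hu hv
  have hle : ‖u' - v'‖ ≤ 2 := (norm_sub_le _ _).trans (by rw [hu'1, hv'1]; norm_num)
  have hn0 : ‖planeRot n‖ = 1 := (norm_planeRot n).trans h.unit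
  have hen : |inner ℝ e n| ≤ 1 := by
    refine (abs_real_inner_le_norm _ _).trans ?_
    rw [he, h.unit]; norm_num
  have h1 := h.inner_normal_sub_mul_le hr hu hv hen
  have hX : ε * inner ℝ (u' - v') (planeRot n) ≤ -(κ * s) := by
    have e1 : (v' - v) - (u' - u) = (2 * c) • n - (u' - v') := by
      rw [← h.outgoing_sub_incoming]; abel
    rw [e1, inner_smul_right, inner_sub_left, inner_smul_left, inner_planeRot_self] at hE
    simp at hE
    linarith
  have hXn : ε * (‖u' - v'‖⁻¹ * inner ℝ (u' - v') (planeRot n)) ≤ -(κ * s / 2) := by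
    have h2 : (1 / 2 : ℝ) ≤ ‖u' - v'‖⁻¹ := by
      rw [one_div]; exact inv_anti₀ (by linarith) hle
    have h3 : 0 ≤ κ * s := by positivity
    nlinarith [mul_le_mul_of_nonneg_left hX (by linarith : 0 ≤ ‖u' - v'‖⁻¹),
      mul_le_mul_of_nonneg_right h2 h3]
  rw [inner_eq_frame h.unit _ e]
  have i1 : (inner ℝ (s • (ε • planeRot n) - (‖u' - v'‖⁻¹ • (u' - v') - n)) n : ℝ)
      = -inner ℝ (‖u' - v'‖⁻¹ • (u' - v') - n) n := by
    rw [inner_sub_left, inner_smul_left, inner_smul_left, real_inner_comm, inner_planeRot_self]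
    simp
  have i2 : (inner ℝ (s • (ε • planeRot n) - (‖u' - v'‖⁻¹ • (u' - v') - n)) (planeRot n) : ℝ)
      = s * ε - ‖u' - v'‖⁻¹ * inner ℝ (u' - v') (planeRot n) := by
    rw [inner_sub_left, inner_smul_left, inner_smul_left, real_inner_self_eq_norm_sq, hn0,
      inner_sub_left, inner_smul_left, inner_planeRot_self]
    simp
  rw [i1, i2]
  have hεε : ε * ε = 1 := by rw [← abs_mul_abs_self, hε]; norm_num
  set et := inner ℝ e (planeRot n)
  set Y := ‖u' - v'‖⁻¹ * inner ℝ (u' - v') (planeRot n)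
  have e3 : et = ε * |et| := by rw [← hεe, ← mul_assoc, hεε, one_mul]
  have e4 : et * (s * ε - Y) = |et| * (s - ε * Y) := by
    calc et * (s * ε - Y) = ε * |et| * (s * ε - Y) := by rw [← e3]
      _ = |et| * (s * (ε * ε) - ε * Y) := by ring
      _ = _ := by rw [hεε, mul_one]
  rw [e4]
  nlinarith [mul_le_mul_of_nonneg_left hXn (abs_nonneg et)]

theorem turning_inequality {et m0 m1 A B D c σ ε s K d r : ℝ} (hc0 : 0 < c) (hc1 : c ≤ 1)
    (hε : |ε| = 1) (hεt : 0 ≤ ε * (σ * et)) (hs : 0 ≤ s) (hK : 0 ≤ K) (hr0 : 0 ≤ r)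
    (het : |et| ≤ 1) (hm : |m0| ≤ |m1|) (hmd : 0 ≤ d * m1) (hKm : |m1| ≤ K * |d|)
    (mu : 2 * |m0| ≤ r) (mv : 2 * |m1| ≤ r) (o1 : |A - -c| ≤ r) (o2 : |B - c| ≤ r)
    (o3 : |D - 2 * c * σ| ≤ r) (hdε : d = s * ε * D) :
    et * (2 * m0 * A - 2 * m1 * B) ≤ 4 * K * s * r + 2 * r ^ 2 := by
  have hsum : -(et * (m0 + m1)) ≤ 2 * K * s * r := by
    rcases le_or_gt 0 (et * m1) with hp | hp
    · have q1 : |et * m0| ≤ et * m1 := by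
        rw [← abs_of_nonneg hp, abs_mul, abs_mul]
        exact mul_le_mul_of_nonneg_left hm (abs_nonneg _)
      have q2 := (abs_le.1 q1).1
      have : 0 ≤ 2 * K * s * r := by positivity
      linarith
    · have q1 : et * d ≤ 0 := by
        by_contra hcon
        push Not at hcon
        have q2 : (et * m1) * (et * d) < 0 := mul_neg_of_neg_of_pos hp hcon
        nlinarith only [q2, mul_nonneg (sq_nonneg et) hmd]
      have q2 : -(s * r) ≤ et * d := by
        rw [hdε]
        have q3 : et * (s * ε * D) = s * (2 * c * (ε * (σ * et)))
            + s * ((ε * et) * (D - 2 * c * σ)) := by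
          ring
        rw [q3]
        have q4 : |(ε * et) * (D - 2 * c * σ)| ≤ 1 * r := by
          rw [abs_mul, abs_mul, hε, one_mul]
          exact mul_le_mul het o3 (abs_nonneg _) zero_le_one
        have q5 := (abs_le.1 q4).1
        have q6 : 0 ≤ s * (2 * c * (ε * (σ * et))) := by positivity
        nlinarith only [q5, q6, mul_le_mul_of_nonneg_left q5 hs]
      have q3 : |et| * |d| ≤ s * r := by
        rw [← abs_mul, abs_of_nonpos q1]; linarith
      have q4 : |et * (m0 + m1)| ≤ |et| * (2 * (K * |d|)) := by
        rw [abs_mul]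
        refine mul_le_mul_of_nonneg_left ?_ (abs_nonneg _)
        exact (abs_add_le _ _).trans (by linarith)
      have q5 := neg_le_abs (et * (m0 + m1))
      nlinarith only [q4, q5, mul_le_mul_of_nonneg_left q3 hK]
  have q0 : et * (2 * m0 * A - 2 * m1 * B) = -(2 * c) * (et * (m0 + m1))
      + et * (2 * m0 * (A - -c) - 2 * m1 * (B - c)) := by
    ring
  have q1 : |2 * m0 * (A - -c)| ≤ r * r := by
    rw [abs_mul, abs_mul, abs_two]
    exact mul_le_mul mu o1 (abs_nonneg _) hr0
  have q2 : |2 * m1 * (B - c)| ≤ r * r := by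
    rw [abs_mul, abs_mul, abs_two]
    exact mul_le_mul mv o2 (abs_nonneg _) hr0
  have q3 : |et * (2 * m0 * (A - -c) - 2 * m1 * (B - c))| ≤ 1 * (r * r + r * r) := by
    rw [abs_mul]
    exact mul_le_mul het ((abs_sub _ _).trans (add_le_add q1 q2)) (abs_nonneg _) zero_le_one
  have q4 := le_abs_self (et * (2 * m0 * (A - -c) - 2 * m1 * (B - c)))
  have q5 : -(2 * c) * (et * (m0 + m1)) ≤ 2 * (2 * K * s * r) := by
    have : 0 ≤ 2 * K * s * r := by positivity
    nlinarith only [this, hsum, hc0, hc1, mul_le_mul_of_nonneg_left hsum hc0.le]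
  rw [q0]; linarith

/-- The displacement of the disk when the collision point moves along the outgoing segment. -/
theorem le_inner_of_outgoing (h : ReflectionFrame n u v c σ) (hr : r ≤ 1 / 10)
    (hu : ‖u' - u‖ ≤ r) (hv : ‖v' - v‖ ≤ r) (hu'1 : ‖u'‖ = 1) (hv'1 : ‖v'‖ = 1)
    {e : Plane} (he : ‖e‖ = 1) {ε s K d : ℝ} (hε : |ε| = 1)
    (hεn : ε * inner ℝ e n = |inner ℝ e n|) (hεt : 0 ≤ ε * (σ * inner ℝ e (planeRot n)))
    (hs : 0 ≤ s) (hK : 0 ≤ K) (hm : |midSlope u u'| ≤ |midSlope v v'|)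
    (hd : d = midOffset v v' (s • (ε • u))) (hmd : 0 ≤ d * midSlope v v')
    (hKm : |midSlope v v'| ≤ K * |d|) :
    s * (c * |inner ℝ e n| + |σ| * |inner ℝ e (planeRot n)|) - 10 * r ^ 2 - 4 * K * s * r
      ≤ inner ℝ (s • (ε • u) - (‖u' - v'‖⁻¹ • (u' - v') - n)) e := by
  have hge := h.norm_sub_ge hr hu hv
  have hr0 : 0 ≤ r := (norm_nonneg _).trans hu
  have hn0 : ‖planeRot n‖ = 1 := (norm_planeRot n).trans h.unit
  have hen : |inner ℝ e n| ≤ 1 := by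
    refine (abs_real_inner_le_norm _ _).trans ?_
    rw [he, h.unit]; norm_num
  have het : |inner ℝ e (planeRot n)| ≤ 1 := by
    refine (abs_real_inner_le_norm _ _).trans ?_
    rw [he, hn0]; norm_num
  have h1 := h.inner_normal_sub_mul_le hr hu hv hen
  have hu0 : u + u' ≠ 0 := norm_pos_iff.1 (by
    linarith [norm_add_ge_of_unit (u' := u') h.unit_outgoing])
  have hv0 : v + v' ≠ 0 := norm_pos_iff.1 (by
    linarith [norm_add_ge_of_unit (u' := v') h.unit_incoming])
  have mu : 2 * |midSlope u u'| ≤ r := by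
    rw [← norm_sub_eq_midSlope h.unit_outgoing hu'1 hu0]; exact hu
  have mv : 2 * |midSlope v v'| ≤ r := by
    rw [← norm_sub_eq_midSlope h.unit_incoming hv'1 hv0]; exact hv
  have o1 := abs_midOffset_sub_planeCross_le h.unit_outgoing hu0 (planeRot n)
  have o2 := abs_midOffset_sub_planeCross_le h.unit_incoming hv0 (planeRot n)
  have o3 := abs_midOffset_sub_planeCross_le h.unit_incoming hv0 u
  rw [h.planeCross_rot_outgoing, hn0, one_mul] at o1
  rw [h.planeCross_rot_incoming, hn0, one_mul] at o2
  rw [h.planeCross_outgoing_incoming, h.unit_outgoing, one_mul] at o3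
  replace o1 := o1.trans hu
  replace o2 := o2.trans hv
  replace o3 := o3.trans hv
  have hdε : d = s * ε * midOffset v v' u := by
    rw [hd, smul_smul, midOffset, planeCross_smul_left, mul_div_assoc, ← midOffset]
  have hX : (inner ℝ (u' - v') (planeRot n) : ℝ) = 2 * midSlope u u' * midOffset u u' (planeRot n)
      - 2 * midSlope v v' * midOffset v v' (planeRot n) := by
    rw [← inner_sub_eq_midSlope_mul h.unit_outgoing hu'1 hu0,
      ← inner_sub_eq_midSlope_mul h.unit_incoming hv'1 hv0, ← inner_sub_left]
    have e1 : (u' - u) - (v' - v) = (u' - v') - (2 * c) • n := by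
      rw [← h.outgoing_sub_incoming]; abel
    rw [e1, inner_sub_left (u' - v'), inner_smul_left, inner_planeRot_self]; simp
  rw [inner_eq_frame h.unit _ e]
  have i1 : (inner ℝ (s • (ε • u) - (‖u' - v'‖⁻¹ • (u' - v') - n)) n : ℝ)
      = s * ε * c - inner ℝ (‖u' - v'‖⁻¹ • (u' - v') - n) n := by
    rw [inner_sub_left, h.outgoing_eq, inner_smul_left, inner_smul_left, inner_add_left,
      inner_smul_left, inner_smul_left, real_inner_self_eq_norm_sq, h.unit,
      real_inner_comm n (planeRot n), inner_planeRot_self]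
    simp; ring
  have i2 : (inner ℝ (s • (ε • u) - (‖u' - v'‖⁻¹ • (u' - v') - n)) (planeRot n) : ℝ)
      = s * ε * σ - ‖u' - v'‖⁻¹ * inner ℝ (u' - v') (planeRot n) := by
    rw [inner_sub_left, h.outgoing_eq, inner_smul_left, inner_smul_left, inner_add_left,
      inner_smul_left, inner_smul_left, real_inner_self_eq_norm_sq, hn0, inner_sub_left,
      inner_smul_left, inner_planeRot_self]
    simp; ring
  rw [i1, i2]
  set et := inner ℝ e (planeRot n)
  set en := inner ℝ e n
  set m0 := midSlope u u'
  set m1 := midSlope v v'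
  set X := inner ℝ (u' - v') (planeRot n)
  set A := midOffset u u' (planeRot n)
  set B := midOffset v v' (planeRot n)
  set D := midOffset v v' u
  have hc1 := h.c_le_one
  have hc0 := h.c_pos
  have hετ : ε * (σ * et) = |σ| * |et| := by
    rw [← abs_mul, ← abs_of_nonneg hεt, abs_mul, hε, one_mul]
  have hetX : et * X ≤ 4 * K * s * r + 2 * r ^ 2 := by
    rw [hX]
    exact turning_inequality hc0 hc1 hε hεt hs hK hr0 het hm hmd hKm mu mv o1 o2 o3 hdε
  have hetX' : et * (‖u' - v'‖⁻¹ * X) ≤ 4 * K * s * r + 2 * r ^ 2 := by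
    have q1 : ‖u' - v'‖⁻¹ ≤ 1 := inv_le_one_of_one_le₀ hge
    have q2 : 0 ≤ ‖u' - v'‖⁻¹ := by positivity
    have q3 : 0 ≤ 4 * K * s * r + 2 * r ^ 2 := by positivity
    calc et * (‖u' - v'‖⁻¹ * X) = ‖u' - v'‖⁻¹ * (et * X) := by ring
      _ ≤ ‖u' - v'‖⁻¹ * (4 * K * s * r + 2 * r ^ 2) := mul_le_mul_of_nonneg_left hetX q2
      _ ≤ _ := mul_le_of_le_one_left q3 q1
  have e1 : en * (s * ε * c) = s * (c * |en|) := by rw [← hεn]; ring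
  have e2 : et * (s * ε * σ) = s * (|σ| * |et|) := by rw [← hετ]; ring
  linarith [mul_sub en (s * ε * c) (inner ℝ (‖u' - v'‖⁻¹ • (u' - v') - n) n),
    mul_sub et (s * ε * σ) (‖u' - v'‖⁻¹ * X)]

end ReflectionFrame

/-- The elementary inequality behind the bound `π / 6` on the angle of incidence. -/
theorem frame_inequality {c σ x y τ : ℝ} (hcσ : c ^ 2 + σ ^ 2 = 1) (hc : 0 < c) (hσ : 0 ≤ σ)
    (hσ2 : σ < 1 / 2) (hxy : x ^ 2 + y ^ 2 = 1) (hx : 0 ≤ x) (hy : 0 ≤ y) (hyτ : y ≤ τ)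
    (hτ : τ < c) :
    2 * σ * c + (c - τ) * ((1 - 2 * σ) * (1 + σ)) / 2 ≤ c * x + σ * y := by
  have hx1 : x ≤ 1 := by nlinarith
  have hxσ : σ < x := by nlinarith
  have hpos : 0 < x + σ := by linarith
  have h1 : (c * x + σ * y - 2 * σ * c) * (x + σ) = (c - y) * (c * (c + y) - σ * (x + σ)) := by
    linear_combination (-c) * hcσ + c * hxy
  have hA : (1 - 2 * σ) * (1 + σ) ≤ c * (c + y) - σ * (x + σ) := by
    have : 0 ≤ c * y := by positivity
    nlinarith [mul_le_mul_of_nonneg_left hx1 hσ]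
  have hB : 0 < (1 - 2 * σ) * (1 + σ) := mul_pos (by linarith) (by linarith)
  have hC : (c - τ) * ((1 - 2 * σ) * (1 + σ)) ≤ (c * x + σ * y - 2 * σ * c) * (x + σ) := by
    rw [h1]
    exact mul_le_mul (by linarith) hA hB.le (by linarith)
  have hD : 0 < (c - τ) * ((1 - 2 * σ) * (1 + σ)) := mul_pos (by linarith) hB
  have hE : 0 ≤ c * x + σ * y - 2 * σ * c := by
    by_contra hcon
    push Not at hcon
    nlinarith
  have : x + σ ≤ 2 := by linarith
  nlinarith [mul_le_mul_of_nonneg_left this hE]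

/-- A segment that is displaced less, in the direction `e`, than the centre `p` of a unit disk
meets the displaced disk, if it passed close to the disk. -/
theorem exists_mem_segment_dist_lt {A B A' B' p p' e x : Plane} {ρ d h η : ℝ} (he : ‖e‖ = 1)
    (hx : x ∈ segment ℝ A B) (hxp : x = p + ρ • e) (hA : |inner ℝ e (A' - A)| ≤ d)
    (hB : |inner ℝ e (B' - B)| ≤ d) (hA' : ‖A' - A‖ ≤ h) (hB' : ‖B' - B‖ ≤ h)
    (hp : ‖p' - p‖ ≤ h) (hV : d + η ≤ inner ℝ (p' - p) e) (hρ : 2 * h ≤ ρ)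
    (hlt : (ρ - η) ^ 2 + (2 * h) ^ 2 < 1) :
    ∃ x' ∈ segment ℝ A' B', dist x' p' < 1 := by
  obtain ⟨a, b, ha, hb, hab, rfl⟩ := hx
  refine ⟨a • A' + b • B', ⟨a, b, ha, hb, hab, rfl⟩, ?_⟩
  set z : Plane := (a • (A' - A) + b • (B' - B)) - (p' - p) with hz
  have e1 : a • A' + b • B' - p' = ρ • e + z := by
    have : ρ • e = a • A + b • B - p := by rw [hxp]; abel
    rw [this, hz, smul_sub, smul_sub]; abel
  have hz1 : ‖z‖ ≤ 2 * h := by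
    have h1 : ‖a • (A' - A) + b • (B' - B)‖ ≤ h := by
      refine (norm_add_le _ _).trans ?_
      rw [norm_smul, norm_smul, Real.norm_of_nonneg ha, Real.norm_of_nonneg hb]
      calc a * ‖A' - A‖ + b * ‖B' - B‖ ≤ a * h + b * h := by gcongr
        _ = h := by rw [← add_mul, hab, one_mul]
    exact (norm_sub_le _ _).trans (by linarith)
  have hz2 : inner ℝ e z ≤ -η := by
    rw [hz, inner_sub_right, inner_add_right, inner_smul_right, inner_smul_right,
      real_inner_comm (p' - p) e]
    have h1 := mul_le_mul_of_nonneg_left ((abs_le.1 hA).2) ha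
    have h2 := mul_le_mul_of_nonneg_left ((abs_le.1 hB).2) hb
    have h3 : a * d + b * d = d := by rw [← add_mul, hab, one_mul]
    have h4 := hV
    rw [real_inner_comm] at h4
    linarith
  have hz3 : -(2 * h) ≤ inner ℝ e z := by
    have := (abs_le.1 (abs_real_inner_le_norm e z)).1
    rw [he, one_mul] at this
    linarith
  have hn : ‖ρ • e + z‖ ^ 2 = (ρ + inner ℝ e z) ^ 2 - inner ℝ e z ^ 2 + ‖z‖ ^ 2 := by
    rw [norm_add_sq_real, norm_smul, he, mul_one, inner_smul_left, Real.norm_eq_abs, sq_abs]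
    simp; ring
  rw [dist_eq_norm, e1]
  have h0 : 0 ≤ h := (norm_nonneg _).trans hp
  have h5 : (ρ + inner ℝ e z) ^ 2 ≤ (ρ - η) ^ 2 := by
    apply sq_le_sq₀ (by linarith) (by linarith) |>.2; linarith
  have h6 : ‖z‖ ^ 2 ≤ (2 * h) ^ 2 := by gcongr
  have h7 : ‖ρ • e + z‖ ^ 2 < 1 := by
    rw [hn]; nlinarith [sq_nonneg (inner ℝ e z : ℝ)]
  nlinarith [norm_nonneg (ρ • e + z)]

theorem submodule_inter_finite (Λ : Submodule ℤ Plane) [DiscreteTopology Λ] (p : Plane) (R : ℝ) :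
    {a : Plane | a ∈ Λ ∧ dist p a ≤ R}.Finite := by
  have hcl : IsClosed (Λ : Set Plane) :=
    @AddSubgroup.isClosed_of_discrete _ _ _ _ _ Λ.toAddSubgroup ‹DiscreteTopology Λ›
  have h := Metric.finite_isBounded_inter_isClosed (s := (Λ : Set Plane))
    (K := Metric.closedBall p R) DiscreteTopology.isDiscrete Metric.isBounded_closedBall hcl
  refine h.subset fun a ha => ⟨?_, ha.1⟩
  rw [Metric.mem_closedBall, dist_comm]; exact ha.2

theorem two_lt_dist_of_disjoint {p q : Plane}
    (h : Disjoint (Metric.closedBall p 1) (Metric.closedBall q 1)) : 2 < dist p q := by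
  by_contra hcon
  push Not at hcon
  have hm := Set.disjoint_left.1 h
  refine @hm (midpoint ℝ p q) ?_ ?_
  · rw [Metric.mem_closedBall, dist_midpoint_left, Real.norm_ofNat]; linarith
  · rw [Metric.mem_closedBall, dist_midpoint_right, Real.norm_ofNat]; linarith

theorem IsBilliard.exists_gap {ι : Type*} [Finite ι] {Λ : Submodule ℤ Plane} [DiscreteTopology Λ]
    {c : ι → Plane} (hc : IsBilliard Λ c) :
    ∃ g : ℝ, 0 < g ∧ ∀ i j : ι, ∀ a ∈ Λ, (i ≠ j ∨ a ≠ 0) → 2 + g ≤ dist (c i) (c j + a) := by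
  have key : ∀ p : ι × ι, ∃ g : ℝ, 0 < g ∧ ∀ a ∈ Λ, (p.1 ≠ p.2 ∨ a ≠ 0) →
      2 + g ≤ dist (c p.1) (c p.2 + a) := by
    rintro ⟨i, j⟩
    set S : Set Plane := {a | a ∈ Λ ∧ dist (c i - c j) a ≤ 3} ∩ {a | i ≠ j ∨ a ≠ 0} with hS
    have hfin : S.Finite := (submodule_inter_finite Λ (c i - c j) 3).inter_of_left _
    have hd : ∀ a, dist (c i) (c j + a) = dist (c i - c j) a := fun a => by
      rw [dist_eq_norm, dist_eq_norm]; congr 1; abel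
    rcases S.eq_empty_or_nonempty with h0 | h0
    · refine ⟨1, one_pos, fun a ha hne => ?_⟩
      by_contra hcon
      have : a ∈ S := ⟨⟨ha, by rw [← hd]; simp only at hcon; linarith⟩, hne⟩
      rw [h0] at this; exact this
    · obtain ⟨b, hb, hmin⟩ := Set.exists_min_image S (fun a => dist (c i) (c j + a)) hfin h0
      have h2 := two_lt_dist_of_disjoint (hc i j b hb.1.1 hb.2)
      refine ⟨min 1 (dist (c i) (c j + b) - 2), lt_min one_pos (by linarith), fun a ha hne => ?_⟩
      by_cases haS : a ∈ S
      · have := hmin a haS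
        have := min_le_right 1 (dist (c i) (c j + b) - 2)
        simp only at *; linarith
      · have h3 : 3 < dist (c i) (c j + a) := by
          by_contra hcon
          push Not at hcon
          exact haS ⟨⟨ha, by rw [← hd]; exact hcon⟩, hne⟩
        have := min_le_left 1 (dist (c i) (c j + b) - 2)
        simp only; linarith
  choose G hG using key
  rcases isEmpty_or_nonempty ι with hι | hι
  · exact ⟨1, one_pos, fun i => hι.elim i⟩
  obtain ⟨p, hp⟩ := Finite.exists_min G
  exact ⟨G p, (hG p).1, fun i j a ha hne => by
    have := (hG (i, j)).2 a ha hne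
    have := hp (i, j)
    simp only at *; linarith⟩

theorem exists_approx_of_isZLattice (Λ : Submodule ℤ Plane) [DiscreteTopology Λ]
    [IsZLattice ℝ Λ] :
    ∃ K : ℝ, ∀ x : Plane, ∃ p ∈ Λ, ‖x - p‖ ≤ K := by
  set b := Module.Free.chooseBasis ℤ Λ
  have : Fintype (Module.Free.ChooseBasisIndex ℤ Λ) := inferInstance
  set B := b.ofZLatticeBasis ℝ Λ
  refine ⟨∑ i, ‖B i‖, fun x => ⟨ZSpan.floor B x, ?_, ?_⟩⟩
  · have h := (ZSpan.floor B x).2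
    exact (b.ofZLatticeBasis_span ℝ Λ).le h
  · rw [← ZSpan.fract_apply]; exact ZSpan.norm_fract_le B x

/-- Simultaneous approximation: every direction has a lattice vector close to the ray it spans, at
bounded distance. -/
theorem exists_lattice_vector_near_ray (Λ : Submodule ℤ Plane) [DiscreteTopology Λ]
    [IsZLattice ℝ Λ] :
    ∃ M : ℝ, ∀ u : Plane, ∃ p ∈ Λ, ∃ t : ℝ, 3 ≤ t ∧ t ≤ M ∧ ‖p - t • u‖ < 1 / 2 := by
  obtain ⟨K, hK⟩ := exists_approx_of_isZLattice Λ
  have htb := (isCompact_closedBall (0 : Plane) K).totallyBounded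
  obtain ⟨S, hSfin, hS⟩ := Metric.totallyBounded_iff.1 htb (1 / 4) (by norm_num)
  refine ⟨3 * (hSfin.toFinset.card : ℝ), fun u => ?_⟩
  choose f hf hfK using hK
  have hcov : ∀ j : ℕ, ∃ y ∈ hSfin.toFinset,
      dist ((3 * (j : ℝ)) • u - f ((3 * (j : ℝ)) • u)) y < 1 / 4 := by
    intro j
    have h1 : (3 * (j : ℝ)) • u - f ((3 * (j : ℝ)) • u) ∈ Metric.closedBall (0 : Plane) K := by
      rw [mem_closedBall_zero_iff]; exact hfK _
    obtain ⟨y, hy, hd⟩ := Set.mem_iUnion₂.1 (hS h1)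
    exact ⟨y, hSfin.mem_toFinset.2 hy, hd⟩
  choose y hy hyd using hcov
  obtain ⟨i, hi, j, hj, hij, hyy⟩ := Finset.exists_ne_map_eq_of_card_lt_of_maps_to
    (s := Finset.range (hSfin.toFinset.card + 1)) (t := hSfin.toFinset) (by simp)
    (f := y) (fun j _ => hy j)
  wlog hlt : i < j generalizing i j
  · exact this j hj i hi hij.symm hyy.symm (by omega)
  rw [Finset.mem_range] at hi hj
  refine ⟨f ((3 * (j : ℝ)) • u) - f ((3 * (i : ℝ)) • u), Λ.sub_mem (hf _) (hf _),
    3 * (j : ℝ) - 3 * (i : ℝ), ?_, ?_, ?_⟩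
  · have : (i : ℝ) + 1 ≤ j := by exact_mod_cast hlt
    linarith
  · have h1 : (j : ℝ) ≤ hSfin.toFinset.card := by exact_mod_cast Nat.lt_succ_iff.1 hj
    have h2 : (0 : ℝ) ≤ i := Nat.cast_nonneg i
    linarith
  · have h1 := hyd i
    have h2 := hyd j
    rw [← hyy, dist_comm] at h2
    have h3 := (dist_triangle _ _ _).trans_lt (add_lt_add h1 h2)
    rw [dist_eq_norm] at h3
    have e : (3 * (i : ℝ)) • u - f ((3 * (i : ℝ)) • u) - ((3 * (j : ℝ)) • u - f ((3 * (j : ℝ)) • u))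
        = f ((3 * (j : ℝ)) • u) - f ((3 * (i : ℝ)) • u) - (3 * (j : ℝ) - 3 * (i : ℝ)) • u := by
      rw [sub_smul]; abel
    rw [e] at h3
    linarith

theorem norm_direction {Q : ℤ → Plane} {k : ℤ} (h : Q k ≠ Q (k + 1)) : ‖direction Q k‖ = 1 :=
  norm_inv_norm_smul (sub_ne_zero.2 h.symm)

theorem norm_smul_direction {Q : ℤ → Plane} {k : ℤ} (h : Q k ≠ Q (k + 1)) :
    ‖Q (k + 1) - Q k‖ • direction Q k = Q (k + 1) - Q k := by
  rw [direction, smul_smul, mul_inv_cancel₀ (norm_ne_zero_iff.2 (sub_ne_zero.2 h.symm)), one_smul]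

theorem add_smul_direction_mem_segment {Q : ℤ → Plane} {k : ℤ} (h : Q k ≠ Q (k + 1)) {t : ℝ}
    (ht : 0 ≤ t) (ht' : t ≤ ‖Q (k + 1) - Q k‖) :
    Q k + t • direction Q k ∈ segment ℝ (Q k) (Q (k + 1)) := by
  have hpos : 0 < ‖Q (k + 1) - Q k‖ := norm_pos_iff.2 (sub_ne_zero.2 h.symm)
  rw [segment_eq_image']
  refine ⟨t / ‖Q (k + 1) - Q k‖, ⟨by positivity, (div_le_one hpos).2 ht'⟩, ?_⟩
  rw [direction, smul_smul, div_eq_mul_inv]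

theorem direction_add_period {Q : ℤ → Plane} {w : Plane} {N : ℕ}
    (h : ∀ k, Q (k + N) = Q k + w) (k : ℤ) : direction Q (k + N) = direction Q k := by
  have e : Q (k + N + 1) - Q (k + N) = Q (k + 1) - Q k := by
    rw [add_right_comm, h, h]; abel
  rw [direction, direction, e]

/-- A ray from the boundary of a unit disk that avoids the open disk points outwards. -/
theorem inner_nonneg_of_segment_avoids {p x y : Plane} (hx : ‖x - p‖ = 1)
    (h : ∀ z ∈ segment ℝ x y, z ∉ Metric.ball p 1) : 0 ≤ inner ℝ (y - x) (x - p) := by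
  by_contra hcon
  push Not at hcon
  set a : ℝ := -inner ℝ (y - x) (x - p) with ha
  have ha0 : 0 < a := by linarith
  have hL : 0 < ‖y - x‖ ^ 2 := by
    have : y - x ≠ 0 := fun h0 => by rw [h0, inner_zero_left] at hcon; exact lt_irrefl _ hcon
    have := norm_pos_iff.2 this
    positivity
  set t := min 1 (a / ‖y - x‖ ^ 2) with ht
  have ht0 : 0 < t := lt_min one_pos (by positivity)
  have ht1 : t ≤ 1 := min_le_left _ _
  have ht2 : t * ‖y - x‖ ^ 2 ≤ a := (le_div_iff₀ hL).1 (min_le_right _ _)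
  refine h (x + t • (y - x)) ?_ ?_
  · rw [segment_eq_image']; exact ⟨t, ⟨ht0.le, ht1⟩, rfl⟩
  · rw [mem_ball_iff_norm, show x + t • (y - x) - p = (x - p) + t • (y - x) by abel]
    have e : ‖(x - p) + t • (y - x)‖ ^ 2 = 1 - 2 * t * a + t ^ 2 * ‖y - x‖ ^ 2 := by
      rw [norm_add_sq_real, hx, norm_smul, inner_smul_right, real_inner_comm, mul_pow,
        Real.norm_eq_abs, sq_abs, ha]
      ring
    have : ‖(x - p) + t • (y - x)‖ ^ 2 < 1 := by
      rw [e]; nlinarith [mul_pos ht0 ha0]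
    nlinarith [norm_nonneg ((x - p) + t • (y - x))]

namespace IsPeriodicOrbit

variable {ι : Type*} {Λ : Submodule ℤ Plane} {c : ι → Plane} {N : ℕ} {σ : ℤ → ι} {g : ℤ → Plane}
  {w : Plane} {Q : ℤ → Plane}

theorem norm_normal (h : IsPeriodicOrbit Λ c N σ g w Q) (k : ℤ) :
    ‖Q k - (c (σ k) + g k)‖ = 1 := by
  rw [← dist_eq_norm]; exact h.mem_boundary k

theorem outgoing (h : IsPeriodicOrbit Λ c N σ g w Q) (k : ℤ) :
    0 ≤ inner ℝ (direction Q k) (Q k - (c (σ k) + g k)) := by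
  rw [direction, inner_smul_left]
  refine mul_nonneg (by simp) (inner_nonneg_of_segment_avoids (h.norm_normal k) fun z hz => ?_)
  exact h.segment_subset k hz _ _ (h.g_mem k)

theorem incoming (h : IsPeriodicOrbit Λ c N σ g w Q) (k : ℤ) :
    inner ℝ (direction Q k) (Q (k + 1) - (c (σ (k + 1)) + g (k + 1))) ≤ 0 := by
  have h1 := h.outgoing (k + 1)
  have h2 := h.reflection (k + 1)
  rw [add_sub_cancel_right] at h2
  rw [inner_reflect (h.norm_normal (k + 1)) h2] at h1
  linarith

theorem next_disk_ne (h : IsPeriodicOrbit Λ c N σ g w Q) (k : ℤ) :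
    σ k ≠ σ (k + 1) ∨ g (k + 1) - g k ≠ 0 := by
  by_contra hcon
  push Not at hcon
  obtain ⟨h1, h2⟩ := hcon
  rw [sub_eq_zero] at h2
  have a1 := h.norm_normal k
  have a2 := h.norm_normal (k + 1)
  rw [← h1, h2] at a2
  have hm : midpoint ℝ (Q k) (Q (k + 1)) ∈ segment ℝ (Q k) (Q (k + 1)) :=
    midpoint_mem_segment _ _
  refine h.segment_subset k hm (σ k) (g k) (h.g_mem k) ?_
  set p := c (σ k) + g k
  rw [mem_ball_iff_norm]
  have hpar := parallelogram_law_with_norm ℝ (Q k - p) (Q (k + 1) - p)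
  rw [a1, a2] at hpar
  have e1 : midpoint ℝ (Q k) (Q (k + 1)) - p = (2⁻¹ : ℝ) • ((Q k - p) + (Q (k + 1) - p)) := by
    rw [midpoint_eq_smul_add, invOf_eq_inv]
    have : p = (2⁻¹ : ℝ) • (p + p) := by
      rw [← two_smul ℝ p, smul_smul]; norm_num
    conv_lhs => rw [this]
    rw [← smul_sub]; congr 1; abel
  have e2 : Q k - p - (Q (k + 1) - p) = Q k - Q (k + 1) := by abel
  rw [e2] at hpar
  have hpos : 0 < ‖Q k - Q (k + 1)‖ := norm_pos_iff.2 (sub_ne_zero.2 (h.ne_next k))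
  rw [e1, norm_smul]
  norm_num
  nlinarith [norm_nonneg ((Q k - p) + (Q (k + 1) - p))]

theorem dist_centres (h : IsPeriodicOrbit Λ c N σ g w Q) {γ : ℝ}
    (hγ : ∀ i j : ι, ∀ a ∈ Λ, (i ≠ j ∨ a ≠ 0) → 2 + γ ≤ dist (c i) (c j + a)) (k : ℤ) :
    2 + γ ≤ ‖(c (σ (k + 1)) + g (k + 1)) - (c (σ k) + g k)‖ := by
  have := hγ (σ k) (σ (k + 1)) _ (Λ.sub_mem (h.g_mem (k + 1)) (h.g_mem k)) (h.next_disk_ne k)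
  rw [dist_comm, dist_eq_norm] at this
  convert this using 1; congr 1; abel

theorem two_le_period (h : IsPeriodicOrbit Λ c N σ g w Q)
    (h0 : inner ℝ (direction Q 0) (Q 0 - (c (σ 0) + g 0)) ≠ 0) : 2 ≤ N := by
  have hN := h.period_pos
  by_contra hcon
  have hN1 : N = 1 := by omega
  have h1 := direction_add_period h.Q_periodic (-1)
  rw [hN1] at h1
  norm_num at h1
  have h2 := inner_reflect (h.norm_normal 0) (h.reflection 0)
  norm_num at h2
  rw [← h1] at h2
  exact h0 (by linarith)

theorem length_lt_of_lattice (h : IsPeriodicOrbit Λ c N σ g w Q) {k : ℤ}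
    (hin : 0 < inner ℝ (direction Q k) (Q k - (c (σ k) + g k)))
    (hang : 3 / 4 < inner ℝ (direction Q k) (Q k - (c (σ k) + g k)) ^ 2)
    {p : Plane} (hp : p ∈ Λ) {t : ℝ} (ht : 3 ≤ t) (hpt : ‖p - t • direction Q k‖ < 1 / 2) :
    ‖Q (k + 1) - Q k‖ < t := by
  by_contra hcon
  push Not at hcon
  set n := Q k - (c (σ k) + g k) with hn
  set u := direction Q k with hu
  have hn1 : ‖n‖ = 1 := h.norm_normal k
  have hu1 : ‖u‖ = 1 := norm_direction (h.ne_next k)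
  set a := inner ℝ u n with ha
  have ha1 : a ≤ 1 := (real_inner_le_norm u n).trans (by rw [hn1, hu1]; norm_num)
  have hmem := add_smul_direction_mem_segment (h.ne_next k) (t := t - a) (by linarith)
    (by linarith)
  refine h.segment_subset k hmem (σ k) (g k + p) (Λ.add_mem (h.g_mem k) hp) ?_
  rw [mem_ball_iff_norm, ← hu]
  have e : Q k + (t - a) • u - (c (σ k) + (g k + p)) = (n - a • u) - (p - t • u) := by
    rw [hn, sub_smul]; abel
  rw [e]
  have h1 : ‖n - a • u‖ ^ 2 = 1 - a ^ 2 := by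
    rw [norm_sub_sq_real, hn1, norm_smul, hu1, inner_smul_right, real_inner_comm u n, ← ha,
      mul_one, Real.norm_eq_abs, sq_abs]
    ring
  have h2 : ‖n - a • u‖ < 1 / 2 := by
    nlinarith [norm_nonneg (n - a • u)]
  exact (norm_sub_le _ _).trans_lt (by linarith)

end IsPeriodicOrbit

/-- Segments that leave a scatterer under an angle less than `π / 6` have bounded length. -/
theorem IsBilliard.exists_length_bound {ι : Type*} [Finite ι] {Λ : Submodule ℤ Plane}
    [DiscreteTopology Λ] (hΛ : Λ = ⊥ ∨ IsZLattice ℝ Λ) (c : ι → Plane) :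
    ∃ M : ℝ, ∀ (N : ℕ) (σ : ℤ → ι) (g : ℤ → Plane) (w : Plane) (Q : ℤ → Plane),
      IsPeriodicOrbit Λ c N σ g w Q → ∀ k : ℤ,
      0 < inner ℝ (direction Q k) (Q k - (c (σ k) + g k)) →
      3 / 4 < inner ℝ (direction Q k) (Q k - (c (σ k) + g k)) ^ 2 →
      ‖Q (k + 1) - Q k‖ ≤ M := by
  rcases hΛ with rfl | hΛ
  · rcases isEmpty_or_nonempty ι with hι | hι
    · exact ⟨0, fun N σ => hι.elim (σ 0)⟩
    obtain ⟨p, hp⟩ := Finite.exists_max fun p : ι × ι => ‖c p.1 - c p.2‖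
    refine ⟨‖c p.1 - c p.2‖ + 2, fun N σ g w Q h k _ _ => ?_⟩
    have h1 := h.norm_normal k
    have h2 := h.norm_normal (k + 1)
    have g1 := (Submodule.mem_bot ℤ).1 (h.g_mem k)
    have g2 := (Submodule.mem_bot ℤ).1 (h.g_mem (k + 1))
    rw [g1, add_zero] at h1
    rw [g2, add_zero] at h2
    have h3 := hp (σ (k + 1), σ k)
    have e : Q (k + 1) - Q k = (Q (k + 1) - c (σ (k + 1))) + (c (σ (k + 1)) - c (σ k))
        - (Q k - c (σ k)) := by abel
    rw [e]
    refine (norm_sub_le _ _).trans ?_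
    have := norm_add_le (Q (k + 1) - c (σ (k + 1))) (c (σ (k + 1)) - c (σ k))
    simp only at h3
    linarith
  · obtain ⟨M, hM⟩ := exists_lattice_vector_near_ray Λ
    refine ⟨M, fun N σ g w Q h k hin hang => ?_⟩
    obtain ⟨p, hp, t, ht3, htM, hpt⟩ := hM (direction Q k)
    exact ((h.length_lt_of_lattice hin hang hp ht3 hpt).le).trans htM

/-- A periodic orbit `Q` and a periodic orbit `P` with the same itinerary of the billiard in which
the scatterer `i₀` has been moved to `C`; the collision points with the scatterer `i₀` differ
by `x₀`. -/
structure OrbitPair {ι : Type*} [DecidableEq ι] (Λ : Submodule ℤ Plane) (c : ι → Plane) (i₀ : ι)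
    (C : Plane) (N : ℕ) (σ : ℤ → ι) (g : ℤ → Plane) (w : Plane) (Q P : ℤ → Plane) (x₀ : Plane)
    (γ : ℝ) : Prop where
  orbit : IsPeriodicOrbit Λ c N σ g w Q
  orbit' : IsPeriodicOrbit Λ (Function.update c i₀ C) N σ g w P
  code : ∀ k : ℤ, σ k = i₀ ↔ (N : ℤ) ∣ k
  gap : ∀ i j : ι, ∀ a ∈ Λ, (i ≠ j ∨ a ≠ 0) → 2 + 2 * γ ≤ dist (c i) (c j + a)
  gap_pos : 0 < γ
  start : P 0 = Q 0 + x₀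
  small : ‖x₀‖ ≤ γ / 2

theorem add_mul_period {Q : ℤ → Plane} {w : Plane} {N : ℕ} (h : ∀ k, Q (k + N) = Q k + w)
    (k j : ℤ) : Q (k + j * N) = Q k + j • w := by
  induction j using Int.induction_on with
  | zero => simp
  | succ j ih => rw [add_mul, one_mul, ← add_assoc, h, ih, add_smul, one_smul, add_assoc]
  | pred j ih =>
    have := h (k + (-(j : ℤ) - 1) * N)
    rw [show k + (-(j : ℤ) - 1) * N + N = k + -(j : ℤ) * N by ring, ih] at this
    rw [sub_smul, one_smul, eq_sub_iff_add_eq.2 this.symm]; abel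

namespace OrbitPair

variable {ι : Type*} [DecidableEq ι] {Λ : Submodule ℤ Plane} {c : ι → Plane} {i₀ : ι}
  {C : Plane} {N : ℕ} {σ : ℤ → ι} {g : ℤ → Plane} {w : Plane} {Q P : ℤ → Plane} {x₀ : Plane}
  {γ : ℝ}

theorem sub_add_period (h : OrbitPair Λ c i₀ C N σ g w Q P x₀ γ) (k j : ℤ) :
    P (k + j * N) - Q (k + j * N) = P k - Q k := by
  rw [add_mul_period h.orbit'.Q_periodic, add_mul_period h.orbit.Q_periodic]; abel

theorem sub_of_dvd (h : OrbitPair Λ c i₀ C N σ g w Q P x₀ γ) {k : ℤ} (hk : (N : ℤ) ∣ k) :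
    P k - Q k = x₀ := by
  obtain ⟨j, rfl⟩ := hk
  have := h.sub_add_period 0 j
  rw [zero_add, mul_comm] at this
  rw [this, h.start]; abel

theorem centre_of_not_dvd (h : OrbitPair Λ c i₀ C N σ g w Q P x₀ γ) {k : ℤ}
    (hk : ¬ (N : ℤ) ∣ k) : Function.update c i₀ C (σ k) = c (σ k) :=
  Function.update_of_ne (fun h0 => hk ((h.code k).1 h0)) _ _

theorem norm_sub_centre_le (h : OrbitPair Λ c i₀ C N σ g w Q P x₀ γ) (k : ℤ) :
    ‖P k - (c (σ k) + g k)‖ ≤ 1 + γ / 2 := by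
  by_cases hk : (N : ℤ) ∣ k
  · have e : P k - (c (σ k) + g k) = (P k - Q k) + (Q k - (c (σ k) + g k)) := by abel
    rw [e, h.sub_of_dvd hk]
    refine (norm_add_le _ _).trans ?_
    rw [h.orbit.norm_normal k]; linarith [h.small]
  · have := h.orbit'.norm_normal k
    rw [h.centre_of_not_dvd hk] at this
    rw [this]; linarith [h.gap_pos]

theorem inner_axis_ge {O O' A A' : Plane} {r : ℝ} (hA : ‖A - O‖ ≤ r) (hA' : ‖A' - O'‖ ≤ r) :
    ‖O' - O‖ * (‖O' - O‖ - 2 * r) ≤ inner ℝ (A' - A) (O' - O) := by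
  have e : A' - A = (O' - O) + (A' - O') - (A - O) := by abel
  rw [e, inner_sub_left, inner_add_left, real_inner_self_eq_norm_sq]
  have h1 := (abs_le.1 (abs_real_inner_le_norm (A' - O') (O' - O))).1
  have h2 := (abs_le.1 (abs_real_inner_le_norm (A - O) (O' - O))).2
  have h3 := mul_le_mul_of_nonneg_right hA (norm_nonneg (O' - O))
  have h4 := mul_le_mul_of_nonneg_right hA' (norm_nonneg (O' - O))
  nlinarith

theorem norm_axis_ge {O O' A A' : Plane} {r : ℝ} (hA : ‖A - O‖ ≤ r) (hA' : ‖A' - O'‖ ≤ r) :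
    ‖O' - O‖ - 2 * r ≤ ‖A' - A‖ := by
  have e : O' - O = (A' - A) - (A' - O') + (A - O) := by abel
  rw [e]
  have := norm_add_le ((A' - A) - (A' - O')) (A - O)
  have := norm_sub_le (A' - A) (A' - O')
  linarith

theorem length_ge (h : OrbitPair Λ c i₀ C N σ g w Q P x₀ γ) (k : ℤ) :
    2 * γ ≤ ‖Q (k + 1) - Q k‖ := by
  have := norm_axis_ge (h.orbit.norm_normal k).le (h.orbit.norm_normal (k + 1)).le
  linarith [h.orbit.dist_centres h.gap k]

theorem length_ge' (h : OrbitPair Λ c i₀ C N σ g w Q P x₀ γ) (k : ℤ) :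
    γ ≤ ‖P (k + 1) - P k‖ := by
  have := norm_axis_ge (h.norm_sub_centre_le k) (h.norm_sub_centre_le (k + 1))
  linarith [h.orbit.dist_centres h.gap k]

theorem direction_add_ne_zero (h : OrbitPair Λ c i₀ C N σ g w Q P x₀ γ) (k : ℤ) :
    direction Q k + direction P k ≠ 0 := by
  have hd := h.orbit.dist_centres h.gap k
  set f := (c (σ (k + 1)) + g (k + 1)) - (c (σ k) + g k) with hf
  have h1 := inner_axis_ge (h.orbit.norm_normal k).le (h.orbit.norm_normal (k + 1)).le
  have h2 := inner_axis_ge (h.norm_sub_centre_le k) (h.norm_sub_centre_le (k + 1))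
  rw [← hf] at h1 h2
  have hγ := h.gap_pos
  have p1 : 0 < inner ℝ (Q (k + 1) - Q k) f :=
    lt_of_lt_of_le (mul_pos (by linarith) (by linarith)) h1
  have p2 : 0 < inner ℝ (P (k + 1) - P k) f :=
    lt_of_lt_of_le (mul_pos (by linarith) (by linarith)) h2
  have q1 : 0 < inner ℝ (direction Q k) f := by
    rw [direction, inner_smul_left]
    exact mul_pos (by simpa using sub_ne_zero.2 (h.orbit.ne_next k).symm) p1
  have q2 : 0 < inner ℝ (direction P k) f := by
    rw [direction, inner_smul_left]
    exact mul_pos (by simpa using sub_ne_zero.2 (h.orbit'.ne_next k).symm) p2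
  intro h0
  have : inner ℝ (direction Q k + direction P k) f = 0 := by rw [h0, inner_zero_left]
  rw [inner_add_left] at this
  linarith

theorem not_dvd_of_lt {k : ℕ} (hk : k + 1 < N) : ¬ (N : ℤ) ∣ ((k + 1 : ℕ) : ℤ) := by
  intro h
  have := Nat.le_of_dvd (by omega) (Int.natCast_dvd_natCast.1 h)
  omega

theorem reflectingPair (h : OrbitPair Λ c i₀ C N σ g w Q P x₀ γ) :
    ReflectingPair N (fun k => direction Q k) (fun k => direction P k)
      (fun k => Q k - (c (σ k) + g k)) (fun k => P k - (c (σ k) + g k))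
      (fun k => P k - Q k) (fun k => ‖Q (k + 1) - Q k‖) (fun k => ‖P (k + 1) - P k‖) where
  unit k _ := norm_direction (h.orbit.ne_next k)
  unit' k _ := norm_direction (h.orbit'.ne_next k)
  add_ne_zero k _ := h.direction_add_ne_zero k
  pos k _ := by linarith [h.length_ge k, h.gap_pos]
  pos' k _ := by linarith [h.length_ge' k, h.gap_pos]
  step k _ := by
    rw [norm_smul_direction (h.orbit.ne_next k), norm_smul_direction (h.orbit'.ne_next k)]
    push_cast; abel
  normal_unit k _ := h.orbit.norm_normal _
  normal_unit' k hk := by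
    have := h.orbit'.norm_normal ((k + 1 : ℕ) : ℤ)
    rwa [h.centre_of_not_dvd (not_dvd_of_lt hk)] at this
  displacement k _ := by abel
  reflect k _ := by
    have := h.orbit.reflection ((k + 1 : ℕ) : ℤ)
    rwa [show (((k + 1 : ℕ) : ℤ) - 1) = (k : ℤ) by push_cast; ring] at this
  reflect' k hk := by
    have := h.orbit'.reflection ((k + 1 : ℕ) : ℤ)
    rwa [h.centre_of_not_dvd (not_dvd_of_lt hk),
      show (((k + 1 : ℕ) : ℤ) - 1) = (k : ℤ) by push_cast; ring] at this
  incoming k _ := h.orbit.incoming k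
  incoming' k hk := by
    have := h.orbit'.incoming k
    have h2 := h.centre_of_not_dvd (not_dvd_of_lt hk)
    push_cast at h2 ⊢
    rwa [h2] at this

theorem period_pos (h : OrbitPair Λ c i₀ C N σ g w Q P x₀ γ) : 0 < N := h.orbit.period_pos

theorem displacement_zero (h : OrbitPair Λ c i₀ C N σ g w Q P x₀ γ) :
    P ((0 : ℕ) : ℤ) - Q ((0 : ℕ) : ℤ) = x₀ := h.sub_of_dvd (by simp)

theorem displacement_last (h : OrbitPair Λ c i₀ C N σ g w Q P x₀ γ) :
    P ((N - 1 + 1 : ℕ) : ℤ) - Q ((N - 1 + 1 : ℕ) : ℤ) = x₀ := by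
  rw [Nat.sub_add_cancel h.period_pos]; exact h.sub_of_dvd dvd_rfl

theorem direction_last (h : OrbitPair Λ c i₀ C N σ g w Q P x₀ γ) :
    direction Q ((N - 1 : ℕ) : ℤ) = direction Q (-1) := by
  rw [← direction_add_period h.orbit.Q_periodic (-1)]
  congr 1
  have := h.period_pos
  omega

theorem direction_last' (h : OrbitPair Λ c i₀ C N σ g w Q P x₀ γ) :
    direction P ((N - 1 : ℕ) : ℤ) = direction P (-1) := by
  rw [← direction_add_period h.orbit'.Q_periodic (-1)]
  congr 1
  have := h.period_pos
  omega

theorem abs_midOffset_zero (h : OrbitPair Λ c i₀ C N σ g w Q P x₀ γ) {s : ℝ} (hs : ‖x₀‖ ≤ s) :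
    |midOffset (direction Q ((0 : ℕ) : ℤ)) (direction P ((0 : ℕ) : ℤ))
      (P ((0 : ℕ) : ℤ) - Q ((0 : ℕ) : ℤ))| ≤ s := by
  rw [h.displacement_zero]; exact (abs_midOffset_le _).trans hs

theorem abs_midOffset_last (h : OrbitPair Λ c i₀ C N σ g w Q P x₀ γ) {s : ℝ} (hs : ‖x₀‖ ≤ s) :
    |midOffset (direction Q ((N - 1 : ℕ) : ℤ)) (direction P ((N - 1 : ℕ) : ℤ))
      (P ((N - 1 + 1 : ℕ) : ℤ) - Q ((N - 1 + 1 : ℕ) : ℤ))| ≤ s := by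
  rw [h.displacement_last]; exact (abs_midOffset_le _).trans hs

theorem length_add_ge (h : OrbitPair Λ c i₀ C N σ g w Q P x₀ γ) (k : ℤ) :
    2 * γ ≤ ‖Q (k + 1) - Q k‖ + ‖P (k + 1) - P k‖ := by
  linarith [h.length_ge k, h.length_ge' k, h.gap_pos]

theorem norm_direction_sub_le (h : OrbitPair Λ c i₀ C N σ g w Q P x₀ γ) {s : ℝ} (hs : ‖x₀‖ ≤ s)
    {k : ℕ} (hk : k < N) : ‖direction P k - direction Q k‖ ≤ 2 * s / γ :=
  h.reflectingPair.norm_direction_sub_le h.gap_pos (fun k _ => h.length_add_ge k)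
    (h.abs_midOffset_zero hs) (h.abs_midOffset_last hs) hk

theorem norm_displacement_le (h : OrbitPair Λ c i₀ C N σ g w Q P x₀ γ) {s : ℝ} (hs : ‖x₀‖ ≤ s)
    (hs1 : s ≤ 1) (hsγ : 2 * s / γ ≤ 1 / 10) {k : ℕ} (hk : k ≤ N) :
    ‖P k - Q k‖ ≤ s + 4 * (2 * s / γ) := by
  have hs0 : 0 ≤ s := (norm_nonneg _).trans hs
  have hr : 0 ≤ 2 * s / γ := div_nonneg (by linarith) h.gap_pos.le
  rcases Nat.eq_zero_or_pos k with rfl | hk0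
  · rw [h.displacement_zero]; linarith
  rcases hk.eq_or_lt with rfl | hkN
  · rw [h.sub_of_dvd dvd_rfl]; linarith
  · obtain ⟨j, rfl⟩ := Nat.exists_eq_add_of_lt hk0
    rw [zero_add] at hkN ⊢
    have := h.reflectingPair.norm_displacement_le h.gap_pos (fun k _ => h.length_add_ge k)
      (h.abs_midOffset_zero hs) (h.abs_midOffset_last hs) hs1 hsγ hkN
    linarith

/-- The new normal at the collision with the moved scatterer. -/
theorem normal_eq (h : OrbitPair Λ c i₀ C N σ g w Q P x₀ γ)
    (hne : direction P 0 - direction P (-1) ≠ 0) :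
    P 0 - (C + g 0)
      = ‖direction P 0 - direction P (-1)‖⁻¹ • (direction P 0 - direction P (-1)) := by
  have h0 : σ 0 = i₀ := (h.code 0).2 (dvd_zero _)
  have hn := h.orbit'.norm_normal 0
  have hr := h.orbit'.reflection 0
  have ho := h.orbit'.outgoing 0
  rw [zero_sub] at hr
  rw [h0, Function.update_self] at hn hr ho
  have hi := inner_reflect hn hr
  set n := P 0 - (C + g 0)
  have e : direction P 0 - direction P (-1) = (2 * inner ℝ (direction P 0) n) • n := by
    rw [hi, hr]; simp
  have hnorm : ‖direction P 0 - direction P (-1)‖ = 2 * inner ℝ (direction P 0) n := by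
    rw [e, norm_smul, hn, mul_one, Real.norm_of_nonneg (by linarith)]
  have h1 : 2 * inner ℝ (direction P 0) n ≠ 0 := by rw [← hnorm]; exact norm_ne_zero_iff.2 hne
  rw [hnorm, e, smul_smul, inv_mul_cancel₀ h1, one_smul]

theorem centre_sub (h : OrbitPair Λ c i₀ C N σ g w Q P x₀ γ)
    (hne : direction P 0 - direction P (-1) ≠ 0) :
    C - c i₀ = x₀ - (‖direction P 0 - direction P (-1)‖⁻¹ • (direction P 0 - direction P (-1))
      - (Q 0 - (c (σ 0) + g 0))) := by
  have h0 : σ 0 = i₀ := (h.code 0).2 (dvd_zero _)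
  rw [← h.normal_eq hne, h0, h.start]; abel

end OrbitPair

/-- The frame of the reflection at the scatterer `i₀`. -/
theorem IsPeriodicOrbit.reflectionFrame {ι : Type*} {Λ : Submodule ℤ Plane} {c : ι → Plane} {N : ℕ}
    {σ : ℤ → ι} {g : ℤ → Plane} {w : Plane} {Q : ℤ → Plane} (h : IsPeriodicOrbit Λ c N σ g w Q)
    {a : ℝ} (ha : 0 < a) (ha2 : 3 / 4 < a ^ 2)
    (hin : inner ℝ (direction Q 0) (Q 0 - (c (σ 0) + g 0)) = a) :
    ReflectionFrame (Q 0 - (c (σ 0) + g 0)) (direction Q 0) (direction Q (-1)) a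
      (inner ℝ (direction Q 0) (planeRot (Q 0 - (c (σ 0) + g 0)))) := by
  have hn := h.norm_normal 0
  have hr := h.reflection 0
  rw [zero_sub] at hr
  have hu := norm_direction (h.ne_next 0)
  have hi := inner_reflect hn hr
  set n := Q 0 - (c (σ 0) + g 0)
  have e1 : direction Q 0 = a • n + inner ℝ (direction Q 0) (planeRot n) • planeRot n := by
    have en := plane_unit hn
    rw [← hin]
    apply plane_ext
    · simp only [plane_inner_eq, PiLp.add_apply, PiLp.smul_apply, smul_eq_mul, planeRot_zero,
        planeRot_one]
      linear_combination (-(direction Q 0 0)) * en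
    · simp only [plane_inner_eq, PiLp.add_apply, PiLp.smul_apply, smul_eq_mul, planeRot_zero,
        planeRot_one]
      linear_combination (-(direction Q 0 1)) * en
  refine ⟨hn, ?_, ha2, ha, e1, ?_⟩
  · have := inner_sq_add_inner_sq_frame hn hu
    rwa [hin] at this
  · have e2 : direction Q (-1) = direction Q 0 - (2 * a) • n := by
      have h3 : inner ℝ (direction Q (-1)) n = -a := by linarith
      rw [h3] at hr
      rw [hr, mul_neg, neg_smul]; abel
    have e3 : direction Q (-1)
        = (a • n + inner ℝ (direction Q 0) (planeRot n) • planeRot n) - (2 * a) • n := by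
      rw [← e1]; exact e2
    rw [e3, two_mul, add_smul, neg_smul]; abel

/-- The conditions on the size `s` of the displacement of a collision point: `γ` is a lower bound
for the free path, `r` the resulting bound for the change of directions, `κ₁` a lower bound for the
second variation of the length, and `κ` the relative speed of a scatterer and a segment. -/
structure StepSize (γ κ₁ κ s r : ℝ) : Prop where
  s_pos : 0 < s
  s_le_one : s ≤ 1
  r_eq : r = 2 * s / γ
  r_le : r ≤ 1 / 10
  energy : 4 * r ^ 4 ≤ κ₁ * s ^ 2
  error : 2 * s * r + 16 * r ^ 2 ≤ κ * s / 4
  transverse : (2 * (s + 4 * r)) ^ 2 ≤ κ * s / 8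
  displacement : 2 * (s + 4 * r) ≤ 1
  κ_pos : 0 < κ
  κ_le_one : κ ≤ 1
  κ₁_pos : 0 < κ₁

theorem eventually_mul_le (A : ℝ) {B : ℝ} (hB : 0 < B) :
    ∀ᶠ s in nhdsWithin (0 : ℝ) (Set.Ioi 0), A * s ≤ B := by
  have h : Filter.Tendsto (fun s : ℝ => A * s) (nhdsWithin (0 : ℝ) (Set.Ioi 0)) (nhds (A * 0)) :=
    (Continuous.tendsto (by fun_prop) 0).mono_left nhdsWithin_le_nhds
  rw [mul_zero] at h
  exact (h.eventually (gt_mem_nhds hB)).mono fun s hs => hs.le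

theorem exists_stepSize {γ κ₁ κ ε : ℝ} (hγ : 0 < γ) (hκ₁ : 0 < κ₁) (hκ : 0 < κ) (hκ1 : κ ≤ 1)
    (hε : 0 < ε) :
    ∃ s r : ℝ, StepSize γ κ₁ κ s r ∧ s + 4 * r ≤ ε := by
  have hpos : ∀ᶠ s in nhdsWithin (0 : ℝ) (Set.Ioi 0), 0 < s :=
    eventually_mem_nhdsWithin
  set b := 2 / γ with hb
  have hb0 : 0 < b := by positivity
  obtain ⟨s, hs, h1, h2, h3, h4, h5, h6, h7⟩ := (hpos.and ((eventually_mul_le 1 one_pos).and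
    ((eventually_mul_le b (B := 1 / 10) (by norm_num)).and
    ((eventually_mul_le (4 * b ^ 4) hκ₁).and
    ((eventually_mul_le (2 * b + 16 * b ^ 2) (B := κ / 4) (by linarith)).and
    ((eventually_mul_le (4 * (1 + 4 * b) ^ 2) (B := κ / 8) (by linarith)).and
    ((eventually_mul_le (2 * (1 + 4 * b)) one_pos).and
    (eventually_mul_le (1 + 4 * b) hε)))))))).exists
  have hs1 : s ≤ 1 := by linarith
  refine ⟨s, b * s, ⟨hs, hs1, by rw [hb]; ring, h2, ?_, ?_, ?_, by linarith, hκ, hκ1, hκ₁⟩,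
    by linarith⟩
  · calc 4 * (b * s) ^ 4 = 4 * b ^ 4 * s * (s ^ 2 * s) := by ring
      _ ≤ 4 * b ^ 4 * s * (s ^ 2 * 1) := by gcongr
      _ = 4 * b ^ 4 * s * s ^ 2 := by ring
      _ ≤ κ₁ * s ^ 2 := by gcongr
  · nlinarith [mul_le_mul_of_nonneg_right h4 hs.le]
  · nlinarith [mul_le_mul_of_nonneg_right h5 hs.le]

namespace StepSize

variable {γ κ₁ κ s r : ℝ}

theorem r_pos (hS : StepSize γ κ₁ κ s r) (hγ : 0 < γ) : 0 < r := by
  rw [hS.r_eq]; have := hS.s_pos; positivity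

theorem s_le (hS : StepSize γ κ₁ κ s r) (hγ : 0 < γ) : s ≤ γ / 2 := by
  have h1 := hS.r_le
  rw [hS.r_eq, div_le_iff₀ hγ] at h1
  linarith

end StepSize

namespace OrbitPair

variable {ι : Type*} [DecidableEq ι] {Λ : Submodule ℤ Plane} {c : ι → Plane} {i₀ : ι}
  {C : Plane} {N : ℕ} {σ : ℤ → ι} {g : ℤ → Plane} {w : Plane} {Q P : ℤ → Plane} {x₀ : Plane}
  {γ κ₁ κ s r a σ₀ : ℝ}

theorem norm_first_sub_le (h : OrbitPair Λ c i₀ C N σ g w Q P x₀ γ)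
    (hS : StepSize γ κ₁ κ s r) (hx : ‖x₀‖ ≤ s) : ‖direction P 0 - direction Q 0‖ ≤ r := by
  rw [hS.r_eq]; exact h.norm_direction_sub_le hx (k := 0) h.period_pos

theorem norm_last_sub_le (h : OrbitPair Λ c i₀ C N σ g w Q P x₀ γ)
    (hS : StepSize γ κ₁ κ s r) (hx : ‖x₀‖ ≤ s) : ‖direction P (-1) - direction Q (-1)‖ ≤ r := by
  rw [hS.r_eq, ← h.direction_last, ← h.direction_last']
  exact h.norm_direction_sub_le hx (k := N - 1) (by have := h.period_pos; omega)

theorem norm_turn_ge (h : OrbitPair Λ c i₀ C N σ g w Q P x₀ γ) (hS : StepSize γ κ₁ κ s r)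
    (hx : ‖x₀‖ ≤ s)
    (hF : ReflectionFrame (Q 0 - (c (σ 0) + g 0)) (direction Q 0) (direction Q (-1)) a σ₀) :
    1 ≤ ‖direction P 0 - direction P (-1)‖ :=
  hF.norm_sub_ge hS.r_le (h.norm_first_sub_le hS hx) (h.norm_last_sub_le hS hx)

theorem turn_ne_zero (h : OrbitPair Λ c i₀ C N σ g w Q P x₀ γ) (hS : StepSize γ κ₁ κ s r)
    (hx : ‖x₀‖ ≤ s)
    (hF : ReflectionFrame (Q 0 - (c (σ 0) + g 0)) (direction Q 0) (direction Q (-1)) a σ₀) :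
    direction P 0 - direction P (-1) ≠ 0 :=
  norm_pos_iff.1 (by linarith [h.norm_turn_ge hS hx hF])

theorem norm_centre_sub_le (h : OrbitPair Λ c i₀ C N σ g w Q P x₀ γ) (hS : StepSize γ κ₁ κ s r)
    (hx : ‖x₀‖ ≤ s)
    (hF : ReflectionFrame (Q 0 - (c (σ 0) + g 0)) (direction Q 0) (direction Q (-1)) a σ₀) :
    ‖C - c i₀‖ ≤ s + 4 * r := by
  rw [h.centre_sub (h.turn_ne_zero hS hx hF)]
  refine (norm_sub_le _ _).trans (add_le_add hx ?_)
  exact hF.norm_normal_sub_le hS.r_le (h.norm_first_sub_le hS hx) (h.norm_last_sub_le hS hx)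

/-- If the lift `c i₀ + b` of the scatterer approaches a segment faster than the segment recedes,
there is no orbit. -/
theorem false_of_approach (h : OrbitPair Λ c i₀ C N σ g w Q P x₀ γ) (hS : StepSize γ κ₁ κ s r)
    (hx : ‖x₀‖ ≤ s)
    (hF : ReflectionFrame (Q 0 - (c (σ 0) + g 0)) (direction Q 0) (direction Q (-1)) a σ₀)
    {k : ℕ} (hk : k < N) {b : Plane} (hb : b ∈ Λ) {e y : Plane} (he : ‖e‖ = 1)
    (hy : y ∈ segment ℝ (Q k) (Q (k + 1))) {ρ : ℝ} (hyρ : y = (c i₀ + b) + ρ • e) (hρ1 : 1 ≤ ρ)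
    (hρ2 : ρ ≤ 1 + κ * s / 2) {d : ℝ}
    (hd0 : |inner ℝ e (P k - Q k)| ≤ d + (s + 4 * r) * r)
    (hd1 : |inner ℝ e (P (k + 1) - Q (k + 1))| ≤ d + (s + 4 * r) * r)
    (hV : d + s * r + κ * s - 10 * r ^ 2 - 2 * r ^ 2
      ≤ inner ℝ (C - c i₀) e + 2 * s * r) : False := by
  have hγ := h.gap_pos
  have hdisp : ∀ j : ℕ, j ≤ N → ‖P j - Q j‖ ≤ s + 4 * r := fun j hj => by
    have := h.norm_displacement_le hx hS.s_le_one (by rw [← hS.r_eq]; exact hS.r_le) hj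
    rwa [← hS.r_eq] at this
  have hr0 := hS.r_pos hγ
  have hs0 := hS.s_pos
  have herr := hS.error
  have hκs : 0 < κ * s := mul_pos hS.κ_pos hs0
  have hκs1 : κ * s ≤ 1 := mul_le_one₀ hS.κ_le_one hs0.le hS.s_le_one
  obtain ⟨x', hx', hlt⟩ := exists_mem_segment_dist_lt (A' := P k) (B' := P (k + 1))
    (p' := C + b) (η := κ * s - κ * s / 4) he hy hyρ hd0 hd1
    (hdisp k hk.le) (by have := hdisp (k + 1) hk; push_cast at this; exact this)
    (by rw [add_sub_add_right_eq_sub]; exact h.norm_centre_sub_le hS hx hF)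
    (by rw [add_sub_add_right_eq_sub]; nlinarith only [hV, herr, hr0, hs0, sq_nonneg r])
    (by linarith [hS.displacement])
    (by
      have h1 : (ρ - (κ * s - κ * s / 4)) ^ 2 ≤ (1 - κ * s / 4) ^ 2 := by
        apply pow_le_pow_left₀ (by linarith); linarith
      have h2 := hS.transverse
      nlinarith only [h1, h2, hκs, hκs1])
  refine h.orbit'.segment_subset k hx' i₀ b hb ?_
  rw [Function.update_self]
  exact hlt

theorem abs_midOffset_smul_le {u u' q : Plane} (hu : ‖u‖ = 1) (hw : u + u' ≠ 0) (hq : ‖q‖ = 1)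
    (hs : 0 ≤ s) (hr : ‖u' - u‖ ≤ r) :
    |midOffset u u' (s • q)| ≤ s * (|planeCross q u| + r) ∧
      s * (|planeCross q u| - r) ≤ |midOffset u u' (s • q)| := by
  have e : midOffset u u' (s • q) = s * midOffset u u' q := by
    rw [midOffset, planeCross_smul_left, mul_div_assoc, ← midOffset]
  have h1 := abs_midOffset_sub_planeCross_le hu hw q
  rw [hq, one_mul] at h1
  have h2 := abs_sub_abs_le_abs_sub (midOffset u u' q) (planeCross q u)
  have h3 := abs_sub_abs_le_abs_sub (planeCross q u) (midOffset u u' q)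
  rw [abs_sub_comm] at h3
  rw [e, abs_mul, abs_of_nonneg hs]
  exact ⟨mul_le_mul_of_nonneg_left (by linarith) hs, mul_le_mul_of_nonneg_left (by linarith) hs⟩

/-- The displacement of the segments of a pair whose first and last offsets are bounded. -/
theorem abs_inner_displacement_le (h : OrbitPair Λ c i₀ C N σ g w Q P x₀ γ)
    (hS : StepSize γ κ₁ κ s r) (hx : ‖x₀‖ ≤ s) {d : ℝ} {x : ℕ → Plane} {l : ℕ → ℝ}
    (hR : ReflectingPair N (fun k => direction Q k) (fun k => direction P k)
      (fun k => Q k - (c (σ k) + g k)) (fun k => P k - (c (σ k) + g k)) x l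
      (fun k => ‖P (k + 1) - P k‖))
    (h0 : |midOffset (direction Q ((0 : ℕ) : ℤ)) (direction P ((0 : ℕ) : ℤ)) (x 0)| ≤ d)
    (hN : |midOffset (direction Q ((N - 1 : ℕ) : ℤ)) (direction P ((N - 1 : ℕ) : ℤ))
      (x (N - 1 + 1))| ≤ d)
    {k : ℕ} (hk : k < N) {e : Plane} (he : ‖e‖ = 1) (heu : inner ℝ e (direction Q k) = 0) :
    (x k = P k - Q k → |inner ℝ e (P k - Q k)| ≤ d + (s + 4 * r) * r) ∧
    (x (k + 1) = P ((k + 1 : ℕ) : ℤ) - Q ((k + 1 : ℕ) : ℤ) →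
      |inner ℝ e (P (k + 1) - Q (k + 1))| ≤ d + (s + 4 * r) * r) := by
  have hdisp : ∀ j : ℕ, j ≤ N → ‖P j - Q j‖ ≤ s + 4 * r := fun j hj => by
    have := h.norm_displacement_le hx hS.s_le_one (by rw [← hS.r_eq]; exact hS.r_le) hj
    rwa [← hS.r_eq] at this
  have hu : ‖direction P k - direction Q k‖ ≤ r := by
    rw [hS.r_eq]; exact h.norm_direction_sub_le hx hk
  have h1 := hR.abs_inner_start_le h0 hN hk he heu
  have h2 := hR.abs_inner_end_le h0 hN hk he heu
  have hr0 := hS.r_pos h.gap_pos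
  have hs0 := hS.s_pos
  constructor
  · intro hxk
    rw [hxk] at h1
    refine h1.trans (add_le_add le_rfl ?_)
    exact mul_le_mul (hdisp k hk.le) hu (norm_nonneg _) (by linarith)
  · intro hxk
    rw [hxk] at h2
    push_cast at h2
    refine h2.trans (add_le_add le_rfl ?_)
    have := hdisp (k + 1) hk
    push_cast at this
    exact mul_le_mul this hu (norm_nonneg _) (by linarith)

/-- Tangential motion of the collision point. -/
theorem false_of_tangential (h : OrbitPair Λ c i₀ C N σ g w Q P x₀ γ) (hS : StepSize γ κ₁ κ s r)
    (hN2 : 2 ≤ N)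
    (hF : ReflectionFrame (Q 0 - (c (σ 0) + g 0)) (direction Q 0) (direction Q (-1)) a σ₀)
    {M : ℝ} (hM : ‖Q (0 + 1) - Q 0‖ ≤ M) (hκ₁ : κ₁ = 1 / (8 * (2 * M + 5)))
    {k : ℕ} (hk : k < N) {b : Plane} (hb : b ∈ Λ) {e y : Plane} (he : ‖e‖ = 1)
    (heu : inner ℝ e (direction Q k) = 0)
    (hy : y ∈ segment ℝ (Q k) (Q (k + 1))) {ρ : ℝ} (hyρ : y = (c i₀ + b) + ρ • e) (hρ1 : 1 ≤ ρ)
    (hρ2 : ρ ≤ 1 + κ * s / 2) {ε τ : ℝ} (hε : |ε| = 1)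
    (hεe : ε * inner ℝ e (planeRot (Q 0 - (c (σ 0) + g 0)))
      = |inner ℝ e (planeRot (Q 0 - (c (σ 0) + g 0)))|)
    (hx₀ : x₀ = s • (ε • planeRot (Q 0 - (c (σ 0) + g 0))))
    (hτ : τ ≤ |inner ℝ e (planeRot (Q 0 - (c (σ 0) + g 0)))|)
    (hκτ : a + κ ≤ τ * (1 + κ₁ / 2)) : False := by
  set n := Q 0 - (c (σ 0) + g 0) with hn
  have hγ := h.gap_pos
  have hs0 := hS.s_pos
  have hr0 := hS.r_pos hγ
  have hq : ‖ε • planeRot n‖ = 1 := by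
    rw [norm_smul, norm_planeRot, hF.unit, Real.norm_eq_abs, hε, mul_one]
  have hx : ‖x₀‖ ≤ s := by
    rw [hx₀, norm_smul, hq, mul_one, Real.norm_of_nonneg hs0.le]
  have hu := h.norm_first_sub_le hS hx
  have hv := h.norm_last_sub_le hS hx
  have hw0 := h.direction_add_ne_zero 0
  have hwN := h.direction_add_ne_zero (-1)
  have c0 : |planeCross (ε • planeRot n) (direction Q 0)| = a := by
    rw [planeCross_smul_left, hF.planeCross_rot_outgoing, abs_mul, hε, abs_neg,
      abs_of_pos hF.c_pos, one_mul]
  have cN : |planeCross (ε • planeRot n) (direction Q (-1))| = a := by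
    rw [planeCross_smul_left, hF.planeCross_rot_incoming, abs_mul, hε,
      abs_of_pos hF.c_pos, one_mul]
  have m0 := abs_midOffset_smul_le hF.unit_outgoing hw0 hq hs0.le hu
  have mN := abs_midOffset_smul_le hF.unit_incoming hwN hq hs0.le hv
  rw [c0, ← hx₀] at m0
  rw [cN, ← hx₀] at mN
  have hb0 : |midOffset (direction Q ((0 : ℕ) : ℤ)) (direction P ((0 : ℕ) : ℤ))
      (P ((0 : ℕ) : ℤ) - Q ((0 : ℕ) : ℤ))| ≤ s * (a + r) := by
    rw [h.displacement_zero]; exact m0.1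
  have hbN : |midOffset (direction Q ((N - 1 : ℕ) : ℤ)) (direction P ((N - 1 : ℕ) : ℤ))
      (P ((N - 1 + 1 : ℕ) : ℤ) - Q ((N - 1 + 1 : ℕ) : ℤ))| ≤ s * (a + r) := by
    rw [h.displacement_last, h.direction_last, h.direction_last']; exact mN.1
  have hdd := h.abs_inner_displacement_le hS hx h.reflectingPair hb0 hbN hk he heu
  have hl0 : ‖Q (((0 : ℕ) : ℤ) + 1) - Q ((0 : ℕ) : ℤ)‖ + ‖P (((0 : ℕ) : ℤ) + 1) - P ((0 : ℕ) : ℤ)‖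
      ≤ 2 * M + 1 := by
    have d1 := h.norm_displacement_le hx hS.s_le_one (by rw [← hS.r_eq]; exact hS.r_le)
      (k := 1) (by omega)
    rw [← hS.r_eq] at d1
    push_cast at d1 ⊢
    have e1 : P (0 + 1) - P 0 = (P (0 + 1) - Q (0 + 1)) + (Q (0 + 1) - Q 0) - x₀ := by
      rw [h.start]; abel
    have d2 := norm_sub_le ((P (0 + 1) - Q (0 + 1)) + (Q (0 + 1) - Q 0)) x₀
    have d3 := norm_add_le (P (0 + 1) - Q (0 + 1)) (Q (0 + 1) - Q 0)
    rw [← e1] at d2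
    have := hS.displacement
    rw [zero_add] at d2 d3 hM
    linarith
  have hen := h.reflectingPair.offset_sq_le_energy hN2 hγ (fun k _ => h.length_add_ge k)
    (h.abs_midOffset_zero hx) (h.abs_midOffset_last hx) hS.s_le_one
    (by rw [← hS.r_eq]; exact hS.r_le) hl0
  rw [h.displacement_zero, h.displacement_last, h.direction_last, h.direction_last',
    ← hS.r_eq] at hen
  have hM0 : 0 ≤ M := (norm_nonneg _).trans hM
  have hE : κ₁ * s ≤ inner ℝ ((direction P (-1) - direction Q (-1))
      - (direction P 0 - direction Q 0)) (ε • planeRot n) := by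
    have e1 : inner ℝ (direction P (-1) - direction Q (-1)) x₀
        - inner ℝ (direction P ((0 : ℕ) : ℤ) - direction Q ((0 : ℕ) : ℤ)) x₀
        = s * inner ℝ ((direction P (-1) - direction Q (-1))
          - (direction P 0 - direction Q 0)) (ε • planeRot n) := by
      rw [hx₀, ← inner_sub_left, inner_smul_right]; rfl
    rw [e1] at hen
    set X := inner ℝ ((direction P (-1) - direction Q (-1))
          - (direction P 0 - direction Q 0)) (ε • planeRot n)
    have h1 : s * (1 / 2) ≤ |midOffset (direction Q 0) (direction P 0) x₀| := by
      refine le_trans (mul_le_mul_of_nonneg_left ?_ hs0.le) m0.2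
      linarith [hF.c_gt, hS.r_le]
    have h2 : (s * (1 / 2)) ^ 2 ≤ midOffset (direction Q 0) (direction P 0) x₀ ^ 2 := by
      rw [← sq_abs (midOffset _ _ _)]; gcongr
    have h3 : (s * (1 / 2)) ^ 2 ≤ (2 * M + 5) * (s * X + 4 * r ^ 4) := by
      refine h2.trans (hen.trans (le_of_eq ?_)); ring
    have h4 : (2 * M + 5) * κ₁ = 1 / 8 := by rw [hκ₁]; field_simp
    have h5 := hS.energy
    have h6 : (2 * M + 5) * (2 * κ₁ * s ^ 2) ≤ (2 * M + 5) * (s * X + κ₁ * s ^ 2) := by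
      have : (2 * M + 5) * (s * X + 4 * r ^ 4) ≤ (2 * M + 5) * (s * X + κ₁ * s ^ 2) := by
        gcongr
      nlinarith only [this, h3, h4]
    have h7 := le_of_mul_le_mul_left h6 (by linarith)
    have h8 : s * (κ₁ * s) ≤ s * X := by linarith only [h7, show s * (κ₁ * s) = κ₁ * s ^ 2 by ring]
    exact le_of_mul_le_mul_left h8 hs0
  have hVe := hF.le_inner_of_tangential hS.r_le hu hv
    (norm_direction (h.orbit'.ne_next 0)) (norm_direction (h.orbit'.ne_next (-1))) he hε hεe
    hs0.le hS.κ₁_pos.le hE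
  rw [← hx₀, ← h.centre_sub (h.turn_ne_zero hS hx hF)] at hVe
  refine h.false_of_approach hS hx hF hk hb he hy hyρ hρ1 hρ2 (hdd.1 rfl) (hdd.2 rfl) ?_
  have h1 : s * (a + κ) ≤ |inner ℝ e (planeRot n)| * (s * (1 + κ₁ / 2)) := by
    have : 0 ≤ s * (1 + κ₁ / 2) := by have := hS.κ₁_pos; positivity
    calc s * (a + κ) ≤ s * (τ * (1 + κ₁ / 2)) := by gcongr
      _ = τ * (s * (1 + κ₁ / 2)) := by ring
      _ ≤ _ := mul_le_mul_of_nonneg_right hτ this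
  nlinarith only [h1, hVe, sq_nonneg r]

/-- Motion of the collision point along the outgoing segment. -/
theorem false_of_outgoing (h : OrbitPair Λ c i₀ C N σ g w Q P x₀ γ) (hS : StepSize γ κ₁ κ s r)
    (hN2 : 2 ≤ N)
    (hF : ReflectionFrame (Q 0 - (c (σ 0) + g 0)) (direction Q 0) (direction Q (-1)) a σ₀)
    {k : ℕ} (hk : k < N) {b : Plane} (hb : b ∈ Λ) {e y : Plane} (he : ‖e‖ = 1)
    (heu : inner ℝ e (direction Q k) = 0)
    (hy : y ∈ segment ℝ (Q k) (Q (k + 1))) {ρ : ℝ} (hyρ : y = (c i₀ + b) + ρ • e) (hρ1 : 1 ≤ ρ)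
    (hρ2 : ρ ≤ 1 + κ * s / 2) {ε : ℝ} (hε : |ε| = 1)
    (hεn : ε * inner ℝ e (Q 0 - (c (σ 0) + g 0)) = |inner ℝ e (Q 0 - (c (σ 0) + g 0))|)
    (hεt : 0 ≤ ε * (σ₀ * inner ℝ e (planeRot (Q 0 - (c (σ 0) + g 0)))))
    (hx₀ : x₀ = s • (ε • direction Q 0))
    (hκ : 2 * |σ₀| * a + κ ≤ a * |inner ℝ e (Q 0 - (c (σ 0) + g 0))|
      + |σ₀| * |inner ℝ e (planeRot (Q 0 - (c (σ 0) + g 0)))|) : False := by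
  set n := Q 0 - (c (σ 0) + g 0) with hn
  have hγ := h.gap_pos
  have hs0 := hS.s_pos
  have hr0 := hS.r_pos hγ
  have hq : ‖ε • direction Q 0‖ = 1 := by
    rw [norm_smul, hF.unit_outgoing, Real.norm_eq_abs, hε, mul_one]
  have hx : ‖x₀‖ ≤ s := by
    rw [hx₀, norm_smul, hq, mul_one, Real.norm_of_nonneg hs0.le]
  have hu := h.norm_first_sub_le hS hx
  have hv := h.norm_last_sub_le hS hx
  have hwN := h.direction_add_ne_zero (-1)
  have cN : |planeCross (ε • direction Q 0) (direction Q (-1))| = 2 * |σ₀| * a := by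
    rw [planeCross_smul_left, hF.planeCross_outgoing_incoming, abs_mul, hε, abs_mul, abs_mul,
      abs_of_pos hF.c_pos, abs_two]; ring
  have mN := abs_midOffset_smul_le hF.unit_incoming hwN hq hs0.le hv
  rw [cN, ← hx₀] at mN
  have hsε : s * ε ≤ γ / 2 := by
    have h1 := le_abs_self (s * ε)
    rw [abs_mul, hε, mul_one, abs_of_pos hs0] at h1
    exact h1.trans (hS.s_le hγ)
  have hlen := h.length_ge 0
  have hR := h.reflectingPair.shiftStart (t := s * ε) (by
      change s * ε < ‖Q (0 + 1) - Q 0‖; linarith)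
    (by rw [h.displacement_zero, hx₀, smul_smul]; rfl)
  set x : ℕ → Plane := Function.update (fun k : ℕ => P k - Q k) 0 0 with hxdef
  set l : ℕ → ℝ := Function.update (fun k : ℕ => ‖Q ((k : ℤ) + 1) - Q k‖) 0
    (‖Q (((0 : ℕ) : ℤ) + 1) - Q ((0 : ℕ) : ℤ)‖ - s * ε) with hldef
  have hx0 : x 0 = 0 := Function.update_self _ _ _
  have hxk : ∀ j : ℕ, x (j + 1) = P ((j + 1 : ℕ) : ℤ) - Q ((j + 1 : ℕ) : ℤ) := fun j =>
    Function.update_of_ne (by omega) _ _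
  have hl : ∀ j : ℕ, 2 * γ ≤ l j + ‖P ((j : ℤ) + 1) - P j‖ := by
    intro j
    rcases j with _ | j
    · have h1 : γ ≤ ‖P (((0 : ℕ) : ℤ) + 1) - P ((0 : ℕ) : ℤ)‖ := h.length_ge' 0
      have h2 : 2 * γ ≤ ‖Q (((0 : ℕ) : ℤ) + 1) - Q ((0 : ℕ) : ℤ)‖ := hlen
      rw [hldef, Function.update_self]
      linarith
    · rw [hldef, Function.update_of_ne (by omega)]
      exact h.length_add_ge _
  have hz : midOffset (direction Q ((0 : ℕ) : ℤ)) (direction P ((0 : ℕ) : ℤ)) (x 0) = 0 := by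
    rw [hx0]; simp [midOffset, planeCross]
  have hxN : x (N - 1 + 1) = x₀ := by rw [hxk]; exact h.displacement_last
  have hdnn : 0 ≤ s * (2 * |σ₀| * a + r) := (abs_nonneg _).trans mN.1
  have hdd := h.abs_inner_displacement_le hS hx hR (d := s * (2 * |σ₀| * a + r))
    (by rw [hz, abs_zero]; exact hdnn)
    (by rw [hxN, h.direction_last, h.direction_last']; exact mN.1) hk he heu
  have hturn := hR.offsetData.slope_le_of_start h.period_pos hz
  have hslope := hR.offsetData.abs_slope_mul_le (k := N - 1) (by omega)
    (d := |midOffset (direction Q (-1)) (direction P (-1)) x₀|)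
    (by rw [hz, abs_zero]; exact abs_nonneg _)
    (by rw [hxN, h.direction_last, h.direction_last'])
  rw [hxN, h.direction_last, h.direction_last'] at hturn
  rw [h.direction_last, h.direction_last'] at hslope
  have hKm : |midSlope (direction Q (-1)) (direction P (-1))|
      ≤ (1 / γ) * |midOffset (direction Q (-1)) (direction P (-1)) x₀| := by
    rw [one_div, inv_mul_eq_div, le_div_iff₀ hγ]
    have h1 := mul_le_mul_of_nonneg_right (hl (N - 1))
      (abs_nonneg (midSlope (direction Q (-1)) (direction P (-1))))
    linarith only [h1, hslope]
  have hVe := hF.le_inner_of_outgoing hS.r_le hu hv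
    (norm_direction (h.orbit'.ne_next 0)) (norm_direction (h.orbit'.ne_next (-1))) he hε hεn hεt
    hs0.le (by positivity : (0 : ℝ) ≤ 1 / γ) hturn.1
    (d := midOffset (direction Q (-1)) (direction P (-1)) x₀) (by rw [hx₀]) hturn.2 hKm
  rw [← hx₀, ← h.centre_sub (h.turn_ne_zero hS hx hF)] at hVe
  have hKr : 4 * (1 / γ) * s * r = 2 * r ^ 2 := by rw [hS.r_eq]; field_simp; ring
  rw [hKr] at hVe
  refine h.false_of_approach hS hx hF hk hb he hy hyρ hρ1 hρ2 (d := s * (2 * |σ₀| * a + r))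
    ?_ (hdd.2 (hxk k)) ?_
  · rcases k with _ | k
    · rw [h.displacement_zero, hx₀, smul_smul, inner_smul_right]
      have : inner ℝ e (direction Q 0) = 0 := heu
      rw [this, mul_zero, abs_zero]
      have : 0 ≤ (s + 4 * r) * r := by positivity
      linarith
    · exact hdd.1 (hxk k)
  · nlinarith only [hVe, mul_le_mul_of_nonneg_left hκ hs0.le]

/-- Motion of the collision point along the incoming segment. -/
theorem false_of_incoming (h : OrbitPair Λ c i₀ C N σ g w Q P x₀ γ) (hS : StepSize γ κ₁ κ s r)
    (hN2 : 2 ≤ N)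
    (hF : ReflectionFrame (Q 0 - (c (σ 0) + g 0)) (direction Q 0) (direction Q (-1)) a σ₀)
    {k : ℕ} (hk : k < N) {b : Plane} (hb : b ∈ Λ) {e y : Plane} (he : ‖e‖ = 1)
    (heu : inner ℝ e (direction Q k) = 0)
    (hy : y ∈ segment ℝ (Q k) (Q (k + 1))) {ρ : ℝ} (hyρ : y = (c i₀ + b) + ρ • e) (hρ1 : 1 ≤ ρ)
    (hρ2 : ρ ≤ 1 + κ * s / 2) {ε : ℝ} (hε : |ε| = 1)
    (hεn : ε * inner ℝ e (Q 0 - (c (σ 0) + g 0)) = |inner ℝ e (Q 0 - (c (σ 0) + g 0))|)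
    (hεt : ε * (σ₀ * inner ℝ e (planeRot (Q 0 - (c (σ 0) + g 0)))) ≤ 0)
    (hx₀ : x₀ = s • (ε • -direction Q (-1)))
    (hκ : 2 * |σ₀| * a + κ ≤ a * |inner ℝ e (Q 0 - (c (σ 0) + g 0))|
      + |σ₀| * |inner ℝ e (planeRot (Q 0 - (c (σ 0) + g 0)))|) : False := by
  set n := Q 0 - (c (σ 0) + g 0) with hn
  have hγ := h.gap_pos
  have hs0 := hS.s_pos
  have hr0 := hS.r_pos hγ
  have hq : ‖ε • -direction Q (-1)‖ = 1 := by
    rw [norm_smul, norm_neg, hF.unit_incoming, Real.norm_eq_abs, hε, mul_one]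
  have hx : ‖x₀‖ ≤ s := by
    rw [hx₀, norm_smul, hq, mul_one, Real.norm_of_nonneg hs0.le]
  have hu := h.norm_first_sub_le hS hx
  have hv := h.norm_last_sub_le hS hx
  have hw0 := h.direction_add_ne_zero 0
  have c0 : |planeCross (ε • -direction Q (-1)) (direction Q 0)| = 2 * |σ₀| * a := by
    have e1 : planeCross (-direction Q (-1)) (direction Q 0)
        = planeCross (direction Q 0) (direction Q (-1)) := by
      simp only [planeCross, PiLp.neg_apply]; ring
    rw [planeCross_smul_left, e1, hF.planeCross_outgoing_incoming, abs_mul, hε, abs_mul, abs_mul,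
      abs_of_pos hF.c_pos, abs_two]; ring
  have m0 := abs_midOffset_smul_le hF.unit_outgoing hw0 hq hs0.le hu
  rw [c0, ← hx₀] at m0
  have hsε : s * ε ≤ γ / 2 := by
    have h1 := le_abs_self (s * ε)
    rw [abs_mul, hε, mul_one, abs_of_pos hs0] at h1
    exact h1.trans (hS.s_le hγ)
  have hlen := h.length_ge ((N - 1 : ℕ) : ℤ)
  have hR := h.reflectingPair.shiftEnd h.period_pos (t := -(s * ε)) (by linarith)
    (by rw [h.sub_of_dvd dvd_rfl, hx₀, smul_smul, h.direction_last, neg_smul, smul_neg])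
  set x : ℕ → Plane := Function.update (fun k : ℕ => P k - Q k) N 0 with hxdef
  set l : ℕ → ℝ := Function.update (fun k : ℕ => ‖Q ((k : ℤ) + 1) - Q k‖) (N - 1)
    (‖Q (((N - 1 : ℕ) : ℤ) + 1) - Q ((N - 1 : ℕ) : ℤ)‖ + -(s * ε)) with hldef
  have hxN : x (N - 1 + 1) = 0 := by
    rw [Nat.sub_add_cancel h.period_pos]; exact Function.update_self _ _ _
  have hxk : ∀ j : ℕ, j < N → x j = P (j : ℤ) - Q (j : ℤ) := fun j hj =>
    Function.update_of_ne (by omega) _ _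
  have hl : ∀ j : ℕ, 2 * γ ≤ l j + ‖P ((j : ℤ) + 1) - P j‖ := by
    intro j
    by_cases hj : j = N - 1
    · have h1 := h.length_ge' ((N - 1 : ℕ) : ℤ)
      rw [hldef, hj, Function.update_self]
      linarith
    · rw [hldef, Function.update_of_ne hj]
      exact h.length_add_ge _
  have hz : midOffset (direction Q ((N - 1 : ℕ) : ℤ)) (direction P ((N - 1 : ℕ) : ℤ))
      (x (N - 1 + 1)) = 0 := by
    rw [hxN]; simp [midOffset, planeCross]
  have hx0 : x 0 = x₀ := by rw [hxk 0 h.period_pos]; exact h.displacement_zero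
  have hdnn : 0 ≤ s * (2 * |σ₀| * a + r) := (abs_nonneg _).trans m0.1
  have hdd := h.abs_inner_displacement_le hS hx hR (d := s * (2 * |σ₀| * a + r))
    (by rw [hx0]; exact m0.1) (by rw [hz, abs_zero]; exact hdnn) hk he heu
  have hturn := hR.offsetData.slope_le_of_end h.period_pos hz
  have hslope := hR.offsetData.abs_slope_mul_le (k := 0) (by omega)
    (d := |midOffset (direction Q 0) (direction P 0) x₀|)
    (by rw [hx0]; rfl)
    (by rw [hz, abs_zero]; exact abs_nonneg _)
  rw [hx0, h.direction_last, h.direction_last'] at hturn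
  change |midSlope (direction Q (-1)) (direction P (-1))|
      ≤ |midSlope (direction Q 0) (direction P 0)|
    ∧ midOffset (direction Q 0) (direction P 0) x₀ * midSlope (direction Q 0) (direction P 0) ≤ 0
    at hturn
  have hneg : ∀ z z' : Plane, midSlope (-z) (-z') = midSlope z z' := fun z z' => by
    have e1 : planeCross (-z) (-z') = planeCross z z' := by
      simp only [planeCross, PiLp.neg_apply]; ring
    rw [midSlope, midSlope, e1, ← neg_add, norm_neg]
  have hneg' : ∀ z z' t : Plane, midOffset (-z) (-z') t = -midOffset z z' t := fun z z' t => by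
    have e1 : planeCross t (-(z + z')) = -planeCross t (z + z') := by
      simp only [planeCross, PiLp.neg_apply]; ring
    rw [midOffset, midOffset, ← neg_add, norm_neg, e1, neg_div]
  have hKm : |midSlope (direction Q 0) (direction P 0)|
      ≤ (1 / γ) * |midOffset (direction Q 0) (direction P 0) x₀| := by
    rw [one_div, inv_mul_eq_div, le_div_iff₀ hγ]
    have h1 := mul_le_mul_of_nonneg_right (hl 0)
      (abs_nonneg (midSlope (direction Q 0) (direction P 0)))
    have h2 : (l 0 + ‖P (((0 : ℕ) : ℤ) + 1) - P ((0 : ℕ) : ℤ)‖)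
      * |midSlope (direction Q 0) (direction P 0)| ≤ _ := hslope
    linarith only [h1, h2]
  have hVe := hF.reverse.le_inner_of_outgoing (u' := -direction P (-1)) (v' := -direction P 0)
    hS.r_le (by rw [neg_sub_neg, norm_sub_rev]; exact hv)
    (by rw [neg_sub_neg, norm_sub_rev]; exact hu)
    (by rw [norm_neg]; exact norm_direction (h.orbit'.ne_next (-1)))
    (by rw [norm_neg]; exact norm_direction (h.orbit'.ne_next 0)) he hε hεn
    (by rw [neg_mul, mul_neg]; linarith)
    hs0.le (by positivity : (0 : ℝ) ≤ 1 / γ) (by rw [hneg, hneg]; exact hturn.1)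
    (d := -midOffset (direction Q 0) (direction P 0) x₀) (by rw [hneg', hx₀])
    (by rw [hneg]; linarith [hturn.2]) (by rw [hneg, abs_neg]; exact hKm)
  rw [neg_sub_neg, ← hx₀, ← h.centre_sub (h.turn_ne_zero hS hx hF), abs_neg] at hVe
  have hKr : 4 * (1 / γ) * s * r = 2 * r ^ 2 := by rw [hS.r_eq]; field_simp; ring
  rw [hKr] at hVe
  refine h.false_of_approach hS hx hF hk hb he hy hyρ hρ1 hρ2 (d := s * (2 * |σ₀| * a + r))
    (hdd.1 (hxk k hk)) ?_ ?_
  · by_cases hkN : k + 1 = N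
    · have h1 : (((k : ℤ) + 1)) = (N : ℤ) := by omega
      rw [h1, h.sub_of_dvd dvd_rfl, hx₀, smul_smul, inner_smul_right, inner_neg_right]
      have h2 : direction Q k = direction Q (-1) := by
        rw [← h.direction_last]; congr 1; omega
      rw [h2] at heu
      rw [heu, neg_zero, mul_zero, abs_zero]
      have : 0 ≤ (s + 4 * r) * r := by positivity
      linarith
    · exact hdd.2 (hxk (k + 1) (by omega))
  · nlinarith only [hVe, mul_le_mul_of_nonneg_left hκ hs0.le]

end OrbitPair

theorem exists_sign (z : ℝ) : ∃ ε : ℝ, |ε| = 1 ∧ ε * z = |z| := by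
  rcases le_total 0 z with h | h
  · exact ⟨1, abs_one, by rw [one_mul, abs_of_nonneg h]⟩
  · exact ⟨-1, by simp, by rw [neg_one_mul, abs_of_nonpos h]⟩

theorem exists_nearest_in_segment (A B p : Plane) :
    ∃ y ∈ segment ℝ A B, ∀ z ∈ segment ℝ A B, inner ℝ (p - y) (z - y) ≤ 0 := by
  have hc : IsCompact (segment ℝ A B) := by
    rw [segment_eq_image']
    exact isCompact_Icc.image (by fun_prop)
  obtain ⟨y, hy, h⟩ := exists_norm_eq_iInf_of_complete_convex (K := segment ℝ A B)
    ⟨A, left_mem_segment ℝ A B⟩ hc.isComplete (convex_segment A B) p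
  exact ⟨y, hy, (norm_eq_iInf_iff_real_inner_le_zero (convex_segment A B) hy).1 h⟩

/-- A segment that passes close to a unit disk, away from its end points, has a foot of the
perpendicular from the centre of the disk. -/
theorem exists_foot {A B p x : Plane} {R : ℝ} (hx : x ∈ segment ℝ A B) (hxp : dist x p < R)
    (hA : R ≤ dist A p) (hB : R ≤ dist B p) :
    ∃ y ∈ segment ℝ A B, dist y p < R ∧ inner ℝ (y - p) (B - A) = 0 := by
  obtain ⟨y, hy, hmin⟩ := exists_nearest_in_segment A B p
  have hyR : dist y p < R := by
    refine lt_of_le_of_lt ?_ hxp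
    rw [dist_comm y, dist_comm x, dist_eq_norm, dist_eq_norm]
    have e : p - x = (p - y) - (x - y) := by abel
    have h1 := hmin x hx
    have h2 : ‖p - y‖ ^ 2 ≤ ‖p - x‖ ^ 2 := by
      rw [e, norm_sub_sq_real (p - y)]; nlinarith [sq_nonneg ‖x - y‖]
    exact (sq_le_sq₀ (norm_nonneg _) (norm_nonneg _)).1 h2
  refine ⟨y, hy, hyR, ?_⟩
  have h1 := hmin A (left_mem_segment ℝ A B)
  have h2 := hmin B (right_mem_segment ℝ A B)
  rw [segment_eq_image'] at hy
  obtain ⟨t, ⟨ht0, ht1⟩, rfl⟩ := hy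
  have htA : t ≠ 0 := by
    rintro rfl; simp at hyR; linarith
  have htB : t ≠ 1 := by
    rintro rfl; simp at hyR; linarith
  have ht0' : 0 < t := lt_of_le_of_ne ht0 htA.symm
  have ht1' : 0 < 1 - t := by
    have := lt_of_le_of_ne ht1 htB; linarith
  have e1 : A - (A + t • (B - A)) = (-t) • (B - A) := by rw [neg_smul]; abel
  have e2 : B - (A + t • (B - A)) = (1 - t) • (B - A) := by rw [sub_smul, one_smul]; abel
  rw [e1, inner_smul_right] at h1
  rw [e2, inner_smul_right] at h2
  have h3 : inner ℝ (p - (A + t • (B - A))) (B - A) = 0 := by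
    apply le_antisymm
    · exact nonpos_of_mul_nonpos_right h2 ht1'
    · by_contra hcon
      push Not at hcon
      nlinarith
  rw [← neg_sub, inner_neg_left, h3, neg_zero]

theorem IsPeriodicOrbit.exists_foot {ι : Type*} {Λ : Submodule ℤ Plane} {c : ι → Plane} {N : ℕ}
    {σ : ℤ → ι} {g : ℤ → Plane} {w : Plane} {Q : ℤ → Plane} (h : IsPeriodicOrbit Λ c N σ g w Q)
    {γ δ : ℝ} (hγ : ∀ i j : ι, ∀ a ∈ Λ, (i ≠ j ∨ a ≠ 0) → 2 + 2 * γ ≤ dist (c i) (c j + a))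
    (hδ : δ ≤ 2 * γ) {i₀ : ι} (hp : PassesWithin Λ c σ g Q i₀ δ) :
    ∃ k : ℕ, k < N ∧ ∃ b ∈ Λ, ∃ y ∈ segment ℝ (Q k) (Q (k + 1)), ∃ e : Plane, ∃ ρ : ℝ,
      ‖e‖ = 1 ∧ inner ℝ e (direction Q k) = 0 ∧ y = (c i₀ + b) + ρ • e ∧ 1 ≤ ρ ∧ ρ < 1 + δ := by
  obtain ⟨k, b, hb, hk, hk1, x, hx, z, hz, hxz⟩ := hp
  have hxp : dist x (c i₀ + b) < 1 + δ := by
    have h1 := dist_triangle x z (c i₀ + b)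
    rw [Metric.mem_sphere] at hz
    linarith
  have hfar : ∀ j, ¬ (σ j = i₀ ∧ g j = b) → 1 + δ ≤ dist (Q j) (c i₀ + b) := by
    intro j hj
    have h1 : 2 + 2 * γ ≤ dist (c (σ j)) (c i₀ + (b - g j)) := by
      refine hγ _ _ _ (Λ.sub_mem hb (h.g_mem j)) ?_
      by_contra hcon
      push Not at hcon
      exact hj ⟨hcon.1, (sub_eq_zero.1 hcon.2).symm⟩
    have h2 : dist (c (σ j)) (c i₀ + (b - g j)) = dist (c (σ j) + g j) (c i₀ + b) := by
      rw [dist_eq_norm, dist_eq_norm]; congr 1; abel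
    have h3 := dist_triangle (c (σ j) + g j) (Q j) (c i₀ + b)
    have h4 := h.mem_boundary j
    rw [Metric.mem_sphere, dist_comm] at h4
    linarith
  obtain ⟨y, hy, hyp, hperp⟩ := _root_.exists_foot hx hxp (hfar k hk) (hfar (k + 1) hk1)
  have hρ1 : 1 ≤ dist y (c i₀ + b) := by
    have := h.segment_subset k hy i₀ b hb
    rw [Metric.mem_ball] at this
    linarith
  have hN : (0 : ℤ) < N := by exact_mod_cast h.period_pos
  obtain ⟨m, hm⟩ : ∃ m : ℕ, (m : ℤ) = k % N :=
    ⟨(k % N).toNat, Int.toNat_of_nonneg (Int.emod_nonneg _ hN.ne')⟩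
  have hmN : m < N := by
    have := Int.emod_lt_of_pos k hN
    omega
  set j := k / N with hj
  have hkm : k = (m : ℤ) + j * N := by
    rw [hm, hj, mul_comm]; exact (Int.emod_add_mul_ediv k N).symm
  have hQ0 : Q k = Q m + j • w := by rw [hkm, add_mul_period h.Q_periodic]
  have hQ1 : Q (k + 1) = Q (m + 1) + j • w := by
    rw [hkm, add_right_comm, add_mul_period h.Q_periodic]
  set ρ := dist y (c i₀ + b)
  have hρ0 : ρ ≠ 0 := by linarith
  have hynorm : ‖y - (c i₀ + b)‖ = ρ := (dist_eq_norm _ _).symm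
  refine ⟨m, hmN, b - j • w, Λ.sub_mem hb (Λ.smul_mem j h.w_mem), y - j • w, ?_,
    ρ⁻¹ • (y - (c i₀ + b)), ρ, ?_, ?_, ?_, hρ1, hyp⟩
  · obtain ⟨a, a', ha, ha', haa, rfl⟩ := hy
    refine ⟨a, a', ha, ha', haa, ?_⟩
    rw [hQ0, hQ1, smul_add, smul_add]
    have : j • w = a • (j • w) + a' • (j • w) := by rw [← add_smul, haa, one_smul]
    nth_rewrite 3 [this]
    abel
  · rw [norm_smul, hynorm, norm_inv, Real.norm_of_nonneg (by linarith), inv_mul_cancel₀ hρ0]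
  · have e1 : Q (k + 1) - Q k = Q (m + 1) - Q m := by rw [hQ0, hQ1]; abel
    rw [direction, inner_smul_left, inner_smul_right, ← e1, hperp, mul_zero, mul_zero]
  · rw [smul_smul, mul_inv_cancel₀ hρ0, one_smul]; abel

/-- There are a step size `s` and a number `δ`, which depend only on the table and on the angle of
incidence, such that for every orbit that passes within `δ` of the scatterer `i₀` there is a
direction `q` for which no orbit has its collision with the scatterer `i₀` displaced by `s • q`. -/
theorem exists_pushing_direction {ι : Type*} [Finite ι] [DecidableEq ι] (Λ : Submodule ℤ Plane)
    [DiscreteTopology Λ] (hΛ : Λ = ⊥ ∨ IsZLattice ℝ Λ) (c : ι → Plane) {γ : ℝ} (hγ0 : 0 < γ)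
    (hγ : ∀ i j : ι, ∀ a ∈ Λ, (i ≠ j ∨ a ≠ 0) → 2 + 2 * γ ≤ dist (c i) (c j + a))
    {a : ℝ} (ha : 0 < a) (ha2 : 3 / 4 < a ^ 2) (ha1 : a ≤ 1) {ε : ℝ} (hε : 0 < ε) :
    ∃ s r κ₁ κ δ : ℝ, StepSize γ κ₁ κ s r ∧ s + 4 * r ≤ ε ∧ 0 < δ ∧
      ∀ (i₀ : ι) (N : ℕ) (σ : ℤ → ι) (g : ℤ → Plane) (w : Plane) (Q : ℤ → Plane),
        IsPeriodicOrbit Λ c N σ g w Q →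
        (∀ k : ℤ, σ k = i₀ ↔ (N : ℤ) ∣ k) →
        inner ℝ (direction Q 0) (Q 0 - (c (σ 0) + g 0)) = a →
        PassesWithin Λ c σ g Q i₀ δ →
        ∃ q : Plane, ‖q‖ = 1 ∧ ∀ (C : Plane) (P : ℤ → Plane), P 0 = Q 0 + s • q →
          ¬ IsPeriodicOrbit Λ (Function.update c i₀ C) N σ g w P := by
  obtain ⟨M', hM'⟩ := IsBilliard.exists_length_bound hΛ c
  set M := max M' 0
  have hM0 : 0 ≤ M := le_max_right _ _
  set κ₁ := 1 / (8 * (2 * M + 5)) with hκ₁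
  have hκ₁0 : 0 < κ₁ := by positivity
  set b := Real.sqrt (1 - a ^ 2) with hb
  have hb2 : a ^ 2 + b ^ 2 = 1 := by
    rw [hb, Real.sq_sqrt (by nlinarith)]; ring
  have hb0 : 0 ≤ b := Real.sqrt_nonneg _
  have hbh : b < 1 / 2 := by nlinarith
  set τ := a * (1 + κ₁ / 4) / (1 + κ₁ / 2) with hτ
  have hτa : τ < a := by
    rw [hτ, div_lt_iff₀ (by positivity)]
    nlinarith [mul_pos ha hκ₁0]
  have hτm : τ * (1 + κ₁ / 2) = a * (1 + κ₁ / 4) := by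
    rw [hτ, div_mul_cancel₀]; positivity
  set κ := min 1 (min (a * κ₁ / 4) ((a - τ) * ((1 - 2 * b) * (1 + b)) / 2)) with hκ
  have hκ0 : 0 < κ := by
    refine lt_min one_pos (lt_min (by positivity) ?_)
    have h1 : 0 < a - τ := by linarith
    have h2 : 0 < 1 - 2 * b := by linarith
    positivity
  have hκ1 : κ ≤ 1 := min_le_left _ _
  have hκA : κ ≤ a * κ₁ / 4 := (min_le_right _ _).trans (min_le_left _ _)
  have hκB : κ ≤ (a - τ) * ((1 - 2 * b) * (1 + b)) / 2 :=
    (min_le_right _ _).trans (min_le_right _ _)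
  obtain ⟨s, r, hS, hsε⟩ := exists_stepSize hγ0 hκ₁0 hκ0 hκ1 hε
  have hs0 := hS.s_pos
  refine ⟨s, r, κ₁, κ, min (κ * s / 2) γ, hS, hsε, lt_min (by positivity) hγ0, ?_⟩
  intro i₀ N σ g w Q hQ hcode hin hpass
  have hF := hQ.reflectionFrame ha ha2 hin
  have hN2 : 2 ≤ N := hQ.two_le_period (by rw [hin]; exact ha.ne')
  have hM : ‖Q (0 + 1) - Q 0‖ ≤ M :=
    (hM' N σ g w Q hQ 0 (by rw [hin]; exact ha) (by rw [hin]; exact ha2)).trans (le_max_left _ _)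
  obtain ⟨k, hk, v, hv, y, hy, e, ρ, he, heu, hyρ, hρ1, hρ2⟩ :=
    hQ.exists_foot hγ ((min_le_right _ _).trans (by linarith)) hpass
  have hρ3 : ρ ≤ 1 + κ * s / 2 := hρ2.le.trans (by linarith [min_le_left (κ * s / 2) γ])
  have hpair : ∀ {q : Plane}, ‖q‖ = 1 → ∀ (C : Plane) (P : ℤ → Plane), P 0 = Q 0 + s • q →
      IsPeriodicOrbit Λ (Function.update c i₀ C) N σ g w P →
      OrbitPair Λ c i₀ C N σ g w Q P (s • q) γ := fun hq C P hP0 hP =>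
    ⟨hQ, hP, hcode, hγ, hγ0, hP0, by
      rw [norm_smul, hq, mul_one, Real.norm_of_nonneg hs0.le]; exact hS.s_le hγ0⟩
  set n := Q 0 - (c (σ 0) + g 0) with hn
  set σ₀ := inner ℝ (direction Q 0) (planeRot n) with hσ₀
  have hσb : |σ₀| = b := by
    have h1 := hF.sq_add_sq
    rw [hb, ← Real.sqrt_sq_eq_abs]; congr 1; linarith
  rcases le_or_gt τ |inner ℝ e (planeRot n)| with hcase | hcase
  · obtain ⟨η, hη, hηe⟩ := exists_sign (inner ℝ e (planeRot n))
    have hq : ‖η • planeRot n‖ = 1 := by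
      rw [norm_smul, norm_planeRot, hF.unit, Real.norm_eq_abs, hη, mul_one]
    refine ⟨η • planeRot n, hq, fun C P hP0 hP => ?_⟩
    exact (hpair hq C P hP0 hP).false_of_tangential hS hN2 hF hM hκ₁ hk hv he heu hy hyρ hρ1 hρ3
      hη hηe rfl hcase (by rw [hτm]; linarith)
  · have hfr := frame_inequality (x := |inner ℝ e n|) (y := |inner ℝ e (planeRot n)|) hb2 ha hb0
      hbh (by rw [sq_abs, sq_abs]; exact inner_sq_add_inner_sq_frame hF.unit he) (abs_nonneg _)
      (abs_nonneg _) hcase.le hτa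
    have hfr' : 2 * |σ₀| * a + κ ≤ a * |inner ℝ e n| + |σ₀| * |inner ℝ e (planeRot n)| := by
      rw [hσb]; linarith
    obtain ⟨η, hη, hηe⟩ := exists_sign (inner ℝ e n)
    rcases le_total 0 (η * (σ₀ * inner ℝ e (planeRot n))) with hsg | hsg
    · have hq : ‖η • direction Q 0‖ = 1 := by
        rw [norm_smul, hF.unit_outgoing, Real.norm_eq_abs, hη, mul_one]
      refine ⟨η • direction Q 0, hq, fun C P hP0 hP => ?_⟩
      exact (hpair hq C P hP0 hP).false_of_outgoing hS hN2 hF hk hv he heu hy hyρ hρ1 hρ3 hη hηe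
        hsg rfl hfr'
    · have hq : ‖η • -direction Q (-1)‖ = 1 := by
        rw [norm_smul, norm_neg, hF.unit_incoming, Real.norm_eq_abs, hη, mul_one]
      refine ⟨η • -direction Q (-1), hq, fun C P hP0 hP => ?_⟩
      exact (hpair hq C P hP0 hP).false_of_incoming hS hN2 hF hk hv he heu hy hyρ hρ1 hρ3 hη hηe
        hsg rfl hfr'

/-- The periodic sequences of points in the closed unit disks around `O k`, with given initial
point. -/
def diskChains (N : ℕ) (w : Plane) (O : ℤ → Plane) (A : Plane) : Set (ℤ → Plane) :=
  {y | (∀ k, y (k + N) = y k + w) ∧ (∀ k, y k ∈ Metric.closedBall (O k) 1) ∧ y 0 = A}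

/-- Translation of the points whose index is divisible by `N`. -/
def shiftChain (N : ℕ) (v : Plane) (y : ℤ → Plane) : ℤ → Plane :=
  fun k => if (N : ℤ) ∣ k then y k + v else y k

/-- The length of one period of a polygon. -/
noncomputable def chainLength (N : ℕ) (z : ℤ → Plane) : ℝ :=
  ∑ k ∈ Finset.range N, ‖z ((k : ℤ) + 1) - z k‖

section Chains

variable {N : ℕ} {w A v : Plane} {O y y' z : ℤ → Plane} {γ : ℝ}

theorem shiftChain_of_dvd {k : ℤ} (h : (N : ℤ) ∣ k) : shiftChain N v y k = y k + v := if_pos h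

theorem shiftChain_of_not_dvd {k : ℤ} (h : ¬ (N : ℤ) ∣ k) : shiftChain N v y k = y k := if_neg h

theorem shiftChain_sub (k : ℤ) :
    shiftChain N v y' k - shiftChain N v y k = y' k - y k := by
  unfold shiftChain
  split_ifs <;> abel

theorem shiftChain_periodic (h : ∀ k, y (k + N) = y k + w) (k : ℤ) :
    shiftChain N v y (k + N) = shiftChain N v y k + w := by
  unfold shiftChain
  simp only [dvd_add_self_right, h]
  split_ifs <;> abel

theorem shiftChain_neg_shiftChain (v : Plane) (z : ℤ → Plane) :
    shiftChain N v (shiftChain N (-v) z) = z := by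
  funext k
  unfold shiftChain
  split_ifs <;> abel

theorem continuous_shiftChain : Continuous fun p : Plane × (ℤ → Plane) => shiftChain N p.1 p.2 := by
  refine continuous_pi fun k => ?_
  unfold shiftChain
  split_ifs <;> fun_prop

theorem continuous_chainLength : Continuous (chainLength N) := by
  unfold chainLength; fun_prop

theorem isCompact_diskChains : IsCompact (diskChains N w O A) := by
  have h1 : IsCompact (Set.univ.pi fun k => Metric.closedBall (O k) 1) :=
    isCompact_univ_pi fun k => isCompact_closedBall _ _
  have h2 : IsClosed {y : ℤ → Plane | (∀ k, y (k + N) = y k + w) ∧ y 0 = A} := by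
    simp only [Set.ofPred_and, Set.ofPred_forall]
    refine IsClosed.inter (isClosed_iInter fun k => isClosed_eq ?_ ?_) (isClosed_eq ?_ ?_) <;>
      fun_prop
  convert h1.inter_right h2 using 1
  ext y
  simp only [diskChains, Set.mem_ofPred_eq, Set.mem_inter_iff, Set.mem_univ_pi]
  tauto

theorem exists_chain_minimiser (hne : (diskChains N w O A).Nonempty) (v : Plane) :
    ∃ y ∈ diskChains N w O A, ∀ y' ∈ diskChains N w O A,
      chainLength N (shiftChain N v y) ≤ chainLength N (shiftChain N v y') := by
  have h : Continuous fun y : ℤ → Plane => shiftChain N v y :=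
    (continuous_shiftChain (N := N)).comp (Continuous.prodMk continuous_const continuous_id)
  exact isCompact_diskChains.exists_isMinOn hne (continuous_chainLength.comp h).continuousOn

theorem norm_shiftChain_sub_centre_le (hy : y ∈ diskChains N w O A) (hγ : 0 < γ)
    (hv : ‖v‖ ≤ γ / 2) (k : ℤ) : ‖shiftChain N v y k - O k‖ ≤ 1 + γ / 2 := by
  have h1 := hy.2.1 k
  rw [mem_closedBall_iff_norm] at h1
  unfold shiftChain
  split_ifs
  · rw [add_sub_right_comm]
    exact (norm_add_le _ _).trans (by linarith)
  · linarith

theorem length_shiftChain_ge (hy : y ∈ diskChains N w O A) (hγ : 0 < γ) (hv : ‖v‖ ≤ γ / 2)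
    (hO : ∀ k, 2 + 2 * γ ≤ ‖O (k + 1) - O k‖) (k : ℤ) :
    γ ≤ ‖shiftChain N v y (k + 1) - shiftChain N v y k‖ := by
  have := OrbitPair.norm_axis_ge (norm_shiftChain_sub_centre_le hy hγ hv k)
    (norm_shiftChain_sub_centre_le hy hγ hv (k + 1))
  linarith [hO k]

theorem shiftChain_ne_next (hy : y ∈ diskChains N w O A) (hγ : 0 < γ) (hv : ‖v‖ ≤ γ / 2)
    (hO : ∀ k, 2 + 2 * γ ≤ ‖O (k + 1) - O k‖) (k : ℤ) :
    shiftChain N v y k ≠ shiftChain N v y (k + 1) := by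
  intro h
  have := length_shiftChain_ge hy hγ hv hO k
  rw [← h, sub_self, norm_zero] at this
  linarith

theorem norm_le_add_inner {a b : Plane} (ha : a ≠ 0) :
    ‖a + b‖ ≤ ‖a‖ + inner ℝ (‖a‖⁻¹ • a) b + ‖b‖ ^ 2 / (2 * ‖a‖) := by
  have h0 : 0 < ‖a‖ := norm_pos_iff.2 ha
  have h1 : ‖a‖ + inner ℝ (‖a‖⁻¹ • a) b + ‖b‖ ^ 2 / (2 * ‖a‖)
      = (‖a‖ ^ 2 + ‖a + b‖ ^ 2) / (2 * ‖a‖) := by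
    rw [norm_add_sq_real, inner_smul_left]
    simp only [conj_trivial]
    field_simp; ring
  rw [h1, le_div_iff₀ (by positivity)]
  nlinarith [sq_nonneg (‖a‖ - ‖a + b‖)]

theorem sum_inner_by_parts {u η : ℤ → Plane} (hu : ∀ k, u (k + N) = u k)
    (hη : ∀ k, η (k + N) = η k) :
    ∑ k ∈ Finset.range N, inner ℝ (u k) (η ((k : ℤ) + 1) - η k)
      = ∑ k ∈ Finset.range N, inner ℝ (u ((k : ℤ) - 1) - u k) (η k) := by
  rw [← sub_eq_zero, ← Finset.sum_sub_distrib]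
  set F : ℕ → ℝ := fun j => inner ℝ (u ((j : ℤ) - 1)) (η j) with hF
  have h1 : ∀ k ∈ Finset.range N, inner ℝ (u k) (η ((k : ℤ) + 1) - η k)
      - inner ℝ (u ((k : ℤ) - 1) - u k) (η k)
      = F (k + 1) - F k := by
    intro k _
    simp only [hF]
    push_cast
    rw [inner_sub_right, inner_sub_left, add_sub_cancel_right]
    ring
  rw [Finset.sum_congr rfl h1, Finset.sum_range_sub F]
  simp only [hF]
  have h2 := hu (-1)
  have h3 := hη 0
  rw [zero_add] at h3
  rw [h3, show ((N : ℤ) - 1) = -1 + N by ring, h2]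
  simp

theorem sum_nonneg_of_minimiser (hγ : 0 < γ) (hv : ‖v‖ ≤ γ / 2)
    (hO : ∀ k, 2 + 2 * γ ≤ ‖O (k + 1) - O k‖) (hy : y ∈ diskChains N w O A)
    (hmin : ∀ y' ∈ diskChains N w O A,
      chainLength N (shiftChain N v y) ≤ chainLength N (shiftChain N v y'))
    (hy' : y' ∈ diskChains N w O A) :
    0 ≤ ∑ k ∈ Finset.range N, inner ℝ (direction (shiftChain N v y) ((k : ℤ) - 1)
      - direction (shiftChain N v y) k) (y' k - y k) := by
  set z := shiftChain N v y with hz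
  have hzne := shiftChain_ne_next hy hγ hv hO
  have hzper : ∀ k, z (k + N) = z k + w := shiftChain_periodic hy.1
  rw [← sum_inner_by_parts (u := direction z) (η := fun k => y' k - y k)
    (direction_add_period hzper) (fun k => by rw [hy.1, hy'.1]; abel)]
  set S := ∑ k ∈ Finset.range N,
    inner ℝ (direction z k) ((y' ((k : ℤ) + 1) - y ((k : ℤ) + 1)) - (y' k - y k)) with hS
  set K := ∑ k ∈ Finset.range N,
    ‖(y' ((k : ℤ) + 1) - y ((k : ℤ) + 1)) - (y' k - y k)‖ ^ 2
      / (2 * ‖z ((k : ℤ) + 1) - z k‖) with hK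
  have hK0 : 0 ≤ K := Finset.sum_nonneg fun k _ => by positivity
  have key : ∀ t : ℝ, 0 < t → t ≤ 1 → 0 ≤ t * S + t ^ 2 * K := by
    intro t ht0 ht1
    have hmem : (fun k => y k + t • (y' k - y k)) ∈ diskChains N w O A := by
      refine ⟨fun k => ?_, fun k => ?_, ?_⟩
      · simp only
        rw [hy.1, hy'.1, add_sub_add_right_eq_sub]; abel
      · exact (convex_closedBall (O k) 1).add_smul_sub_mem (hy.2.1 k) (hy'.2.1 k) ⟨ht0.le, ht1⟩
      · simp only
        rw [hy.2.2, hy'.2.2]; simp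
    have h1 := hmin _ hmem
    have h2 : chainLength N (shiftChain N v fun k => y k + t • (y' k - y k))
        ≤ chainLength N z + (t * S + t ^ 2 * K) := by
      unfold chainLength
      rw [hS, hK, Finset.mul_sum, Finset.mul_sum, ← Finset.sum_add_distrib,
        ← Finset.sum_add_distrib]
      refine Finset.sum_le_sum fun k _ => ?_
      have e : ∀ j, shiftChain N v (fun k => y k + t • (y' k - y k)) j
          = z j + t • (y' j - y j) := by
        intro j
        have := shiftChain_sub (N := N) (v := v) (y := y) (y' := fun k => y k + t • (y' k - y k)) j
        rw [sub_eq_iff_eq_add] at this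
        rw [this, hz]; abel
      rw [e, e]
      have e2 : z ((k : ℤ) + 1) + t • (y' ((k : ℤ) + 1) - y ((k : ℤ) + 1))
          - (z k + t • (y' k - y k))
          = (z ((k : ℤ) + 1) - z k)
            + t • ((y' ((k : ℤ) + 1) - y ((k : ℤ) + 1)) - (y' k - y k)) := by
        rw [smul_sub t (y' ((k : ℤ) + 1) - y ((k : ℤ) + 1))]; abel
      rw [e2]
      refine (norm_le_add_inner (sub_ne_zero.2 (hzne k).symm)).trans (le_of_eq ?_)
      rw [inner_smul_right, norm_smul, mul_pow, Real.norm_eq_abs, sq_abs, direction]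
      ring
    linarith
  by_contra hcon
  push Not at hcon
  set t := min 1 (-S / (2 * (K + 1))) with ht
  have ht0 : 0 < t := lt_min one_pos (div_pos (by linarith) (by linarith))
  have ht2 : t * (2 * (K + 1)) ≤ -S := (le_div_iff₀ (by linarith)).1 (min_le_right _ _)
  have h3 := key t ht0 (min_le_left _ _)
  have h4 : t * (S + t * K) < 0 := mul_neg_of_pos_of_neg ht0 (by nlinarith)
  nlinarith

theorem sub_eq_sub_of_dvd (hO : ∀ k, O (k + N) = O k + w) (hy : ∀ k, y (k + N) = y k + w) {j k : ℤ}
    (h : (N : ℤ) ∣ j - k) : y j - y k = O j - O k := by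
  obtain ⟨m, hm⟩ := h
  have e : j = k + m * N := by rw [mul_comm, ← hm]; ring
  rw [e, add_mul_period hy, add_mul_period hO]; abel

/-- The variational inequality at a single point of a minimiser. -/
theorem inner_nonneg_of_minimiser (hN : 0 < N) (hOper : ∀ k, O (k + N) = O k + w) (hγ : 0 < γ)
    (hv : ‖v‖ ≤ γ / 2)
    (hO : ∀ k, 2 + 2 * γ ≤ ‖O (k + 1) - O k‖) (hy : y ∈ diskChains N w O A)
    (hmin : ∀ y' ∈ diskChains N w O A,
      chainLength N (shiftChain N v y) ≤ chainLength N (shiftChain N v y'))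
    {k : ℤ} (hk : ¬ (N : ℤ) ∣ k) {p : Plane} (hp : p ∈ Metric.closedBall (O k) 1) :
    0 ≤ inner ℝ (direction (shiftChain N v y) (k - 1) - direction (shiftChain N v y) k)
      (p - y k) := by
  set y' : ℤ → Plane := fun j => if (N : ℤ) ∣ j - k then y j + (p - y k) else y j with hy'
  have hmem : y' ∈ diskChains N w O A := by
    refine ⟨fun j => ?_, fun j => ?_, ?_⟩
    · simp only [hy']
      rw [show j + N - k = j - k + N by ring, hy.1]
      simp only [dvd_add_self_right]
      split_ifs <;> abel
    · simp only [hy']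
      split_ifs with h
      · have := sub_eq_sub_of_dvd hOper hy.1 h
        rw [mem_closedBall_iff_norm] at hp ⊢
        rw [show y j + (p - y k) - O j = (p - O k) + ((y j - y k) - (O j - O k)) by abel, this]
        simpa using hp
      · exact hy.2.1 j
    · simp only [hy']
      rw [if_neg (by simpa using hk), hy.2.2]
  have h1 := sum_nonneg_of_minimiser hγ hv hO hy hmin hmem
  have hN' : (0 : ℤ) < N := by exact_mod_cast hN
  obtain ⟨m, hm⟩ : ∃ m : ℕ, (m : ℤ) = k % N :=
    ⟨(k % N).toNat, Int.toNat_of_nonneg (Int.emod_nonneg _ hN'.ne')⟩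
  have hmN : m < N := by have := Int.emod_lt_of_pos k hN'; omega
  have hkm : k = (m : ℤ) + (k / N) * N := by
    rw [hm, mul_comm]; exact (Int.emod_add_mul_ediv k N).symm
  have hdvd : (N : ℤ) ∣ (m : ℤ) - k := ⟨-(k / N), by linarith⟩
  rw [Finset.sum_eq_single m] at h1
  · have hper : ∀ j, direction (shiftChain N v y) (j + (k / N) * N)
        = direction (shiftChain N v y) j := by
      intro j
      have h2 : ∀ i, shiftChain N v y (i + (k / N) * N) = shiftChain N v y i + (k / N) • w :=
        fun i => add_mul_period (shiftChain_periodic hy.1) i _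
      rw [direction, direction, add_right_comm, h2, h2, add_sub_add_right_eq_sub]
    have e1 := hper m
    have e2 := hper ((m : ℤ) - 1)
    rw [← hkm] at e1
    rw [show ((m : ℤ) - 1 + (k / N) * N) = k - 1 by linarith] at e2
    have e3 : y' m - y m = p - y k := by simp only [hy']; rw [if_pos hdvd]; abel
    rw [e3, ← e1, ← e2] at h1
    exact h1
  · intro j hj hjm
    have : ¬ (N : ℤ) ∣ (j : ℤ) - k := by
      intro h
      have h2 : (N : ℤ) ∣ (j : ℤ) - m := by
        have := dvd_sub h hdvd
        rwa [sub_sub_sub_cancel_right] at this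
      rw [Finset.mem_range] at hj
      have h3 := Int.eq_zero_of_abs_lt_dvd h2 (by rw [abs_lt]; constructor <;> omega)
      exact hjm (by omega)
    simp only [hy']
    rw [if_neg this, sub_self, inner_zero_right]
  · intro h
    exact absurd (Finset.mem_range.2 hmN) h

/-- A variational inequality on a unit disk is the law of reflection. -/
theorem reflection_of_variational {O z u v : Plane} (hu : ‖u‖ = 1) (hv : ‖v‖ = 1)
    (hz : ‖z - O‖ ≤ 1) (hne : v - u ≠ 0)
    (h : ∀ p ∈ Metric.closedBall O 1, 0 ≤ inner ℝ (v - u) (p - z)) :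
    ‖z - O‖ = 1 ∧ u = v - (2 * inner ℝ v (z - O)) • (z - O) ∧ 0 < inner ℝ u (z - O) := by
  have hpos : 0 < ‖v - u‖ := norm_pos_iff.2 hne
  have h1 := h (O - ‖v - u‖⁻¹ • (v - u)) (by
    rw [mem_closedBall_iff_norm, sub_sub_cancel_left, norm_neg, norm_inv_norm_smul hne])
  have e1 : O - ‖v - u‖⁻¹ • (v - u) - z = -(‖v - u‖⁻¹ • (v - u)) - (z - O) := by abel
  rw [e1, inner_sub_right, inner_neg_right, inner_smul_right, real_inner_self_eq_norm_sq] at h1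
  have e2 : ‖v - u‖⁻¹ * ‖v - u‖ ^ 2 = ‖v - u‖ := by field_simp
  rw [e2] at h1
  have h2 := (abs_le.1 (abs_real_inner_le_norm (v - u) (z - O))).1
  have hn : ‖z - O‖ = 1 := by
    apply le_antisymm hz
    by_contra hcon
    push Not at hcon
    nlinarith
  have h3 : ‖(v - u) + ‖v - u‖ • (z - O)‖ ^ 2 ≤ 0 := by
    rw [norm_add_sq_real, norm_smul, inner_smul_right, hn, norm_norm]
    nlinarith
  have h4 : (v - u) + ‖v - u‖ • (z - O) = 0 := by
    rw [← norm_eq_zero]; nlinarith [norm_nonneg ((v - u) + ‖v - u‖ • (z - O))]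
  have h5 : u = v + ‖v - u‖ • (z - O) := by
    rw [eq_comm, ← sub_eq_zero, ← h4]; abel
  have h6 : ‖v - u‖ = -(2 * inner ℝ v (z - O)) := by
    have : ‖u‖ ^ 2 = ‖v + ‖v - u‖ • (z - O)‖ ^ 2 := by rw [← h5]
    rw [norm_add_sq_real, norm_smul, inner_smul_right, hn, hu, hv, norm_norm] at this
    have h7 : ‖v - u‖ * (2 * inner ℝ v (z - O) + ‖v - u‖) = 0 := by linarith
    rcases mul_eq_zero.1 h7 with h8 | h8
    · exact absurd h8 hpos.ne'
    · linarith
  have hrefl : u = v - (2 * inner ℝ v (z - O)) • (z - O) := by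
    rw [h6, neg_smul] at h5
    rw [sub_eq_add_neg]; exact h5
  exact ⟨hn, hrefl, by rw [inner_reflect hn hrefl]; linarith⟩

theorem eq_of_periodic_of_eqOn {N : ℕ} (hN : 0 < N) {y y' : ℤ → Plane}
    (h : ∀ k, y (k + N) = y k + w) (h' : ∀ k, y' (k + N) = y' k + w)
    (he : ∀ k : ℕ, k < N → y' k = y k) : y' = y := by
  funext k
  have hN' : (0 : ℤ) < N := by exact_mod_cast hN
  obtain ⟨m, hm⟩ : ∃ m : ℕ, (m : ℤ) = k % N :=
    ⟨(k % N).toNat, Int.toNat_of_nonneg (Int.emod_nonneg _ hN'.ne')⟩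
  have hmN : m < N := by have := Int.emod_lt_of_pos k hN'; omega
  have hkm : k = (m : ℤ) + (k / N) * N := by
    rw [hm, mul_comm]; exact (Int.emod_add_mul_ediv k N).symm
  rw [hkm, add_mul_period h, add_mul_period h', he m hmN]

/-- A reflecting chain is the unique minimiser of the length. -/
theorem eq_of_chainLength_le (hN : 0 < N) (hy : y ∈ diskChains N w O A)
    (hne : ∀ k, shiftChain N v y k ≠ shiftChain N v y (k + 1))
    (hunit : ∀ k : ℤ, ¬ (N : ℤ) ∣ k → ‖y k - O k‖ = 1)
    (hrefl : ∀ k : ℤ, ¬ (N : ℤ) ∣ k → direction (shiftChain N v y) k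
      = direction (shiftChain N v y) (k - 1)
        - (2 * inner ℝ (direction (shiftChain N v y) (k - 1)) (y k - O k)) • (y k - O k))
    (hin : ∀ k : ℤ, ¬ (N : ℤ) ∣ k →
      inner ℝ (direction (shiftChain N v y) (k - 1)) (y k - O k) ≤ 0)
    (hy' : y' ∈ diskChains N w O A)
    (hle : chainLength N (shiftChain N v y') ≤ chainLength N (shiftChain N v y)) : y' = y := by
  set z := shiftChain N v y with hz
  set z' := shiftChain N v y' with hz'
  have hzz : ∀ k, z' k - z k = y' k - y k := shiftChain_sub
  have hnormal : ∀ k : ℤ, ¬ (N : ℤ) ∣ k →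
      inner ℝ (y k - O k) (y' k - y k) ≤ -(‖y' k - y k‖ ^ 2 / 2) := by
    intro k hk
    have h1 := hy'.2.1 k
    rw [mem_closedBall_iff_norm] at h1
    have e : y' k - O k = (y k - O k) + (y' k - y k) := by abel
    have h2 : ‖y' k - O k‖ ^ 2 ≤ 1 := by nlinarith [norm_nonneg (y' k - O k)]
    rw [e, norm_add_sq_real, hunit k hk] at h2
    linarith
  have hzero : ∀ k : ℤ, (N : ℤ) ∣ k → y' k - y k = 0 := by
    rintro k ⟨m, rfl⟩
    have h1 := add_mul_period hy.1 0 m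
    have h2 := add_mul_period hy'.1 0 m
    rw [zero_add, mul_comm] at h1 h2
    rw [h1, h2, hy.2.2, hy'.2.2, sub_self]
  have hterm : ∀ k : ℤ, 0 ≤ inner ℝ (direction z (k - 1) - direction z k) (y' k - y k) := by
    intro k
    by_cases hk : (N : ℤ) ∣ k
    · rw [hzero k hk, inner_zero_right]
    · rw [hrefl k hk, sub_sub_cancel, inner_smul_left]
      have := hnormal k hk
      simp only [conj_trivial]
      nlinarith [hin k hk, sq_nonneg ‖y' k - y k‖]
  have hzper : ∀ k, z (k + N) = z k + w := shiftChain_periodic hy.1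
  have hparts := sum_inner_by_parts (N := N) (u := direction z) (η := fun k => y' k - y k)
    (direction_add_period hzper) (fun k => by rw [hy.1, hy'.1]; abel)
  have hseg : ∀ k : ℤ, inner ℝ (direction z k) (z' (k + 1) - z' k)
      = ‖z (k + 1) - z k‖ + inner ℝ (direction z k) ((y' (k + 1) - y (k + 1)) - (y' k - y k)) := by
    intro k
    have e : z' (k + 1) - z' k = (z (k + 1) - z k)
        + ((y' (k + 1) - y (k + 1)) - (y' k - y k)) := by
      rw [← hzz, ← hzz]; abel
    rw [e, inner_add_right]
    congr 1
    nth_rewrite 1 [← norm_smul_direction (hne k)]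
    rw [inner_smul_right, real_inner_self_eq_norm_sq, norm_direction (hne k)]; ring
  have hcs : ∀ k : ℤ, inner ℝ (direction z k) (z' (k + 1) - z' k) ≤ ‖z' (k + 1) - z' k‖ := by
    intro k
    refine (real_inner_le_norm _ _).trans ?_
    rw [norm_direction (hne k), one_mul]
  have hsum : ∑ k ∈ Finset.range N, ((‖z' ((k : ℤ) + 1) - z' k‖
      - inner ℝ (direction z k) (z' ((k : ℤ) + 1) - z' k))
      + inner ℝ (direction z ((k : ℤ) - 1) - direction z k) (y' k - y k)) ≤ 0 := by
    rw [Finset.sum_add_distrib, ← hparts, Finset.sum_sub_distrib]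
    have h2 : ∑ k ∈ Finset.range N, inner ℝ (direction z k) (z' ((k : ℤ) + 1) - z' k)
        = chainLength N z + ∑ k ∈ Finset.range N, inner ℝ (direction z k)
          ((y' ((k : ℤ) + 1) - y ((k : ℤ) + 1)) - (y' k - y k)) := by
      rw [chainLength, ← Finset.sum_add_distrib]
      exact Finset.sum_congr rfl fun k _ => hseg k
    rw [h2]
    unfold chainLength at hle ⊢
    linarith
  have hall : ∀ k : ℕ, k < N → (‖z' ((k : ℤ) + 1) - z' k‖
      = inner ℝ (direction z k) (z' ((k : ℤ) + 1) - z' k)) := by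
    intro k hk
    have hnn : ∀ j ∈ Finset.range N, 0 ≤ (‖z' ((j : ℤ) + 1) - z' j‖
      - inner ℝ (direction z j) (z' ((j : ℤ) + 1) - z' j))
      + inner ℝ (direction z ((j : ℤ) - 1) - direction z j) (y' j - y j) := fun j _ => by
      linarith [hcs j, hterm j]
    have h0 := (Finset.sum_eq_zero_iff_of_nonneg hnn).1 (le_antisymm hsum (Finset.sum_nonneg hnn))
      k (Finset.mem_range.2 hk)
    linarith [hcs k, hterm k]
  have hall2 : ∀ k : ℕ, k < N →
      inner ℝ (direction z ((k : ℤ) - 1) - direction z k) (y' k - y k) = 0 := by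
    intro k hk
    have hnn : ∀ j ∈ Finset.range N, 0 ≤ (‖z' ((j : ℤ) + 1) - z' j‖
      - inner ℝ (direction z j) (z' ((j : ℤ) + 1) - z' j))
      + inner ℝ (direction z ((j : ℤ) - 1) - direction z j) (y' j - y j) := fun j _ => by
      linarith [hcs j, hterm j]
    have h0 := (Finset.sum_eq_zero_iff_of_nonneg hnn).1 (le_antisymm hsum (Finset.sum_nonneg hnn))
      k (Finset.mem_range.2 hk)
    linarith [hcs k, hterm k]
  refine eq_of_periodic_of_eqOn hN hy.1 hy'.1 fun k => ?_
  induction k with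
  | zero => intro _; rw [Nat.cast_zero, hy.2.2, hy'.2.2]
  | succ k ih =>
    intro hk
    have ihk := ih (by omega)
    have hndvd := OrbitPair.not_dvd_of_lt hk
    have hdir : z' ((k : ℤ) + 1) - z' k = ‖z' ((k : ℤ) + 1) - z' k‖ • direction z k := by
      have h1 := hall k (by omega)
      have h2 : inner ℝ (direction z k) (z' ((k : ℤ) + 1) - z' k)
          = ‖direction z k‖ * ‖z' ((k : ℤ) + 1) - z' k‖ := by
        rw [norm_direction (hne k), one_mul, ← h1]
      have h3 := (inner_eq_norm_mul_iff_real).1 h2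
      rw [norm_direction (hne k), one_smul] at h3
      exact h3.symm
    have hΔ : y' ((k + 1 : ℕ) : ℤ) - y ((k + 1 : ℕ) : ℤ)
        = (‖z' ((k : ℤ) + 1) - z' k‖ - ‖z ((k : ℤ) + 1) - z k‖) • direction z k := by
      rw [sub_smul, ← hdir, norm_smul_direction (hne k), ← hzz]
      have : z' k = z k := by
        have := hzz k
        rw [ihk, sub_self] at this
        exact sub_eq_zero.1 this
      rw [this]; push_cast; abel
    have hcast : (((k + 1 : ℕ) : ℤ) - 1) = (k : ℤ) := by push_cast; ring
    have h0 := hall2 (k + 1) hk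
    rw [hrefl _ hndvd, sub_sub_cancel, inner_smul_left, hcast] at h0
    simp only [conj_trivial] at h0
    have hperp : inner ℝ (y ((k + 1 : ℕ) : ℤ) - O ((k + 1 : ℕ) : ℤ))
        (y' ((k + 1 : ℕ) : ℤ) - y ((k + 1 : ℕ) : ℤ)) = 0 := by
      rcases mul_eq_zero.1 h0 with h1 | h1
      · rw [hΔ, inner_smul_right, real_inner_comm]
        have : inner ℝ (direction z k) (y ((k + 1 : ℕ) : ℤ) - O ((k + 1 : ℕ) : ℤ)) = 0 := by
          linarith
        rw [this, mul_zero]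
      · exact h1
    have h2 := hnormal _ hndvd
    rw [hperp] at h2
    have h3 : ‖y' ((k + 1 : ℕ) : ℤ) - y ((k + 1 : ℕ) : ℤ)‖ = 0 := by
      nlinarith [norm_nonneg (y' ((k + 1 : ℕ) : ℤ) - y ((k + 1 : ℕ) : ℤ))]
    exact sub_eq_zero.1 (norm_eq_zero.1 h3)

end Chains

/-- A selection of minimisers over a compact set is continuous wherever the minimiser is unique. -/
theorem continuousAt_of_unique_minimiser {X Y : Type*} [TopologicalSpace X] [TopologicalSpace Y]
    {K : Set Y} (hK : IsCompact K) {f : X × Y → ℝ} (hf : Continuous f)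
    {m : X → Y} (hm : ∀ x, m x ∈ K) (hmin : ∀ x, ∀ y ∈ K, f (x, m x) ≤ f (x, y)) {x₀ : X}
    (huniq : ∀ y ∈ K, f (x₀, y) ≤ f (x₀, m x₀) → y = m x₀) : ContinuousAt m x₀ := by
  rw [ContinuousAt, Filter.tendsto_iff_ultrafilter]
  intro F hF
  obtain ⟨y, hy, hFy⟩ := hK.ultrafilter_le_nhds (F.map m)
    (Filter.le_principal_iff.2 (Filter.mem_map.2 (Filter.univ_mem' hm)))
  have hlim : Filter.Tendsto (fun x => (x, m x)) F (nhds (x₀, y)) :=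
    Filter.Tendsto.prodMk_nhds (Filter.tendsto_id'.2 hF) hFy
  have h1 : f (x₀, y) ≤ f (x₀, m x₀) := by
    have h2 : Filter.Tendsto (fun x => f (x, m x)) F (nhds (f (x₀, y))) :=
      hf.continuousAt.tendsto.comp hlim
    have h3 : Filter.Tendsto (fun x => f (x, m x₀)) F (nhds (f (x₀, m x₀))) :=
      hf.continuousAt.tendsto.comp
        (Filter.Tendsto.prodMk_nhds (Filter.tendsto_id'.2 hF) tendsto_const_nhds)
    exact le_of_tendsto_of_tendsto' h2 h3 fun x => hmin x _ (hm x₀)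
  rw [← huniq y hy h1]
  exact hFy

theorem tendsto_direction {X : Type*} {F : Filter X} {P : X → ℤ → Plane} {z : ℤ → Plane}
    (hP : ∀ k, Filter.Tendsto (fun t => P t k) F (nhds (z k))) {k : ℤ} (hne : z k ≠ z (k + 1)) :
    Filter.Tendsto (fun t => direction (P t) k) F (nhds (direction z k)) := by
  have h1 := (hP (k + 1)).sub (hP k)
  exact (h1.norm.inv₀ (norm_ne_zero_iff.2 (sub_ne_zero.2 hne.symm))).smul h1

theorem exists_eq_natCast_add_mul {N : ℕ} (hN : 0 < N) (k : ℤ) :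
    ∃ m < N, ∃ j : ℤ, k = (m : ℤ) + j * N := by
  have hN' : (0 : ℤ) < N := by exact_mod_cast hN
  refine ⟨(k % N).toNat, ?_, k / N, ?_⟩
  · have := Int.emod_lt_of_pos k hN'
    have := Int.emod_nonneg k hN'.ne'
    omega
  · rw [Int.toNat_of_nonneg (Int.emod_nonneg _ hN'.ne'), mul_comm]
    exact (Int.emod_add_mul_ediv k N).symm

theorem direction_add_mul_period {Q : ℤ → Plane} {w : Plane} {N : ℕ}
    (h : ∀ k, Q (k + N) = Q k + w) (k j : ℤ) : direction Q (k + j * N) = direction Q k := by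
  rw [direction, direction, add_right_comm, add_mul_period h, add_mul_period h,
    add_sub_add_right_eq_sub]

theorem apply_add_mul_period {ι : Type*} {σ : ℤ → ι} {N : ℕ} (h : ∀ k, σ (k + N) = σ k) (k j : ℤ) :
    σ (k + j * N) = σ k := by
  induction j using Int.induction_on with
  | zero => simp
  | succ j ih => rw [add_mul, one_mul, ← add_assoc, h, ih]
  | pred j ih =>
    rw [← ih, ← h (k + (-(j : ℤ) - 1) * N)]
    congr 1; ring

/-- Every closed disk of the billiard that does not carry an end point of the `k`-th segment is
disjoint from the segment. -/
def IsClearSegment {ι : Type*} (Λ : Submodule ℤ Plane) (c : ι → Plane) (σ : ℤ → ι) (g : ℤ → Plane)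
    (Q : ℤ → Plane) (k : ℤ) : Prop :=
  ∀ i : ι, ∀ a ∈ Λ, ¬ (σ k = i ∧ g k = a) → ¬ (σ (k + 1) = i ∧ g (k + 1) = a) →
    ∀ x ∈ segment ℝ (Q k) (Q (k + 1)), 1 < dist x (c i + a)

/-- A polygon with vertices on the scatterers that satisfies the law of reflection. -/
structure IsReflectingPolygon {ι : Type*} (Λ : Submodule ℤ Plane) (c : ι → Plane)
    (N : ℕ) (σ : ℤ → ι) (g : ℤ → Plane) (w : Plane) (Q : ℤ → Plane) : Prop where
  period_pos : 0 < N
  g_mem : ∀ k, g k ∈ Λ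
  w_mem : w ∈ Λ
  σ_periodic : ∀ k, σ (k + N) = σ k
  g_periodic : ∀ k, g (k + N) = g k + w
  Q_periodic : ∀ k, Q (k + N) = Q k + w
  norm_normal : ∀ k, ‖Q k - (c (σ k) + g k)‖ = 1
  reflection : ∀ k, direction Q k = direction Q (k - 1) -
    (2 * inner ℝ (direction Q (k - 1)) (Q k - (c (σ k) + g k))) • (Q k - (c (σ k) + g k))

section Regular

variable {ι : Type*} {Λ : Submodule ℤ Plane} {c : ι → Plane} {N : ℕ} {σ : ℤ → ι} {g : ℤ → Plane}
  {w : Plane} {Q : ℤ → Plane}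

theorem IsPeriodicOrbit.of_tendsto {X : Type*} {F : Filter X} [F.NeBot] {c' : X → ι → Plane}
    {P : X → ℤ → Plane} (hc : ∀ i, Filter.Tendsto (fun t => c' t i) F (nhds (c i)))
    (hP : ∀ k, Filter.Tendsto (fun t => P t k) F (nhds (Q k)))
    (h : ∀ᶠ t in F, IsPeriodicOrbit Λ (c' t) N σ g w (P t)) (hne : ∀ k, Q k ≠ Q (k + 1)) :
    IsPeriodicOrbit Λ c N σ g w Q := by
  obtain ⟨t₀, h₀⟩ := h.exists
  have hn : ∀ k, Filter.Tendsto (fun t => P t k - (c' t (σ k) + g k)) F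
      (nhds (Q k - (c (σ k) + g k))) := fun k => (hP k).sub ((hc _).add tendsto_const_nhds)
  have hd := fun k => tendsto_direction hP (hne k)
  have hd' : ∀ k, Filter.Tendsto (fun t => direction (P t) (k - 1)) F
      (nhds (direction Q (k - 1))) := fun k => hd (k - 1)
  refine ⟨h₀.period_pos, h₀.g_mem, h₀.w_mem, h₀.σ_periodic, h₀.g_periodic, fun k => ?_, fun k => ?_,
    hne, fun k x hx i a ha => ?_, fun k => ?_⟩
  · exact tendsto_nhds_unique_of_eventuallyEq (hP (k + N)) ((hP k).add tendsto_const_nhds)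
      (h.mono fun t ht => ht.Q_periodic k)
  · rw [mem_sphere_iff_norm]
    exact tendsto_nhds_unique_of_eventuallyEq (hn k).norm tendsto_const_nhds
      (h.mono fun t ht => ht.norm_normal k)
  · rw [segment_eq_image'] at hx
    obtain ⟨θ, hθ, rfl⟩ := hx
    rw [mem_ball_iff_norm, not_lt]
    have hx' : Filter.Tendsto (fun t => ‖P t k + θ • (P t (k + 1) - P t k) - (c' t i + a)‖) F
        (nhds ‖Q k + θ • (Q (k + 1) - Q k) - (c i + a)‖) :=
      ((((hP k).add (((hP (k + 1)).sub (hP k)).const_smul θ))).sub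
        ((hc i).add tendsto_const_nhds)).norm
    refine ge_of_tendsto hx' (h.mono fun t ht => ?_)
    have hmem : P t k + θ • (P t (k + 1) - P t k) ∈ segment ℝ (P t k) (P t (k + 1)) := by
      rw [segment_eq_image']; exact ⟨θ, hθ, rfl⟩
    have h1 := ht.segment_subset k hmem i a ha
    rwa [mem_ball_iff_norm, not_lt] at h1
  · exact tendsto_nhds_unique_of_eventuallyEq (hd k)
      ((hd' k).sub (((((hd' k).inner (hn k)).const_mul 2)).smul (hn k)))
      (h.mono fun t ht => ht.reflection k)

theorem IsPeriodicOrbit.isReflectingPolygon (h : IsPeriodicOrbit Λ c N σ g w Q) :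
    IsReflectingPolygon Λ c N σ g w Q :=
  ⟨h.period_pos, h.g_mem, h.w_mem, h.σ_periodic, h.g_periodic, h.Q_periodic, h.norm_normal,
    h.reflection⟩

theorem IsPeriodicOrbit.outgoing_pos (h : IsPeriodicOrbit Λ c N σ g w Q)
    (hns : ¬ IsSingularOrbit Λ c Q) (k : ℤ) :
    0 < inner ℝ (direction Q k) (Q k - (c (σ k) + g k)) := by
  refine lt_of_le_of_ne (h.outgoing k) fun h0 => hns ⟨k, σ k, g k, h.g_mem k, Q k,
    left_mem_segment _ _ _, h.mem_boundary k, ?_⟩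
  rw [← norm_smul_direction (h.ne_next k), inner_smul_right, real_inner_comm, ← h0, mul_zero]

theorem IsBilliard.two_lt_dist (hc : IsBilliard Λ c) {i j : ι} {a b : Plane} (ha : a ∈ Λ)
    (hb : b ∈ Λ) (hne : ¬ (i = j ∧ a = b)) : 2 < dist (c i + a) (c j + b) := by
  have h1 := two_lt_dist_of_disjoint (hc i j (b - a) (Λ.sub_mem hb ha) (by
    by_contra hcon
    push Not at hcon
    exact hne ⟨hcon.1, (sub_eq_zero.1 hcon.2).symm⟩))
  rw [dist_eq_norm] at h1 ⊢
  convert h1 using 2; abel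

theorem IsPeriodicOrbit.isClearSegment (h : IsPeriodicOrbit Λ c N σ g w Q) (hc : IsBilliard Λ c)
    (hns : ¬ IsSingularOrbit Λ c Q) (k : ℤ) : IsClearSegment Λ c σ g Q k := by
  intro i a ha h1 h2 x hx
  have h3 := h.segment_subset k hx i a ha
  rw [Metric.mem_ball, not_lt] at h3
  refine lt_of_le_of_ne h3 fun h4 => ?_
  have hx1 : ‖x - (c i + a)‖ = 1 := by rw [← dist_eq_norm]; exact h4.symm
  have e1 := inner_nonneg_of_segment_avoids hx1 (y := Q (k + 1)) fun z hz =>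
    h.segment_subset k ((convex_segment _ _).segment_subset hx (right_mem_segment _ _ _) hz) i a ha
  have e2 := inner_nonneg_of_segment_avoids hx1 (y := Q k) fun z hz =>
    h.segment_subset k ((convex_segment _ _).segment_subset hx (left_mem_segment _ _ _) hz) i a ha
  have hend : ∀ l, ¬ (σ l = i ∧ g l = a) → x ≠ Q l := by
    rintro l hl rfl
    have := hc.two_lt_dist (h.g_mem l) ha hl
    have := dist_triangle_left (c (σ l) + g l) (c i + a) (Q l)
    have := h.mem_boundary l
    rw [Metric.mem_sphere] at this
    linarith
  have hx' := hx
  rw [segment_eq_image'] at hx'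
  obtain ⟨θ, hθ, hθx⟩ := hx'
  simp only at hθx
  have hθ0 : 0 < θ := lt_of_le_of_ne hθ.1 fun h0 => hend k h1 (by rw [← hθx, ← h0]; simp)
  have hθ1 : θ < 1 := lt_of_le_of_ne hθ.2 fun h0 => hend (k + 1) h2 (by rw [← hθx, h0]; simp)
  have d1 : Q (k + 1) - x = (1 - θ) • (Q (k + 1) - Q k) := by
    rw [← hθx, sub_smul, one_smul]; abel
  have d2 : Q k - x = (-θ) • (Q (k + 1) - Q k) := by
    rw [← hθx, neg_smul]; abel
  rw [d1, inner_smul_left] at e1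
  rw [d2, inner_smul_left] at e2
  simp only [conj_trivial] at e1 e2
  refine hns ⟨k, i, a, ha, x, hx, h4.symm, ?_⟩
  rw [real_inner_comm]
  nlinarith

namespace IsReflectingPolygon

theorem inner_next_neg (h : IsReflectingPolygon Λ c N σ g w Q)
    (hout : ∀ k, 0 < inner ℝ (direction Q k) (Q k - (c (σ k) + g k))) (k : ℤ) :
    inner ℝ (direction Q k) (Q (k + 1) - (c (σ (k + 1)) + g (k + 1))) < 0 := by
  have h1 := hout (k + 1)
  have h2 := h.reflection (k + 1)
  rw [add_sub_cancel_right] at h2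
  rw [inner_reflect (h.norm_normal (k + 1)) h2] at h1
  linarith

theorem isPeriodicOrbit (h : IsReflectingPolygon Λ c N σ g w Q)
    (hne : ∀ k, Q k ≠ Q (k + 1))
    (hout : ∀ k, 0 < inner ℝ (direction Q k) (Q k - (c (σ k) + g k)))
    (hclear : ∀ k, IsClearSegment Λ c σ g Q k) :
    IsPeriodicOrbit Λ c N σ g w Q ∧ ¬ IsSingularOrbit Λ c Q := by
  have key : ∀ k i, ∀ a ∈ Λ, ∀ x ∈ segment ℝ (Q k) (Q (k + 1)), 1 ≤ ‖x - (c i + a)‖ ∧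
      (‖x - (c i + a)‖ = 1 → inner ℝ (x - (c i + a)) (Q (k + 1) - Q k) ≠ 0) := by
    intro k i a ha x hx
    have hD := norm_smul_direction (hne k)
    have hL : 0 < ‖Q (k + 1) - Q k‖ := norm_pos_iff.2 (sub_ne_zero.2 (hne k).symm)
    have hx' := hx
    rw [segment_eq_image'] at hx'
    obtain ⟨θ, hθ, rfl⟩ := hx'
    simp only
    by_cases h1 : σ k = i ∧ g k = a
    · obtain ⟨rfl, rfl⟩ := h1
      have hn := h.norm_normal k
      have hp : 0 < inner ℝ (Q k - (c (σ k) + g k)) (Q (k + 1) - Q k) := by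
        rw [← hD, inner_smul_right, real_inner_comm]; exact mul_pos hL (hout k)
      have e : Q k + θ • (Q (k + 1) - Q k) - (c (σ k) + g k)
          = (Q k - (c (σ k) + g k)) + θ • (Q (k + 1) - Q k) := by abel
      rw [e]
      set n := Q k - (c (σ k) + g k)
      set D := Q (k + 1) - Q k
      have e2 : ‖n + θ • D‖ ^ 2 = 1 + 2 * θ * inner ℝ n D + θ ^ 2 * ‖D‖ ^ 2 := by
        rw [norm_add_sq_real, hn, inner_smul_right, norm_smul, mul_pow, Real.norm_eq_abs, sq_abs]
        ring
      refine ⟨?_, fun _ => ?_⟩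
      · have : 0 ≤ θ * inner ℝ n D := mul_nonneg hθ.1 hp.le
        have : 0 ≤ θ ^ 2 * ‖D‖ ^ 2 := by positivity
        have h5 : 1 ≤ ‖n + θ • D‖ ^ 2 := by rw [e2]; linarith
        by_contra hcon
        push Not at hcon
        nlinarith [norm_nonneg (n + θ • D)]
      · rw [inner_add_left, inner_smul_left, real_inner_self_eq_norm_sq]
        simp only [conj_trivial]
        have : 0 ≤ θ * ‖D‖ ^ 2 := mul_nonneg hθ.1 (by positivity)
        linarith
    by_cases h2 : σ (k + 1) = i ∧ g (k + 1) = a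
    · obtain ⟨rfl, rfl⟩ := h2
      have hn := h.norm_normal (k + 1)
      have hp : inner ℝ (Q (k + 1) - (c (σ (k + 1)) + g (k + 1))) (Q (k + 1) - Q k) < 0 := by
        rw [← hD, inner_smul_right, real_inner_comm]
        exact mul_neg_of_pos_of_neg hL (h.inner_next_neg hout k)
      have e : Q k + θ • (Q (k + 1) - Q k) - (c (σ (k + 1)) + g (k + 1))
          = (Q (k + 1) - (c (σ (k + 1)) + g (k + 1))) - (1 - θ) • (Q (k + 1) - Q k) := by
        rw [sub_smul, one_smul]; abel
      rw [e]
      set n := Q (k + 1) - (c (σ (k + 1)) + g (k + 1))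
      set D := Q (k + 1) - Q k
      have e2 : ‖n - (1 - θ) • D‖ ^ 2 = 1 - 2 * (1 - θ) * inner ℝ n D + (1 - θ) ^ 2 * ‖D‖ ^ 2 := by
        rw [norm_sub_sq_real, hn, inner_smul_right, norm_smul, mul_pow, Real.norm_eq_abs, sq_abs]
        ring
      have hθ' : 0 ≤ 1 - θ := by linarith [hθ.2]
      refine ⟨?_, fun _ => ?_⟩
      · have : (1 - θ) * inner ℝ n D ≤ 0 := mul_nonpos_of_nonneg_of_nonpos hθ' hp.le
        have : 0 ≤ (1 - θ) ^ 2 * ‖D‖ ^ 2 := by positivity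
        have h5 : 1 ≤ ‖n - (1 - θ) • D‖ ^ 2 := by rw [e2]; linarith
        by_contra hcon
        push Not at hcon
        nlinarith [norm_nonneg (n - (1 - θ) • D)]
      · rw [inner_sub_left, inner_smul_left, real_inner_self_eq_norm_sq]
        simp only [conj_trivial]
        have : 0 ≤ (1 - θ) * ‖D‖ ^ 2 := mul_nonneg hθ' (by positivity)
        linarith
    · have := hclear k i a ha h1 h2 _ hx
      rw [dist_eq_norm] at this
      exact ⟨this.le, fun h0 => absurd h0 this.ne'⟩
  refine ⟨⟨h.period_pos, h.g_mem, h.w_mem, h.σ_periodic, h.g_periodic, h.Q_periodic,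
    fun k => mem_sphere_iff_norm.2 (h.norm_normal k), hne, fun k x hx i a ha => ?_,
    h.reflection⟩, ?_⟩
  · rw [mem_ball_iff_norm, not_lt]
    exact (key k i a ha x hx).1
  · rintro ⟨k, i, a, ha, x, hx, h1, h2⟩
    exact (key k i a ha x hx).2 (mem_sphere_iff_norm.1 h1) h2

theorem isClearSegment_add_mul_period (h : IsReflectingPolygon Λ c N σ g w Q) {k : ℤ}
    (hk : IsClearSegment Λ c σ g Q k) (j : ℤ) : IsClearSegment Λ c σ g Q (k + j * N) := by
  intro i a ha h1 h2 x hx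
  rw [add_right_comm, apply_add_mul_period h.σ_periodic, add_mul_period h.g_periodic] at h2
  rw [apply_add_mul_period h.σ_periodic, add_mul_period h.g_periodic] at h1
  rw [add_right_comm, add_mul_period h.Q_periodic, add_mul_period h.Q_periodic,
    segment_eq_image'] at hx
  obtain ⟨θ, hθ, rfl⟩ := hx
  have := hk i (a - j • w) (Λ.sub_mem ha (Λ.smul_mem j h.w_mem))
    (fun h0 => h1 ⟨h0.1, by rw [h0.2]; abel⟩) (fun h0 => h2 ⟨h0.1, by rw [h0.2]; abel⟩)
    (Q k + θ • (Q (k + 1) - Q k)) (by rw [segment_eq_image']; exact ⟨θ, hθ, rfl⟩)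
  rw [dist_eq_norm] at this ⊢
  simp only [add_sub_add_right_eq_sub]
  convert this using 2; abel

end IsReflectingPolygon

theorem isCompact_segment (x y : Plane) : IsCompact (segment ℝ x y) := by
  rw [segment_eq_image']
  exact isCompact_Icc.image (by fun_prop)

theorem IsClearSegment.exists_margin [DiscreteTopology Λ] {k : ℤ}
    (h : IsClearSegment Λ c σ g Q k) (i : ι) :
    ∃ η : ℝ, 0 < η ∧ ∀ a ∈ Λ, ¬ (σ k = i ∧ g k = a) → ¬ (σ (k + 1) = i ∧ g (k + 1) = a) →
      ∀ x ∈ segment ℝ (Q k) (Q (k + 1)), 1 + η ≤ dist x (c i + a) := by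
  set R := ‖Q (k + 1) - Q k‖ + 2 with hR
  set S : Set Plane := {a | a ∈ Λ ∧ dist (Q k - c i) a ≤ R} ∩
    {a | ¬ (σ k = i ∧ g k = a) ∧ ¬ (σ (k + 1) = i ∧ g (k + 1) = a)} with hS
  have hfin : S.Finite := (submodule_inter_finite Λ (Q k - c i) R).inter_of_left _
  have hfar : ∀ a, R < dist (Q k - c i) a → ∀ x ∈ segment ℝ (Q k) (Q (k + 1)),
      2 ≤ dist x (c i + a) := by
    intro a ha x hx
    rw [segment_eq_image'] at hx
    obtain ⟨θ, hθ, rfl⟩ := hx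
    rw [dist_eq_norm] at ha ⊢
    simp only
    have e : Q k - c i - a = (Q k + θ • (Q (k + 1) - Q k) - (c i + a))
        - θ • (Q (k + 1) - Q k) := by abel
    rw [e] at ha
    have h1 := norm_sub_le (Q k + θ • (Q (k + 1) - Q k) - (c i + a)) (θ • (Q (k + 1) - Q k))
    rw [norm_smul, Real.norm_of_nonneg hθ.1] at h1
    nlinarith [norm_nonneg (Q (k + 1) - Q k), hθ.2]
  have hK : IsCompact (segment ℝ (Q k) (Q (k + 1)) ×ˢ S) :=
    (isCompact_segment _ _).prod hfin.isCompact
  rcases S.eq_empty_or_nonempty with h0 | h0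
  · refine ⟨1, one_pos, fun a ha h1 h2 x hx => ?_⟩
    have := hfar a (by
      by_contra hcon
      have : a ∈ S := ⟨⟨ha, not_lt.1 hcon⟩, h1, h2⟩
      rw [h0] at this; exact this) x hx
    linarith
  · obtain ⟨⟨x₀, a₀⟩, h1, hmin⟩ := hK.exists_isMinOn
      (Set.Nonempty.prod ⟨Q k, left_mem_segment _ _ _⟩ h0)
      (f := fun p : Plane × Plane => dist p.1 (c i + p.2)) (by fun_prop)
    obtain ⟨hx₀, ha₀⟩ := Set.mem_prod.1 h1
    obtain ⟨⟨b1, -⟩, b2, b3⟩ := ha₀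
    have h2 : 1 < dist x₀ (c i + a₀) := h i a₀ b1 b2 b3 x₀ hx₀
    refine ⟨min 1 (dist x₀ (c i + a₀) - 1), lt_min one_pos (by linarith),
      fun a ha hn1 hn2 x hx => ?_⟩
    by_cases haS : a ∈ S
    · have h3 : dist x₀ (c i + a₀) ≤ dist x (c i + a) :=
        isMinOn_iff.1 hmin (x, a) (Set.mk_mem_prod hx haS)
      have := min_le_right 1 (dist x₀ (c i + a₀) - 1)
      linarith
    · have := hfar a (by
        by_contra hcon
        exact haS ⟨⟨ha, not_lt.1 hcon⟩, hn1, hn2⟩) x hx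
      have := min_le_left 1 (dist x₀ (c i + a₀) - 1)
      linarith

theorem IsClearSegment.eventually [Finite ι] [DiscreteTopology Λ] {X : Type*} {F : Filter X}
    {c' : X → ι → Plane} {P : X → ℤ → Plane}
    (hc : ∀ i, Filter.Tendsto (fun t => c' t i) F (nhds (c i)))
    (hP : ∀ k, Filter.Tendsto (fun t => P t k) F (nhds (Q k))) {k : ℤ}
    (h : IsClearSegment Λ c σ g Q k) : ∀ᶠ t in F, IsClearSegment Λ (c' t) σ g (P t) k := by
  unfold IsClearSegment
  rw [Filter.eventually_all]
  intro i
  obtain ⟨η, hη, hmargin⟩ := h.exists_margin i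
  have h1 : ∀ᶠ t in F, dist (c' t i) (c i) < η / 3 :=
    (hc i).eventually (Metric.ball_mem_nhds _ (by positivity))
  have h2 : ∀ l, ∀ᶠ t in F, dist (P t l) (Q l) < η / 3 := fun l =>
    (hP l).eventually (Metric.ball_mem_nhds _ (by positivity))
  filter_upwards [h1, h2 k, h2 (k + 1)] with t t1 t2 t3 a ha n1 n2 x hx
  rw [segment_eq_image'] at hx
  obtain ⟨θ, hθ, rfl⟩ := hx
  have h3 := hmargin a ha n1 n2 (Q k + θ • (Q (k + 1) - Q k))
    (by rw [segment_eq_image']; exact ⟨θ, hθ, rfl⟩)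
  rw [dist_eq_norm] at h3 t1 t2 t3 ⊢
  simp only
  have e : Q k + θ • (Q (k + 1) - Q k) - (c i + a)
      = (P t k + θ • (P t (k + 1) - P t k) - (c' t i + a)) + (c' t i - c i)
        - ((1 - θ) • (P t k - Q k) + θ • (P t (k + 1) - Q (k + 1))) := by
    module
  rw [e] at h3
  have n3 := norm_sub_le (P t k + θ • (P t (k + 1) - P t k) - (c' t i + a) + (c' t i - c i))
    ((1 - θ) • (P t k - Q k) + θ • (P t (k + 1) - Q (k + 1)))
  have n4 := norm_add_le (P t k + θ • (P t (k + 1) - P t k) - (c' t i + a)) (c' t i - c i)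
  have n5 := norm_add_le ((1 - θ) • (P t k - Q k)) (θ • (P t (k + 1) - Q (k + 1)))
  rw [norm_smul, norm_smul, Real.norm_of_nonneg hθ.1,
    Real.norm_of_nonneg (by linarith [hθ.2])] at n5
  have n6 : (1 - θ) * ‖P t k - Q k‖ ≤ 1 * ‖P t k - Q k‖ :=
    mul_le_mul_of_nonneg_right (by linarith [hθ.1]) (norm_nonneg _)
  have n7 : θ * ‖P t (k + 1) - Q (k + 1)‖ ≤ 1 * ‖P t (k + 1) - Q (k + 1)‖ :=
    mul_le_mul_of_nonneg_right hθ.2 (norm_nonneg _)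
  linarith

/-- Reflecting polygons close to a nonsingular orbit are nonsingular orbits. -/
theorem IsPeriodicOrbit.eventually_nonsingular [Finite ι] [DiscreteTopology Λ] {X : Type*}
    {F : Filter X} {c' : X → ι → Plane} {P : X → ℤ → Plane} (h : IsPeriodicOrbit Λ c N σ g w Q)
    (hbil : IsBilliard Λ c) (hns : ¬ IsSingularOrbit Λ c Q)
    (hc : ∀ i, Filter.Tendsto (fun t => c' t i) F (nhds (c i)))
    (hP : ∀ k, Filter.Tendsto (fun t => P t k) F (nhds (Q k)))
    (hpoly : ∀ᶠ t in F, IsReflectingPolygon Λ (c' t) N σ g w (P t) ∧ ∀ k, P t k ≠ P t (k + 1)) :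
    ∀ᶠ t in F, IsPeriodicOrbit Λ (c' t) N σ g w (P t) ∧ ¬ IsSingularOrbit Λ (c' t) (P t) := by
  have h1 : ∀ᶠ t in F, ∀ m ∈ Finset.range N, IsClearSegment Λ (c' t) σ g (P t) m :=
    (Filter.eventually_all_finset _).2 fun m _ => (h.isClearSegment hbil hns m).eventually hc hP
  have h2 : ∀ᶠ t in F, ∀ m ∈ Finset.range N,
      0 < inner ℝ (direction (P t) m) (P t m - (c' t (σ m) + g m)) := by
    refine (Filter.eventually_all_finset _).2 fun m _ => ?_
    exact ((tendsto_direction hP (h.ne_next m)).inner ((hP m).sub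
      ((hc _).add tendsto_const_nhds))).eventually (lt_mem_nhds (h.outgoing_pos hns m))
  filter_upwards [h1, h2, hpoly] with t t1 t2 t3
  obtain ⟨tp, tne⟩ := t3
  refine tp.isPeriodicOrbit tne (fun k => ?_) fun k => ?_
  · obtain ⟨m, hm, j, rfl⟩ := exists_eq_natCast_add_mul h.period_pos k
    rw [direction_add_mul_period tp.Q_periodic, add_mul_period tp.Q_periodic,
      add_mul_period tp.g_periodic, apply_add_mul_period tp.σ_periodic, ← add_assoc,
      add_sub_add_right_eq_sub]
    exact t2 m (Finset.mem_range.2 hm)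
  · obtain ⟨m, hm, j, rfl⟩ := exists_eq_natCast_add_mul h.period_pos k
    exact tp.isClearSegment_add_mul_period (t1 m (Finset.mem_range.2 hm)) j

end Regular

/-- The centre of a unit disk, translated by `-g 0`, at which the polygon `z` is reflected in the
point `z 0`. -/
noncomputable def reflectingCentre (g z : ℤ → Plane) : Plane :=
  z 0 - ‖direction z 0 - direction z (-1)‖⁻¹ • (direction z 0 - direction z (-1)) - g 0

theorem tendsto_reflectingCentre {X : Type*} {F : Filter X} {P : X → ℤ → Plane}
    {g z : ℤ → Plane} (hP : ∀ k, Filter.Tendsto (fun t => P t k) F (nhds (z k)))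
    (hne : ∀ k, z k ≠ z (k + 1)) (hturn : direction z 0 - direction z (-1) ≠ 0) :
    Filter.Tendsto (fun t => reflectingCentre g (P t)) F (nhds (reflectingCentre g z)) := by
  have h1 := (tendsto_direction hP (hne 0)).sub (tendsto_direction hP (hne (-1)))
  exact ((hP 0).sub ((h1.norm.inv₀ (norm_ne_zero_iff.2 hturn)).smul h1)).sub tendsto_const_nhds

theorem tendsto_update {ι X : Type*} [DecidableEq ι] {F : Filter X} {c : ι → Plane} {i₀ : ι}
    {C : X → Plane} {C₀ : Plane} (h : Filter.Tendsto C F (nhds C₀)) (i : ι) :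
    Filter.Tendsto (fun t => Function.update c i₀ (C t) i) F
      (nhds (Function.update c i₀ C₀ i)) := by
  rcases eq_or_ne i i₀ with rfl | hi
  · simpa using h
  · simpa [hi] using tendsto_const_nhds

theorem reflection_of_turn {u v : Plane} (hu : ‖u‖ = 1) (hv : ‖v‖ = 1) (hne : u - v ≠ 0) :
    u = v - (2 * inner ℝ v (‖u - v‖⁻¹ • (u - v))) • (‖u - v‖⁻¹ • (u - v)) := by
  have hpos : 0 < ‖u - v‖ := norm_pos_iff.2 hne
  have h1 : 2 * inner ℝ v (u - v) = -‖u - v‖ ^ 2 := by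
    rw [norm_sub_sq_real, inner_sub_right, real_inner_self_eq_norm_sq, hu, hv, real_inner_comm]
    ring
  rw [inner_smul_right, smul_smul]
  have e : 2 * (‖u - v‖⁻¹ * inner ℝ v (u - v)) * ‖u - v‖⁻¹ = -1 := by
    field_simp; linarith
  rw [e, neg_one_smul]; abel

theorem IsReflectingPolygon.turn_ne_zero {ι : Type*} {Λ : Submodule ℤ Plane} {c : ι → Plane}
    {N : ℕ} {σ : ℤ → ι} {g : ℤ → Plane} {w : Plane} {Q : ℤ → Plane}
    (h : IsReflectingPolygon Λ c N σ g w Q) {k : ℤ}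
    (hk : 0 < inner ℝ (direction Q k) (Q k - (c (σ k) + g k))) :
    direction Q (k - 1) - direction Q k ≠ 0 := by
  intro h0
  have h1 := inner_reflect (h.norm_normal k) (h.reflection k)
  rw [sub_eq_zero.1 h0] at h1
  linarith

section Minimiser

variable {ι : Type*} [DecidableEq ι] {Λ : Submodule ℤ Plane} {c : ι → Plane} {i₀ : ι}
  {C : Plane} {N : ℕ} {σ : ℤ → ι} {g : ℤ → Plane} {w : Plane} {Q P : ℤ → Plane} {x₀ : Plane}
  {γ : ℝ}

theorem isReflectingPolygon_of_minimiser (h : IsPeriodicOrbit Λ c N σ g w Q)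
    (hcode : ∀ k : ℤ, σ k = i₀ ↔ (N : ℤ) ∣ k) (hγ : 0 < γ) {v : Plane} (hv : ‖v‖ ≤ γ / 2)
    (hO : ∀ k, 2 + 2 * γ ≤ ‖(c (σ (k + 1)) + g (k + 1)) - (c (σ k) + g k)‖) {y : ℤ → Plane}
    (hy : y ∈ diskChains N w (fun k => c (σ k) + g k) (Q 0))
    (hmin : ∀ y' ∈ diskChains N w (fun k => c (σ k) + g k) (Q 0),
      chainLength N (shiftChain N v y) ≤ chainLength N (shiftChain N v y'))
    (hturn : ∀ k, direction (shiftChain N v y) (k - 1) - direction (shiftChain N v y) k ≠ 0) :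
    IsReflectingPolygon Λ (Function.update c i₀ (reflectingCentre g (shiftChain N v y))) N σ g w
      (shiftChain N v y) := by
  have hOper : ∀ k, (fun k => c (σ k) + g k) (k + N) = (fun k => c (σ k) + g k) k + w := by
    intro k
    simp only
    rw [h.σ_periodic, h.g_periodic, add_assoc]
  have hne := shiftChain_ne_next hy hγ hv hO
  have hper := shiftChain_periodic (v := v) hy.1
  set z := shiftChain N v y with hz
  have key : ∀ k, ‖z k - (Function.update c i₀ (reflectingCentre g z) (σ k) + g k)‖ = 1 ∧
      direction z k = direction z (k - 1) - (2 * inner ℝ (direction z (k - 1))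
        (z k - (Function.update c i₀ (reflectingCentre g z) (σ k) + g k))) •
        (z k - (Function.update c i₀ (reflectingCentre g z) (σ k) + g k)) := by
    intro k
    by_cases hk : (N : ℤ) ∣ k
    · obtain ⟨j, rfl⟩ := hk
      have e1 := direction_add_mul_period hper 0 j
      have e2 := direction_add_mul_period hper (-1) j
      have e3 := add_mul_period hper 0 j
      have e4 := add_mul_period h.g_periodic 0 j
      rw [zero_add, mul_comm] at e1 e3 e4
      rw [show -1 + j * (N : ℤ) = (N : ℤ) * j - 1 by ring] at e2
      have ht := hturn 0
      rw [zero_sub, ← neg_ne_zero, neg_sub] at ht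
      rw [(hcode _).2 (dvd_mul_right _ _), Function.update_self, e1, e2, e3, e4]
      have e5 : z 0 + j • w - (reflectingCentre g z + (g 0 + j • w))
          = ‖direction z 0 - direction z (-1)‖⁻¹ • (direction z 0 - direction z (-1)) := by
        rw [reflectingCentre]; abel
      rw [e5]
      exact ⟨norm_inv_norm_smul ht,
        reflection_of_turn (norm_direction (hne 0)) (norm_direction (hne (-1))) ht⟩
    · rw [Function.update_of_ne (fun h0 => hk ((hcode k).1 h0))]
      have hzk : z k = y k := shiftChain_of_not_dvd hk
      have hu' : ‖direction z (k - 1)‖ = 1 := norm_direction (hne (k - 1))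
      have hvar : ∀ p ∈ Metric.closedBall (c (σ k) + g k) 1,
          0 ≤ inner ℝ (direction z (k - 1) - direction z k) (p - z k) := fun p hp => by
        rw [hzk]
        exact inner_nonneg_of_minimiser (O := fun k => c (σ k) + g k) h.period_pos hOper hγ hv hO hy
          hmin hk hp
      have hball : ‖z k - (c (σ k) + g k)‖ ≤ 1 := by
        rw [hzk]; exact mem_closedBall_iff_norm.1 (hy.2.1 k)
      obtain ⟨h1, h2, -⟩ := reflection_of_variational (norm_direction (hne k)) hu' hball (hturn k)
        hvar
      exact ⟨h1, h2⟩
  exact ⟨h.period_pos, h.g_mem, h.w_mem, h.σ_periodic, h.g_periodic, hper, fun k => (key k).1,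
    fun k => (key k).2⟩

namespace OrbitPair

theorem shiftChain_mem_diskChains (h : OrbitPair Λ c i₀ C N σ g w Q P x₀ γ) :
    shiftChain N (-x₀) P ∈ diskChains N w (fun k => c (σ k) + g k) (Q 0) := by
  refine ⟨shiftChain_periodic h.orbit'.Q_periodic, fun k => ?_, ?_⟩
  · rw [mem_closedBall_iff_norm]
    by_cases hk : (N : ℤ) ∣ k
    · have e : P k + -x₀ = Q k := by rw [← h.sub_of_dvd hk]; abel
      rw [shiftChain_of_dvd hk, e]
      exact (h.orbit.norm_normal k).le
    · have := h.orbit'.norm_normal k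
      rw [h.centre_of_not_dvd hk] at this
      rw [shiftChain_of_not_dvd hk]
      exact this.le
  · rw [shiftChain_of_dvd (dvd_zero _), h.start]; abel

theorem shiftChain_eq_of_chainLength_le (h : OrbitPair Λ c i₀ C N σ g w Q P x₀ γ) {y : ℤ → Plane}
    (hy : y ∈ diskChains N w (fun k => c (σ k) + g k) (Q 0))
    (hle : chainLength N (shiftChain N x₀ y) ≤ chainLength N P) : shiftChain N x₀ y = P := by
  have hP : shiftChain N x₀ (shiftChain N (-x₀) P) = P := shiftChain_neg_shiftChain x₀ P
  have hk' : ∀ k : ℤ, ¬ (N : ℤ) ∣ k → shiftChain N (-x₀) P k - (c (σ k) + g k)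
      = P k - (Function.update c i₀ C (σ k) + g k) := fun k hk => by
    rw [shiftChain_of_not_dvd hk, h.centre_of_not_dvd hk]
  have := eq_of_chainLength_le (v := x₀) h.period_pos h.shiftChain_mem_diskChains
    (by rw [hP]; exact h.orbit'.ne_next)
    (fun k hk => by rw [hk' k hk]; exact h.orbit'.norm_normal k)
    (fun k hk => by rw [hP, hk' k hk]; exact h.orbit'.reflection k)
    (fun k hk => by
      rw [hP, hk' k hk]
      have := h.orbit'.incoming (k - 1)
      rwa [sub_add_cancel] at this) hy (by rwa [hP])
  rw [this, hP]

theorem reflectingCentre_eq (h : OrbitPair Λ c i₀ C N σ g w Q P x₀ γ)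
    (hne : direction P 0 - direction P (-1) ≠ 0) : reflectingCentre g P = C := by
  rw [reflectingCentre, ← h.normal_eq hne]; abel

end OrbitPair

theorem shiftChain_injective {N : ℕ} {v : Plane} {y y' : ℤ → Plane}
    (h : shiftChain N v y' = shiftChain N v y) : y' = y := by
  funext k
  have := shiftChain_sub (N := N) (v := v) (y := y) (y' := y') k
  rw [h, sub_self] at this
  exact (sub_eq_zero.1 this.symm)

theorem isBilliard_update {Λ : Submodule ℤ Plane} {c : ι → Plane} (hγ0 : 0 < γ)
    (hγ : ∀ i j : ι, ∀ a ∈ Λ, (i ≠ j ∨ a ≠ 0) → 2 + 2 * γ ≤ dist (c i) (c j + a))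
    (hC : ‖C - c i₀‖ ≤ γ) : IsBilliard Λ (Function.update c i₀ C) := by
  have key : ∀ i j : ι, ∀ a ∈ Λ, (i ≠ j ∨ a ≠ 0) →
      2 < dist (Function.update c i₀ C i) (Function.update c i₀ C j + a) := by
    intro i j a ha hne
    have h1 := hγ i j a ha hne
    rw [dist_eq_norm] at h1 ⊢
    by_cases hi : i = i₀ <;> by_cases hj : j = i₀
    · subst hi hj
      simp only [Function.update_self]
      rw [show C - (C + a) = c j - (c j + a) by abel]
      linarith
    · subst hi
      rw [Function.update_self, Function.update_of_ne hj]
      have := norm_sub_norm_le (c i - (c j + a)) (C - (c j + a))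
      rw [sub_sub_sub_cancel_right, norm_sub_rev (c i) C] at this
      linarith
    · subst hj
      rw [Function.update_self, Function.update_of_ne hi]
      have := norm_sub_norm_le (c i - (c j + a)) (c i - (C + a))
      rw [sub_sub_sub_cancel_left, add_sub_add_right_eq_sub] at this
      linarith
    · rw [Function.update_of_ne hi, Function.update_of_ne hj]
      linarith
  intro i j a ha hne
  rw [Set.disjoint_left]
  intro x hx hx'
  rw [Metric.mem_closedBall] at hx hx'
  have := key i j a ha hne
  have := dist_triangle_left (Function.update c i₀ C i) (Function.update c i₀ C j + a) x
  linarith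

/-- Pushing the scatterer `i₀` along a direction in which it cannot be pushed by `s` leads to a
singular orbit. -/
theorem exists_motion_to_singular_orbit [Finite ι] [DiscreteTopology Λ] {κ₁ κ s r a σ₀ : ℝ}
    (h : IsPeriodicOrbit Λ c N σ g w Q)
    (hcode : ∀ k : ℤ, σ k = i₀ ↔ (N : ℤ) ∣ k) (hγ0 : 0 < γ)
    (hγ : ∀ i j : ι, ∀ a ∈ Λ, (i ≠ j ∨ a ≠ 0) → 2 + 2 * γ ≤ dist (c i) (c j + a))
    (hS : StepSize γ κ₁ κ s r) (hsr : s + 4 * r ≤ γ)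
    (hF : ReflectionFrame (Q 0 - (c (σ 0) + g 0)) (direction Q 0) (direction Q (-1)) a σ₀)
    {q : Plane} (hq : ‖q‖ = 1)
    (hend : ∀ (C : Plane) (P : ℤ → Plane), P 0 = Q 0 + s • q →
      ¬ IsPeriodicOrbit Λ (Function.update c i₀ C) N σ g w P) :
    ∃ (T : ℝ) (C : ℝ → Plane) (P : ℝ → ℤ → Plane),
      0 ≤ T ∧ ContinuousOn C (Set.Icc 0 T) ∧ C 0 = c i₀ ∧
      (∀ k : ℤ, ContinuousOn (fun t => P t k) (Set.Icc 0 T)) ∧ P 0 = Q ∧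
      (∀ t ∈ Set.Icc 0 T, ‖C t - c i₀‖ ≤ s + 4 * r ∧
        IsPeriodicOrbit Λ (Function.update c i₀ (C t)) N σ g w (P t)) ∧
      (∀ t ∈ Set.Ico 0 T, ¬ IsSingularOrbit Λ (Function.update c i₀ (C t)) (P t)) ∧
      IsSingularOrbit Λ (Function.update c i₀ (C T)) (P T) := by
  set K := diskChains N w (fun k => c (σ k) + g k) (Q 0) with hK
  have hQK : Q ∈ K :=
    ⟨h.Q_periodic, fun k => Metric.sphere_subset_closedBall (h.mem_boundary k), rfl⟩
  have hO := h.dist_centres hγ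
  have hsγ := hS.s_le hγ0
  have hv : ∀ t ∈ Set.Icc 0 s, ‖t • q‖ ≤ s := fun t ht => by
    rw [norm_smul, hq, mul_one, Real.norm_of_nonneg ht.1]; exact ht.2
  choose m hm hmin using fun t : ℝ => exists_chain_minimiser ⟨Q, hQK⟩ (t • q)
  set P : ℝ → ℤ → Plane := fun t => shiftChain N (t • q) (m t) with hPdef
  set C : ℝ → Plane := fun t => reflectingCentre g (P t) with hCdef
  have hP0 : ∀ t, P t 0 = Q 0 + t • q := fun t => by
    rw [hPdef]; simp only; rw [shiftChain_of_dvd (dvd_zero _), (hm t).2.2]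
  have hPne : ∀ t ∈ Set.Icc 0 s, ∀ k, P t k ≠ P t (k + 1) := fun t ht =>
    shiftChain_ne_next (hm t) hγ0 ((hv t ht).trans hsγ) hO
  have hpair : ∀ t ∈ Set.Icc 0 s, ∀ C' P', P' 0 = Q 0 + t • q →
      IsPeriodicOrbit Λ (Function.update c i₀ C') N σ g w P' →
      OrbitPair Λ c i₀ C' N σ g w Q P' (t • q) γ := fun t ht C' P' h0 h1 =>
    ⟨h, h1, hcode, hγ, hγ0, h0, (hv t ht).trans hsγ⟩
  have hcs : Continuous fun p : ℝ × (ℤ → Plane) => shiftChain N (p.1 • q) p.2 :=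
    (continuous_shiftChain (N := N)).comp
      (Continuous.prodMk (continuous_fst.smul continuous_const) continuous_snd)
  have hdet : ∀ t ∈ Set.Icc 0 s, ∀ C' P', P' 0 = Q 0 + t • q →
      IsPeriodicOrbit Λ (Function.update c i₀ C') N σ g w P' →
      P t = P' ∧ C t = C' ∧ ContinuousAt m t := by
    intro t ht C' P' h0 h1
    have hp := hpair t ht C' P' h0 h1
    have hlen : chainLength N (P t) ≤ chainLength N P' := by
      have := hmin t _ hp.shiftChain_mem_diskChains
      rwa [shiftChain_neg_shiftChain] at this
    have e1 : P t = P' := hp.shiftChain_eq_of_chainLength_le (hm t) hlen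
    refine ⟨e1, ?_, ?_⟩
    · rw [hCdef]; simp only; rw [e1]
      exact hp.reflectingCentre_eq (hp.turn_ne_zero hS (hv t ht) hF)
    · refine continuousAt_of_unique_minimiser isCompact_diskChains
        (f := fun p : ℝ × (ℤ → Plane) => chainLength N (shiftChain N (p.1 • q) p.2))
        (continuous_chainLength.comp hcs) hm hmin fun y hy hle => ?_
      exact shiftChain_injective ((hp.shiftChain_eq_of_chainLength_le hy (hle.trans hlen)).trans
        e1.symm)
  set Orb : ℝ → Prop := fun t => IsPeriodicOrbit Λ (Function.update c i₀ (C t)) N σ g w (P t)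
    with hOrb
  set Reg : ℝ → Prop := fun t => Orb t ∧ ¬ IsSingularOrbit Λ (Function.update c i₀ (C t)) (P t)
    with hReg
  have hmcont : ∀ t ∈ Set.Icc 0 s, Orb t → ContinuousAt m t := fun t ht ho =>
    (hdet t ht _ _ (hP0 t) ho).2.2
  have hPcont : ∀ t ∈ Set.Icc 0 s, Orb t → ∀ k, ContinuousAt (fun t => P t k) t := by
    intro t ht ho k
    have h1 : ContinuousAt P t :=
      ContinuousAt.comp (f := fun t => (t, m t)) hcs.continuousAt
        (continuousAt_id.prodMk (hmcont t ht ho))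
    exact (continuous_apply k).continuousAt.comp h1
  have hCcont : ∀ t ∈ Set.Icc 0 s, Orb t → ContinuousAt C t := fun t ht ho =>
    tendsto_reflectingCentre (hPcont t ht ho) (hPne t ht)
      ((hpair t ht _ _ (hP0 t) ho).turn_ne_zero hS (hv t ht) hF)
  have hCle : ∀ t ∈ Set.Icc 0 s, Orb t → ‖C t - c i₀‖ ≤ s + 4 * r := fun t ht ho =>
    (hpair t ht _ _ (hP0 t) ho).norm_centre_sub_le hS (hv t ht) hF
  have hopen : ∀ t₀ ∈ Set.Icc 0 s, Reg t₀ → ∀ᶠ t in nhdsWithin t₀ (Set.Icc 0 s), Reg t := by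
    intro t₀ ht₀ hreg
    obtain ⟨ho, hns⟩ := hreg
    have hPt : ∀ k, Filter.Tendsto (fun t => P t k) (nhdsWithin t₀ (Set.Icc 0 s))
        (nhds (P t₀ k)) := fun k => (hPcont t₀ ht₀ ho k).mono_left nhdsWithin_le_nhds
    refine ho.eventually_nonsingular
      (isBilliard_update hγ0 hγ ((hCle t₀ ht₀ ho).trans hsr)) hns
      (tendsto_update ((hCcont t₀ ht₀ ho).mono_left nhdsWithin_le_nhds)) hPt ?_
    have hturn : ∀ᶠ t in nhdsWithin t₀ (Set.Icc 0 s), ∀ l ∈ Finset.range N,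
        direction (P t) ((l : ℤ) - 1) - direction (P t) l ≠ 0 :=
      (Filter.eventually_all_finset _).2 fun l _ =>
        ((tendsto_direction hPt (hPne t₀ ht₀ _)).sub
          (tendsto_direction hPt (hPne t₀ ht₀ _))).eventually_ne
          (ho.isReflectingPolygon.turn_ne_zero (ho.outgoing_pos hns l))
    filter_upwards [hturn, self_mem_nhdsWithin] with t h1 ht
    refine ⟨isReflectingPolygon_of_minimiser h hcode hγ0 ((hv t ht).trans hsγ) hO (hm t) (hmin t)
      fun k => ?_, hPne t ht⟩
    obtain ⟨l, hl, j, rfl⟩ := exists_eq_natCast_add_mul h.period_pos k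
    have hper := shiftChain_periodic (v := t • q) (hm t).1
    rw [direction_add_mul_period hper, add_sub_right_comm, direction_add_mul_period hper]
    exact h1 l (Finset.mem_range.2 hl)
  have hzero := hdet 0 ⟨le_rfl, hS.s_pos.le⟩ (c i₀) Q (by simp) (by rwa [Function.update_eq_self])
  set B := {t | t ∈ Set.Icc 0 s ∧ ¬ Reg t} with hB
  have hsB : s ∈ B := ⟨⟨hS.s_pos.le, le_rfl⟩, fun hr => hend _ _ (hP0 s) hr.1⟩
  have hBbdd : BddBelow B := ⟨0, fun t ht => ht.1.1⟩
  set T := sInf B with hT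
  have hT0 : 0 ≤ T := le_csInf ⟨s, hsB⟩ fun t ht => ht.1.1
  have hTs : T ≤ s := csInf_le hBbdd hsB
  have hsub : ∀ t ∈ Set.Icc 0 T, t ∈ Set.Icc 0 s := fun t ht => ⟨ht.1, ht.2.trans hTs⟩
  have hreg : ∀ t ∈ Set.Ico 0 T, Reg t := by
    intro t ht
    by_contra hcon
    exact absurd (csInf_le hBbdd ⟨⟨ht.1, ht.2.le.trans hTs⟩, hcon⟩) (not_le.2 ht.2)
  have hOT : Orb T := by
    rcases hT0.eq_or_lt with h0 | h0
    · rw [← h0]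
      simp only [hOrb]
      rw [hzero.1, hzero.2.1, Function.update_eq_self]
      exact h
    have : (nhdsWithin T (Set.Ico 0 T)).NeBot := by
      rw [← mem_closure_iff_nhdsWithin_neBot, closure_Ico h0.ne]
      exact ⟨hT0, le_rfl⟩
    set F := Ultrafilter.of (nhdsWithin T (Set.Ico 0 T)) with hFdef
    have hFle : (F : Filter ℝ) ≤ nhdsWithin T (Set.Ico 0 T) := Ultrafilter.of_le _
    have hFmem : ∀ᶠ t in (F : Filter ℝ), t ∈ Set.Ico 0 T := hFle self_mem_nhdsWithin
    obtain ⟨y, hy, hFy⟩ := (isCompact_diskChains (N := N) (w := w)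
      (O := fun k => c (σ k) + g k) (A := Q 0)).ultrafilter_le_nhds (F.map m)
      (Filter.le_principal_iff.2 (Filter.mem_map.2 (Filter.univ_mem' hm)))
    set z := shiftChain N (T • q) y with hz
    have hTmem : T ∈ Set.Icc 0 s := ⟨hT0, hTs⟩
    have hlim : Filter.Tendsto P F (nhds z) :=
      Filter.Tendsto.comp (f := fun t => (t, m t)) (hcs.tendsto (T, y))
        (Filter.Tendsto.prodMk_nhds (Filter.tendsto_id'.2 (hFle.trans nhdsWithin_le_nhds)) hFy)
    have hPt : ∀ k, Filter.Tendsto (fun t => P t k) F (nhds (z k)) := tendsto_pi_nhds.1 hlim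
    have hzne := shiftChain_ne_next hy hγ0 ((hv T hTmem).trans hsγ) hO
    have hturn : 1 ≤ ‖direction z 0 - direction z (-1)‖ := by
      refine ge_of_tendsto ((tendsto_direction hPt (hzne 0)).sub
        (tendsto_direction hPt (hzne (-1)))).norm (hFmem.mono fun t ht => ?_)
      have ht' := hsub t ⟨ht.1, ht.2.le⟩
      exact (hpair t ht' _ _ (hP0 t) (hreg t ht).1).norm_turn_ge hS (hv t ht') hF
    have hCt : Filter.Tendsto C F (nhds (reflectingCentre g z)) :=
      tendsto_reflectingCentre hPt hzne (norm_pos_iff.1 (by linarith))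
    have horb : IsPeriodicOrbit Λ (Function.update c i₀ (reflectingCentre g z)) N σ g w z :=
      IsPeriodicOrbit.of_tendsto (tendsto_update hCt) hPt
        (hFmem.mono fun t ht => (hreg t ht).1) hzne
    have hz0 : z 0 = Q 0 + T • q := by rw [hz, shiftChain_of_dvd (dvd_zero _), hy.2.2]
    have := hdet T hTmem _ _ hz0 horb
    simp only [hOrb]
    rw [this.1, this.2.1]
    exact horb
  have hOrbT : ∀ t ∈ Set.Icc 0 T, Orb t := by
    intro t ht
    rcases ht.2.eq_or_lt with h1 | h1
    · rw [h1]; exact hOT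
    · exact (hreg t ⟨ht.1, h1⟩).1
  refine ⟨T, C, P, hT0, fun t ht => (hCcont t (hsub t ht) (hOrbT t ht)).continuousWithinAt,
    hzero.2.1, fun k t ht => (hPcont t (hsub t ht) (hOrbT t ht) k).continuousWithinAt, hzero.1,
    fun t ht => ⟨hCle t (hsub t ht) (hOrbT t ht), hOrbT t ht⟩, fun t ht => (hreg t ht).2, ?_⟩
  by_contra hns
  have h1 := hopen T ⟨hT0, hTs⟩ ⟨hOT, hns⟩
  have h2 : T ∈ closure B := csInf_mem_closure ⟨s, hsB⟩ hBbdd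
  rw [mem_closure_iff_frequently] at h2
  rw [eventually_nhdsWithin_iff] at h1
  obtain ⟨t, ht, ht'⟩ := (h2.and_eventually h1).exists
  exact ht.2 (ht' ht.1)

end Minimiser

theorem theorem1 {ι : Type*} [Finite ι] [DecidableEq ι]
    (Λ : Submodule ℤ Plane) [DiscreteTopology Λ] (hΛ : Λ = ⊥ ∨ IsZLattice ℝ Λ)
    (c : ι → Plane) (hc : IsBilliard Λ c)
    (α₀ : ℝ) (hα₀ : |α₀| < Real.pi / 6) (ε : ℝ) (hε : 0 < ε) :
    ∃ δ : ℝ, 0 < δ ∧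
      ∀ (i₀ : ι) (N : ℕ) (σ : ℤ → ι) (g : ℤ → Plane) (w : Plane) (Q : ℤ → Plane),
        IsPeriodicOrbit Λ c N σ g w Q →
        (∀ k : ℤ, σ k = i₀ ↔ (N : ℤ) ∣ k) →
        incidenceAngle c σ g Q 0 = |α₀| →
        PassesWithin Λ c σ g Q i₀ δ →
        ∃ (T : ℝ) (C : ℝ → Plane) (P : ℝ → ℤ → Plane),
          0 ≤ T ∧
          ContinuousOn C (Set.Icc 0 T) ∧
          C 0 = c i₀ ∧
          (∀ k : ℤ, ContinuousOn (fun γ => P γ k) (Set.Icc 0 T)) ∧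
          P 0 = Q ∧
          (∀ γ ∈ Set.Icc 0 T,
            dist (C γ) (c i₀) ≤ ε ∧
            IsBilliard Λ (Function.update c i₀ (C γ)) ∧
            IsPeriodicOrbit Λ (Function.update c i₀ (C γ)) N σ g w (P γ)) ∧
          (∀ γ ∈ Set.Ico 0 T, ¬ IsSingularOrbit Λ (Function.update c i₀ (C γ)) (P γ)) ∧
          IsSingularOrbit Λ (Function.update c i₀ (C T)) (P T) := by
  obtain ⟨G, hG0, hG⟩ := hc.exists_gap
  set γ := G / 2 with hγdef
  have hγ0 : 0 < γ := by positivity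
  have hγ : ∀ i j : ι, ∀ a ∈ Λ, (i ≠ j ∨ a ≠ 0) → 2 + 2 * γ ≤ dist (c i) (c j + a) := by
    intro i j a ha hne
    have := hG i j a ha hne
    linarith
  have hcos : Real.sqrt 3 / 2 < Real.cos |α₀| := by
    rw [← Real.cos_pi_div_six]
    exact Real.cos_lt_cos_of_nonneg_of_le_pi (abs_nonneg _) (by linarith [Real.pi_pos]) hα₀
  have hsqrt := Real.sq_sqrt (show (0 : ℝ) ≤ 3 by norm_num)
  have ha0 : 0 < Real.cos |α₀| := lt_of_le_of_lt (by positivity) hcos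
  have ha2 : 3 / 4 < Real.cos |α₀| ^ 2 := by nlinarith [Real.sqrt_nonneg 3]
  obtain ⟨s, r, κ₁, κ, δ, hS, hsr, hδ, hpush⟩ := exists_pushing_direction Λ hΛ c hγ0 hγ ha0 ha2
    (Real.cos_le_one _) (lt_min hε hγ0)
  refine ⟨δ, hδ, fun i₀ N σ g w Q h hcode hangle hpass => ?_⟩
  have hin : inner ℝ (direction Q 0) (Q 0 - (c (σ 0) + g 0)) = Real.cos |α₀| := by
    rw [← hangle, incidenceAngle, InnerProductGeometry.cos_angle, h.norm_normal 0, direction,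
      inner_smul_left, real_inner_comm]
    simp only [conj_trivial]
    rw [one_mul, div_eq_inv_mul]
  obtain ⟨q, hq, hend⟩ := hpush i₀ N σ g w Q h hcode hin hpass
  obtain ⟨T, C, P, h1, h2, h3, h4, h5, h6, h7, h8⟩ := exists_motion_to_singular_orbit h hcode hγ0 hγ
    hS (hsr.trans (min_le_right _ _)) (h.reflectionFrame ha0 ha2 hin) hq hend
  refine ⟨T, C, P, h1, h2, h3, h4, h5, fun t ht => ⟨?_, ?_, (h6 t ht).2⟩, h7, h8⟩
  · rw [dist_eq_norm]
    exact (h6 t ht).1.trans (hsr.trans (min_le_left _ _))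
  · exact isBilliard_update hγ0 hγ ((h6 t ht).1.trans (hsr.trans (min_le_right _ _)))
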